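/- Let $n\ge 2$ and let $H_n=\mathbb R^{2n+1}$ be the Heisenberg group with coordinates $(x,y,t)$, contact form $\Theta=dt+\sum_{j=1}^n(x_j\,dy_j-y_j\,dx_j)$, contact distribution $\xi=\ker\Theta$, left invariant frame $\mathring e_j=\partial_{x_j}+y_j\partial_t$, $\mathring e_{n+j}=\partial_{y_j}-x_j\partial_t$ $(1\le j\le n)$, $T=\partial_t$, CR structure $J\mathring e_j=\mathring e_{n+j}$, $J\mathring e_{n+j}=-\mathring e_j$ on $\xi$, Levi metric $G=\sum_j (dx_j^2+dy_j^2)$ on $\xi$, and pseudohermitian connection $\nabla$, determined by $\nabla\mathring e_j=\nabla\mathring e_{n+j}=\nabla T=0$. Let $\Sigma$ be an immersed $C^2$ hypersurface of $H_n$. A point of $\Sigma$ is regular if $\xi\neq T\Sigma$ there; the set of regular points (the regular part) is assumed to be $C^\infty$. On the regular part put $\xi'=(\xi\cap T\Sigma)\cap J(\xi\cap T\Sigma)$, which has rank $2n-2$; let $e_n$ be a ($G$-)unit vector in $(\xi\cap T\Sigma)\cap(\xi')^\perp$ (the characteristic direction, unique up to sign and chosen smoothly near a given point), $e_{2n}=Je_n$,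 and let $\alpha$ be the function with $\alpha e_{2n}+T\in T\Sigma$. A regular point is umbilic if the operator $v\mapsto -\nabla_v e_{2n}+\alpha Jv$ maps $\xi'$ into $\xi'$ and all its eigenvalues on $\xi'$ coincide, i.e. it acts on $\xi'$ as a multiple of the identity. Suppose that $\Sigma$ is an umbilic hypersurface, i.e. that all its regular points are umbilic. For an open subset $U$ of the regular part let $L(\xi')$ be the smallest $C^\infty(U)$-module of vector fields on $U$ that contains all smooth sections of $\xi'$ over $U$ and is closed under the Lie bracket; or, if $\xi'$ has a smooth orthonormal frame $e_1,\dots,e_{n-1},e_{n+1},\dots,e_{2n-1}$ over $U$, the smallest such module that contains the members of that frame. Then in both cases $L(\xi')$ has rank $2n-1$: at each $p\in U$ the values at $p$ of its elements form a $(2n-1)$-dimensional subspace of $T_p\Sigma$. Moreover, there is a smooth $(2n-1)$-dimensional (codimension-one) foliation of the regular part whose leaf through each point $p$ has as tangent space at $p$ the space of values at $p$ of $L(\xi')$, for every such $U\ni p$. The characteristic direction $e_n$ is transversal to every leaf of this foliation: at each point $p$ of a leaf $\ell$, $T_p\Sigma=\mathbb R e_n\oplus T_p\ell$. -/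

import Mathlib

open Set
open scoped Manifold ContDiff Topology

noncomputable section

/-! ### The Heisenberg group and its pseudohermitian structure -/

/-- The underlying manifold `ℝ²ⁿ⁺¹` of the Heisenberg group, with coordinates `(x, y, t)`.  A tangent
vector at any point is again an element `(v_x, v_y, v_t)` of this space. -/
abbrev Heis (n : ℕ) : Type := (Fin n → ℝ) × (Fin n → ℝ) × ℝ

namespace Heis

variable {n : ℕ}

/-- The vector `∑ a_j e̊_j + ∑ b_j e̊_{n+j} + c T` at `q = (x, y, t)`, where
`e̊_j = ∂/∂x_j + y_j ∂/∂t`, `e̊_{n+j} = ∂/∂y_j - x_j ∂/∂t` and `T = ∂/∂t`. -/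
def ofFrame (q : Heis n) (w : Heis n) : Heis n :=
  (w.1, w.2.1, w.2.2 + ∑ j, (q.2.1 j * w.1 j - q.1 j * w.2.1 j))

/-- The characteristic field `T = ∂/∂t`. -/
def T : Heis n := (0, 0, 1)

/-- The contact form `Θ = dt + ∑ (x_j dy_j - y_j dx_j)` at `q`. -/
def Θ (q : Heis n) : Heis n →ₗ[ℝ] ℝ where
  toFun v := v.2.2 + ∑ j, (q.1 j * v.2.1 j - q.2.1 j * v.1 j)
  map_add' v w := by
    simp only [Prod.fst_add, Prod.snd_add, Pi.add_apply]
    rw [add_add_add_comm, ← Finset.sum_add_distrib]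
    congr 1
    exact Finset.sum_congr rfl fun j _ => by ring
  map_smul' c v := by
    simp only [Prod.smul_fst, Prod.smul_snd, Pi.smul_apply, smul_eq_mul, RingHom.id_apply]
    rw [mul_add, Finset.mul_sum]
    congr 1
    exact Finset.sum_congr rfl fun j _ => by ring

/-- The contact plane `ξ` at `q`. -/
def ξ (q : Heis n) : Submodule ℝ (Heis n) := LinearMap.ker (Θ q)

/-- The components of a vector `v` at `q` in the left invariant frame `(e̊_j, e̊_{n+j}, T)`. -/
def toFrame (q : Heis n) (v : Heis n) : Heis n := (v.1, v.2.1, Θ q v)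

/-- The standard CR structure: `J e̊_j = e̊_{n+j}`, `J e̊_{n+j} = - e̊_j` (extended by `J T = 0`). -/
def J (q : Heis n) : Heis n →ₗ[ℝ] Heis n where
  toFun v := ofFrame q (-v.2.1, v.1, 0)
  map_add' v w := by
    ext j
    · simp [ofFrame, add_comm]
    · simp [ofFrame]
    · simp only [ofFrame, Prod.fst_add, Prod.snd_add, Pi.add_apply, Pi.neg_apply, zero_add]
      rw [← Finset.sum_add_distrib]
      exact Finset.sum_congr rfl fun j _ => by ring
  map_smul' c v := by
    ext j
    · simp [ofFrame]
    · simp [ofFrame]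
    · simp only [ofFrame, Prod.smul_fst, Prod.smul_snd, Pi.smul_apply, Pi.neg_apply, smul_eq_mul,
        RingHom.id_apply, zero_add]
      rw [Finset.mul_sum]
      exact Finset.sum_congr rfl fun j _ => by ring

/-- The Levi metric `G = ∑ (dx_j)² + (dy_j)²`. -/
def G (v w : Heis n) : ℝ := ∑ j, (v.1 j * w.1 j + v.2.1 j * w.2.1 j)

end Heis

/-! ### Immersed hypersurfaces of the Heisenberg group -/

section Hypersurface

variable {n : ℕ} {M : Type*} [TopologicalSpace M] [ChartedSpace (EuclideanSpace ℝ (Fin (2 * n))) M]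

/-- The differential of `f : M → H_n` at `p`. -/
def diffAt (f : M → Heis n) (p : M) : TangentSpace (𝓡 (2 * n)) p →ₗ[ℝ] Heis n :=
  (mfderiv (𝓡 (2 * n)) 𝓘(ℝ, Heis n) f p).toLinearMap

/-- The tangent plane `TΣ` at `p`, as a subspace of the tangent space of `H_n` at `f p`. -/
def tangentPlane (f : M → Heis n) (p : M) : Submodule ℝ (Heis n) := LinearMap.range (diffAt f p)

/-- The regular part `Σ \ S_Σ`: the points at which `ξ ≠ TΣ`. -/
def regularSet (f : M → Heis n) : Set M := {p | Heis.ξ (f p) ≠ tangentPlane f p}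

/-- `f` is a `C²` immersion of the `2n`-manifold `M` into `H_n`, of class `C^∞` on the regular part. -/
structure IsImmersedHypersurface (f : M → Heis n) : Prop where
  contMDiff : ContMDiff (𝓡 (2 * n)) 𝓘(ℝ, Heis n) 2 f
  immersion : ∀ p, Function.Injective (diffAt f p)
  smoothOn : ContMDiffOn (𝓡 (2 * n)) 𝓘(ℝ, Heis n) ∞ f (regularSet f)

/-- `ξ ∩ TΣ` at `p`. -/
def xiTangent (f : M → Heis n) (p : M) : Submodule ℝ (Heis n) := Heis.ξ (f p) ⊓ tangentPlane f p

/-- `ξ' = (ξ ∩ TΣ) ∩ J(ξ ∩ TΣ)` at `p`. -/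
def xiPrime (f : M → Heis n) (p : M) : Submodule ℝ (Heis n) :=
  xiTangent f p ⊓ (xiTangent f p).map (Heis.J (f p))

/-- The characteristic line `(ξ ∩ TΣ) ∩ (ξ')^⊥` at `p`, which is spanned by `e_n`. -/
def charLine (f : M → Heis n) (p : M) : Submodule ℝ (Heis n) where
  carrier := {w | w ∈ xiTangent f p ∧ ∀ v ∈ xiPrime f p, Heis.G v w = 0}
  zero_mem' := ⟨Submodule.zero_mem _, fun v _ => by simp [Heis.G]⟩
  add_mem' := by
    rintro a b ⟨ha, ha'⟩ ⟨hb, hb'⟩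
    refine ⟨Submodule.add_mem _ ha hb, fun v hv => ?_⟩
    have h : Heis.G v (a + b) = Heis.G v a + Heis.G v b := by
      simp only [Heis.G, Prod.fst_add, Prod.snd_add, Pi.add_apply]
      rw [← Finset.sum_add_distrib]
      exact Finset.sum_congr rfl fun j _ => by ring
    rw [h, ha' v hv, hb' v hv, add_zero]
  smul_mem' := by
    rintro c a ⟨ha, ha'⟩
    refine ⟨Submodule.smul_mem _ c ha, fun v hv => ?_⟩
    have h : Heis.G v (c • a) = c * Heis.G v a := by
      simp only [Heis.G, Prod.smul_fst, Prod.smul_snd, Pi.smul_apply, smul_eq_mul]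
      rw [Finset.mul_sum]
      exact Finset.sum_congr rfl fun j _ => by ring
    rw [h, ha' v hv, mul_zero]

/-- The pseudohermitian connection `∇_v W` for a field `W` of vectors of `H_n` along `f` and
`v ∈ T_p M`.  It is determined by `∇ e̊_j = ∇ e̊_{n+j} = ∇ T = 0`: one differentiates the components of
`W` in the left invariant frame. -/
def covDeriv (f : M → Heis n) (W : M → Heis n) (p : M) (v : TangentSpace (𝓡 (2 * n)) p) : Heis n :=
  Heis.ofFrame (f p) (diffAt (fun q => Heis.toFrame (f q) (W q)) p v)

/-- `e` is a smooth choice on `U` of the unit vector field `e_n ∈ (ξ ∩ TΣ) ∩ (ξ')^⊥`. -/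
structure IsCharField (f : M → Heis n) (U : Set M) (e : M → Heis n) : Prop where
  smoothOn : ContMDiffOn (𝓡 (2 * n)) 𝓘(ℝ, Heis n) ∞ e U
  mem : ∀ q ∈ U, e q ∈ charLine f q
  unit : ∀ q ∈ U, Heis.G (e q) (e q) = 1

/-- The horizontal normal `e_{2n} = J e_n`. -/
def horizontalNormal (f : M → Heis n) (e : M → Heis n) : M → Heis n := fun q => Heis.J (f q) (e q)

/-- The shape operator `𝔖(v) = -∇_v e_{2n} + α J v` at `p`, for tangent vectors `v` of `M` with
`df v ∈ ξ'` (where `J' = J`). -/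
def shapeOp (f : M → Heis n) (e : M → Heis n) (α : ℝ) (p : M) (v : TangentSpace (𝓡 (2 * n)) p) :
    Heis n :=
  -covDeriv f (horizontalNormal f e) p v + α • Heis.J (f p) (diffAt f p v)

/-- `p` is umbilic: with respect to a local choice of `e_n` near `p`, and with `α` the number such
that `α e_{2n} + T ∈ TΣ` at `p`, the shape operator maps `ξ'` into `ξ'` and all its eigenvalues there
are equal, that is, it acts on `ξ'` as a multiple of the identity.  The condition does not depend on
the choice of `e_n`, which is unique up to sign: replacing `e_n` by `-e_n` changes the signs of
`e_{2n}`, `α`, the shape operator and its eigenvalue. -/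
def IsUmbilicAt (f : M → Heis n) (p : M) : Prop :=
  ∃ (U : Set M) (e : M → Heis n) (α k : ℝ), IsOpen U ∧ p ∈ U ∧ U ⊆ regularSet f ∧
    IsCharField f U e ∧
    α • horizontalNormal f e p + Heis.T ∈ tangentPlane f p ∧
    (∀ v, diffAt f p v ∈ xiPrime f p → shapeOp f e α p v ∈ xiPrime f p) ∧
    (∀ v, diffAt f p v ∈ xiPrime f p → shapeOp f e α p v = k • diffAt f p v)

/-- All regular points are umbilic. -/
def IsUmbilicHypersurface (f : M → Heis n) : Prop := ∀ p ∈ regularSet f, IsUmbilicAt f p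

end Hypersurface

/-! ### Vector fields, Lie-bracket closure, and codimension-one foliations -/

section Manifold

variable {d : ℕ} {M : Type*} [TopologicalSpace M] [ChartedSpace (EuclideanSpace ℝ (Fin d)) M]

/-- The vector field `V` is `C^∞` on `U`. -/
def SmoothVFOn [IsManifold (𝓡 d) ∞ M] (U : Set M) (V : ∀ q : M, TangentSpace (𝓡 d) q) : Prop :=
  ContMDiffOn (𝓡 d) (𝓡 d).tangent ∞ (fun q => (⟨q, V q⟩ : TangentBundle (𝓡 d) M)) U

/-- Membership in the smallest `C^∞(U)`-module of vector fields on the open set `U` that contains `S`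
and is closed under the Lie bracket (values of fields and functions outside `U` are irrelevant). -/
inductive LieClosure (U : Set M) (S : Set (∀ q : M, TangentSpace (𝓡 d) q)) :
    (∀ q : M, TangentSpace (𝓡 d) q) → Prop
  | of (V) (hV : V ∈ S) : LieClosure U S V
  | zero : LieClosure U S (fun _ => 0)
  | add (V W) (hV : LieClosure U S V) (hW : LieClosure U S W) : LieClosure U S (fun q => V q + W q)
  | smul (g : M → ℝ) (hg : ContMDiffOn (𝓡 d) 𝓘(ℝ, ℝ) ∞ g U) (V) (hV : LieClosure U S V) :
      LieClosure U S (fun q => g q • V q)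
  | bracket (V W) (hV : LieClosure U S V) (hW : LieClosure U S W) :
      LieClosure U S (VectorField.mlieBracket (𝓡 d) V W)

/-- The subspace of `T_p M` formed by the values at `p` of the Lie-bracket closure of `S`. -/
def lieClosureAt (U : Set M) (S : Set (∀ q : M, TangentSpace (𝓡 d) q)) (p : M) :
    Submodule ℝ (TangentSpace (𝓡 d) p) :=
  Submodule.span ℝ {v | ∃ V, LieClosure U S V ∧ V p = v}

/-- A smooth codimension-one foliation of the open set `R ⊆ M`, given by a foliated atlas: smooth
charts onto open boxes, covering `R`, with a distinguished transverse coordinate, such that the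
transverse coordinate of each chart is locally a function of the transverse coordinate of any
other. -/
structure CodimOneFoliation (R : Set M) where
  charts : Set (OpenPartialHomeomorph M (EuclideanSpace ℝ (Fin d)))
  /-- the index of the transverse coordinate -/
  τ : Fin d
  mem_maximalAtlas : ∀ φ ∈ charts, φ ∈ IsManifold.maximalAtlas (𝓡 d) ∞ M
  source_subset : ∀ φ ∈ charts, φ.source ⊆ R
  box : ∀ φ ∈ charts, ∃ a b : Fin d → ℝ, φ.target = {z | ∀ i, a i < z i ∧ z i < b i}
  cover : ∀ p ∈ R, ∃ φ ∈ charts, p ∈ φ.source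
  compat : ∀ φ ∈ charts, ∀ ψ ∈ charts, ∀ p ∈ φ.source ∩ ψ.source, ∃ W ∈ 𝓝 p,
    ∀ q ∈ W, ∀ q' ∈ W, φ q τ = φ q' τ → ψ q τ = ψ q' τ

namespace CodimOneFoliation

variable {R : Set M} (F : CodimOneFoliation (d := d) R)

/-- `p` and `q` lie in a common plaque, i.e. a slice of constant transverse coordinate of a chart. -/
def SamePlaque (p q : M) : Prop :=
  ∃ φ ∈ F.charts, p ∈ φ.source ∧ q ∈ φ.source ∧ φ p F.τ = φ q F.τ

/-- The leaves: the equivalence classes of points of `R` that are joined by a chain of plaques. -/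
def leaves : Set (Set M) := {ℓ | ∃ p ∈ R, ℓ = {q | Relation.EqvGen F.SamePlaque p q}}

/-- The tangent space at `p` of the leaf through `p ∈ R`: the common tangent space of the plaques
through `p`, on which the differential of the transverse coordinate vanishes. -/
def tangent (p : M) : Submodule ℝ (TangentSpace (𝓡 d) p) :=
  ⨅ φ ∈ F.charts, ⨅ (_ : p ∈ φ.source),
    LinearMap.ker (mfderiv (𝓡 d) 𝓘(ℝ, ℝ) (fun q => φ q F.τ) p).toLinearMap

end CodimOneFoliation

end Manifold

/-! ### Sections and frames of `ξ'` -/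

section Sections

variable {n : ℕ} {M : Type*} [TopologicalSpace M] [ChartedSpace (EuclideanSpace ℝ (Fin (2 * n))) M]

/-- The smooth sections over `U` of the distribution `ξ'`, as vector fields on `M`. -/
def xiPrimeSections [IsManifold (𝓡 (2 * n)) ∞ M] (f : M → Heis n) (U : Set M) : Set (∀ q : M, TangentSpace (𝓡 (2 * n)) q) :=
  {V | SmoothVFOn U V ∧ ∀ q ∈ U, diffAt f q (V q) ∈ xiPrime f q}

/-- A smooth frame of `ξ'` (which has rank `2n-2`) over `U`, orthonormal for the Levi metric. -/
def IsOrthonormalFrame [IsManifold (𝓡 (2 * n)) ∞ M] (f : M → Heis n) (U : Set M)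
    (e : Fin (2 * n - 2) → ∀ q : M, TangentSpace (𝓡 (2 * n)) q) : Prop :=
  (∀ i, e i ∈ xiPrimeSections f U) ∧
    ∀ q ∈ U, ∀ i j, Heis.G (diffAt f q (e i q)) (diffAt f q (e j q)) = if i = j then 1 else 0

end Sections

end

/-! Write the horizontal part of the immersion as `z` with values in `ℂⁿ`, and let `N` be the
horizontal normal `e_{2n}`. The space `ξ'` is then the part of `ker Θ` on which `⟨N, dz⟩` vanishes,
and umbilicity says `dN = lam dz` on `ξ'` with the complex curvature `lam = -k + iα`. Define the
real form `η` by `⟨N, dz⟩ = i (conj lam Θ - η)`. It is 1 on `e_n`, and `ξ' = ker η ∩ ker Θ`. The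
heart of the proof is that `η` is closed (`UmbilicChart.charForm_closed`); `ker η` is then the
tangent distribution of the foliation.

Closedness comes from prolonging `dN = lam dz + η A + Θ B`. Let `e` be the lift of `e_n`, `X` a
vector of `ξ'`, and `Z` the vector of `ker η` with `Θ Z = 1` and `dz Z` a multiple of `N`.
Differentiating the equations for `⟨N, dz⟩` and `dN`, and comparing `X` with `iX`, gives `A = a N`,
`⟨N, B⟩ = 0`, and the vanishing of every component of `dη` except `dη(X, Z) = 4 Im ⟨B, dz X⟩`. It
remains to show `B = 0`. The same equations determine `d lam` up to its `Θ`-component. Symmetry of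
the second derivatives of `lam` forces `Im a + Re lam = 0` wherever `B ≠ 0`, and differentiating
this relation along the lift of `iB` gives `6‖B‖² = 0`.

Since `η` is closed, it is locally `dg` (`exists_charPotential`). Brackets of sections of `ξ'` stay
in `ker dg`. As `n ≥ 2`, the space `ξ'` contains some `w` together with `iw`, on which `dΘ = 2 Im
⟨dz, dz⟩` does not vanish, so some bracket leaves `ker Θ`. With `ξ' = ker dg ∩ ker Θ` this gives
equality of the bracket closure with `ker dg` (`IsCharPotential.lieClosureAt_eq_ker`). The functions
`g`, completed to charts, form the foliated atlas (`exists_codimOneFoliation`), and `dg(e_n) ≠ 0` is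
transversality. -/

noncomputable section

/-! ### The structure equations of an umbilic hypersurface at a point -/

section StructureEquations

open Complex ComplexConjugate

variable {E V : Type*} [NormedAddCommGroup E] [NormedSpace ℝ E] [NormedAddCommGroup V]
  [InnerProductSpace ℂ V]

/-- The structure equations at a point of an umbilic hypersurface, for the differential `ζ` of the
horizontal part of the immersion, the horizontal unit normal `N`, the contact form `Θ`, the form `η`
dual to the characteristic direction, the complex curvature `lam`, and the components `A`, `B` of
`dN - lam ζ` along `η` and `Θ`; `ddη`, `ddΘ` are the exterior derivatives. -/
structure UmbilicJet (ζ dN dA dB : E →L[ℝ] V) (dlam : E →L[ℝ] ℂ) (η Θ : E →L[ℝ] ℝ)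
    (ddη ddΘ : E → E → ℝ) (N A B : V) (lam : ℂ) : Prop where
  norm_normal : ‖N‖ = 1
  inner_normal : ∀ v, inner ℂ N (ζ v) = I * (conj lam * Θ v - η v)
  exists_tangent : ∀ (w : V) (c : ℝ), (inner ℂ N w).re = lam.im * c → ∃ v, ζ v = w ∧ Θ v = c
  dN_eq : ∀ v, dN v = lam • ζ v + (η v : ℂ) • A + (Θ v : ℂ) • B
  contact : ∀ u v, ddΘ u v = 2 * (inner ℂ (ζ u) (ζ v)).im
  re_inner_dN : ∀ v, (inner ℂ N (dN v)).re = 0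
  -- The exterior derivatives of `inner_normal` and `dN_eq`; the second derivatives of `z` and `N`
  -- have cancelled by symmetry.
  d_inner : ∀ u v, inner ℂ (dN u) (ζ v) - inner ℂ (dN v) (ζ u) =
    I * (conj (dlam u) * Θ v - conj (dlam v) * Θ u + conj lam * ddΘ u v - ddη u v)
  d_dN : ∀ u v, dlam u • ζ v - dlam v • ζ u + (η v : ℂ) • dA u - (η u : ℂ) • dA v +
    (ddη u v : ℂ) • A + (Θ v : ℂ) • dB u - (Θ u : ℂ) • dB v + (ddΘ u v : ℂ) • B = 0
  exists_horizontal : ∃ w : V, w ≠ 0 ∧ inner ℂ N w = 0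

namespace UmbilicJet

variable {ζ dN dA dB : E →L[ℝ] V} {dlam : E →L[ℝ] ℂ} {η Θ : E →L[ℝ] ℝ}
    {ddη ddΘ : E → E → ℝ} {N A B : V} {lam : ℂ}

section

variable (h : UmbilicJet ζ dN dA dB dlam η Θ ddη ddΘ N A B lam)
include h

lemma inner_self_normal : inner ℂ N N = 1 := by
  rw [inner_self_eq_norm_sq_to_K, h.norm_normal]; simp

lemma eta_eq {v : E} : (η v : ℂ) = I * inner ℂ N (ζ v) + conj lam * Θ v := by
  rw [h.inner_normal]; linear_combination -(conj lam * Θ v - η v) * I_mul_I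

/-- A complex-horizontal vector is the image of a vector in the kernel of `η` and `Θ`. -/
lemma exists_lift {w : V} (hw : inner ℂ N w = 0) : ∃ v, ζ v = w ∧ Θ v = 0 ∧ η v = 0 := by
  obtain ⟨v, hv, hv'⟩ := h.exists_tangent w 0 (by simp [hw])
  refine ⟨v, hv, hv', ?_⟩
  have := h.eta_eq (v := v)
  rw [hv, hw, hv'] at this
  simpa using this

/-- This is the lift of `e_n`, because `N = J e_n` reads `N = i e_n` in complex coordinates. -/
lemma exists_char : ∃ v, ζ v = -I • N ∧ Θ v = 0 ∧ η v = 1 := by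
  obtain ⟨v, hv, hv'⟩ := h.exists_tangent (-I • N) 0 (by
    simp [inner_smul_right, h.norm_normal])
  refine ⟨v, hv, hv', ?_⟩
  have := h.eta_eq (v := v)
  rw [hv, hv', inner_smul_right, h.inner_self_normal] at this
  simpa using this

/-- The direction of `ker η` outside `ξ'`: the multiple of `N` is the one that makes `η` vanish once
`Θ = 1`. -/
lemma exists_transversal : ∃ v, ζ v = (I * conj lam) • N ∧ Θ v = 1 ∧ η v = 0 := by
  obtain ⟨v, hv, hv'⟩ := h.exists_tangent ((I * conj lam) • N) 1 (by
    simp [h.norm_normal])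
  refine ⟨v, hv, hv', ?_⟩
  have := h.eta_eq (v := v)
  rw [hv, hv', inner_smul_right, h.inner_self_normal] at this
  have h2 : (η v : ℂ) = 0 := by rw [this, ofReal_one]; linear_combination conj lam * I_mul_I
  exact_mod_cast h2

lemma inner_eq_zero {X : E} (hΘ : Θ X = 0) (hη : η X = 0) : inner ℂ N (ζ X) = 0 := by
  rw [h.inner_normal, hΘ, hη]; simp

lemma inner_eq_zero' {X : E} (hΘ : Θ X = 0) (hη : η X = 0) : inner ℂ (ζ X) N = 0 := by
  rw [← inner_conj_symm, h.inner_eq_zero hΘ hη, map_zero]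

/-- In `d_inner` the left side is `conj lam · 2i Im ⟨ζ X, ζ Y⟩`, which is exactly the `dΘ` term on
the right. -/
lemma ddη_horizontal {X Y : E} (hΘ : Θ X = 0) (hη : η X = 0) (hΘ' : Θ Y = 0) (hη' : η Y = 0) :
    ddη X Y = 0 := by
  have h0 := h.d_inner X Y
  rw [h.dN_eq, h.dN_eq, hΘ, hη, hΘ', hη', h.contact] at h0
  simp only [ofReal_zero, zero_smul, add_zero, inner_smul_left, mul_zero, sub_zero, zero_add] at h0
  rw [← inner_conj_symm (ζ Y) (ζ X)] at h0
  have h1 : inner ℂ (ζ X) (ζ Y) - conj (inner ℂ (ζ X) (ζ Y)) =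
      (2 * (inner ℂ (ζ X) (ζ Y)).im : ℝ) * I := by
    rw [sub_conj]
  have h2 : (ddη X Y : ℂ) = 0 := by
    have : I * (ddη X Y : ℂ) = 0 := by
      push_cast at h0 h1
      linear_combination h0 - conj lam * h1
    simpa using this
  exact_mod_cast h2

/-- The equation `d_inner` at `(e, X)` makes `⟨A, ζ X⟩` purely imaginary. The same holds for the
lift of `i ζ X`, so `⟨A, ζ X⟩` is real as well. -/
lemma ddη_char_and_A {X e : E} (hΘ : Θ X = 0) (hη : η X = 0) (he : ζ e = -I • N) (hΘe : Θ e = 0)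
    (hηe : η e = 1) : ddη e X = 0 ∧ inner ℂ A (ζ X) = 0 := by
  have key : ∀ Y, Θ Y = 0 → η Y = 0 → inner ℂ A (ζ Y) = -I * ddη e Y := by
    intro Y hΘ hη
    have h0 := h.d_inner e Y
    rw [h.dN_eq, h.dN_eq, hΘ, hη, hΘe, hηe, h.contact, he] at h0
    simp only [ofReal_zero, ofReal_one, one_smul, zero_smul, add_zero, inner_smul_left,
      inner_smul_right, mul_zero, sub_zero, zero_add, inner_add_left, h.inner_eq_zero hΘ hη,
      h.inner_eq_zero' hΘ hη, zero_im] at h0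
    linear_combination h0
  obtain ⟨Y, hY, hY1, hY2⟩ := h.exists_lift (w := I • ζ X) (by
    rw [inner_smul_right, h.inner_eq_zero hΘ hη, mul_zero])
  have h1 := key X hΘ hη
  have h2 := key Y hY1 hY2
  rw [hY, inner_smul_right, h1] at h2
  have h3 : (ddη e X : ℂ) = -I * ddη e Y := by linear_combination h2 + ddη e X * I_mul_I
  have h4 : ddη e X = 0 := by
    have := congrArg re h3
    simpa using this
  exact ⟨h4, by rw [h1, h4]; simp⟩

/-- The component of `A` orthogonal to `N` lifts to a vector of `ξ'`, hence is orthogonal to `A` and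
so to itself. -/
lemma A_eq : A = inner ℂ N A • N := by
  obtain ⟨e, he, he1, he2⟩ := h.exists_char
  have h0 : inner ℂ N (A - inner ℂ N A • N) = 0 := by
    rw [inner_sub_right, inner_smul_right, h.inner_self_normal]; ring
  obtain ⟨X, hX, hX1, hX2⟩ := h.exists_lift h0
  have h1 := (h.ddη_char_and_A hX1 hX2 he he1 he2).2
  rw [hX] at h1
  have h2 : inner ℂ (A - inner ℂ N A • N) (A - inner ℂ N A • N) = 0 := by
    rw [inner_sub_left, h1, inner_smul_left, h0]; ring
  exact sub_eq_zero.1 (inner_self_eq_zero.1 h2)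

/-- Comparison of the mixed second derivatives of the normal along `X` and `iX`. -/
lemma B_eq {X Y : E} (hΘ : Θ X = 0) (hη : η X = 0) (hΘY : Θ Y = 0) (hηY : η Y = 0)
    (hY : ζ Y = I • ζ X) :
    (2 * (‖ζ X‖ : ℂ) ^ 2) • B = (dlam Y - I * dlam X) • ζ X := by
  have h0 := h.d_dN X Y
  rw [h.ddη_horizontal hΘ hη hΘY hηY, h.contact, hΘ, hη, hΘY, hηY, hY, inner_smul_right,
    inner_self_eq_norm_sq_to_K] at h0
  have h1 : (I * (((‖ζ X‖ : ℝ) : ℂ)) ^ 2).im = ‖ζ X‖ ^ 2 := by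
    rw [← ofReal_pow, I_mul_im, ofReal_re]
  have h2 : (I * ((RCLike.ofReal ‖ζ X‖ : ℂ)) ^ 2).im = ‖ζ X‖ ^ 2 := h1
  rw [h2] at h0
  push_cast at h0
  simp only [zero_smul, add_zero, sub_zero] at h0
  rw [← sub_eq_zero, ← h0]
  module

/-- By `B_eq`, `B` is a complex multiple of any nonzero horizontal `w`. -/
lemma inner_N_B : inner ℂ N B = 0 := by
  obtain ⟨w, hw, hw'⟩ := h.exists_horizontal
  obtain ⟨X, hX, hX1, hX2⟩ := h.exists_lift hw'
  obtain ⟨Y, hY, hY1, hY2⟩ := h.exists_lift (w := I • w) (by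
    rw [inner_smul_right, hw', mul_zero])
  have h1 := congrArg (inner ℂ N) (h.B_eq hX1 hX2 hY1 hY2 (by rw [hY, hX]))
  rw [inner_smul_right, inner_smul_right, hX, hw', mul_zero] at h1
  have : (2 * (‖w‖ : ℂ) ^ 2) ≠ 0 := by simp [hw]
  exact (mul_eq_zero.1 h1).resolve_left this

lemma inner_B_N : inner ℂ B N = 0 := by
  rw [← inner_conj_symm, h.inner_N_B, map_zero]

/-- This is `d_inner` at `(X, Z)`, conjugated. -/
lemma dlam_conj {X Z : E} (hΘ : Θ X = 0) (hη : η X = 0) (hZ : ζ Z = (I * conj lam) • N)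
    (hΘZ : Θ Z = 1) (hηZ : η Z = 0) :
    dlam X = ddη X Z - I * conj (inner ℂ B (ζ X)) := by
  have h0 := h.d_inner X Z
  rw [h.dN_eq, h.dN_eq, hΘ, hη, hΘZ, hηZ, h.contact, hZ] at h0
  simp only [ofReal_zero, ofReal_one, one_smul, zero_smul, add_zero, inner_smul_left,
      inner_smul_right, mul_zero, sub_zero, zero_add, inner_add_left, h.inner_eq_zero hΘ hη,
      h.inner_eq_zero' hΘ hη, zero_im, zero_sub, mul_one] at h0
  have h1 : conj (dlam X) = ddη X Z + I * inner ℂ B (ζ X) := by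
    linear_combination (conj (dlam X) - ddη X Z) * I_mul_I + I * h0
  have h2 := congrArg conj h1
  simpa [sub_eq_add_neg] using h2

/-- On complex-horizontal vectors the differential of the curvature is determined by `B`. -/
lemma dlam_horizontal {X : E} (hΘ : Θ X = 0) (hη : η X = 0) :
    dlam X = 4 * (inner ℂ B (ζ X)).im - I * conj (inner ℂ B (ζ X)) ∧
    ∀ Z, ζ Z = (I * conj lam) • N → Θ Z = 1 → η Z = 0 → ddη X Z = 4 * (inner ℂ B (ζ X)).im := by
  obtain ⟨Y, hY, hY1, hY2⟩ := h.exists_lift (w := I • ζ X) (by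
    rw [inner_smul_right, h.inner_eq_zero hΘ hη, mul_zero])
  have key : ∀ Z, ζ Z = (I * conj lam) • N → Θ Z = 1 → η Z = 0 →
      ddη X Z = 4 * (inner ℂ B (ζ X)).im := by
    intro Z hZ hZ1 hZ2
    have hX := h.dlam_conj hΘ hη hZ hZ1 hZ2
    have hY' := h.dlam_conj hY1 hY2 hZ hZ1 hZ2
    rw [hY, inner_smul_right] at hY'
    have hB := h.B_eq hΘ hη hY1 hY2 hY
    -- `B_eq` has the factor `‖ζ X‖²`. If it vanishes, `d_dN` against a vector with nonzero
    -- horizontal image gives `dlam X = 0` instead.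
    by_cases h0 : ζ X = 0
    · have hX0 : dlam X = ddη X Z := by rw [hX, h0]; simp
      have hB' : ∀ W, Θ W = 0 → η W = 0 → ζ W = 0 → dlam W = 0 := by
        intro W hW1 hW2 hW
        obtain ⟨w, hw, hw'⟩ := h.exists_horizontal
        obtain ⟨U, hU, hU1, hU2⟩ := h.exists_lift hw'
        have := h.d_dN W U
        rw [h.ddη_horizontal hW1 hW2 hU1 hU2, h.contact, hW1, hW2, hU1, hU2, hW, hU] at this
        simp only [smul_zero, ofReal_zero, zero_smul, add_zero, sub_zero, inner_zero_left, zero_im,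
          mul_zero] at this
        exact (smul_eq_zero.1 this).resolve_right hw
      rw [hB' X hΘ hη h0] at hX0
      have : ddη X Z = 0 := by exact_mod_cast hX0.symm
      rw [this, h0]; simp
    · have h1 := congrArg (inner ℂ (ζ X)) hB
      rw [inner_smul_right, inner_smul_right, inner_self_eq_norm_sq_to_K] at h1
      have hne : ((‖ζ X‖ : ℂ)) ^ 2 ≠ 0 := by simp [h0]
      have h2 : 2 * inner ℂ (ζ X) B = dlam Y - I * dlam X := by
        apply mul_right_cancel₀ hne
        have h3 : (RCLike.ofReal ‖ζ X‖ : ℂ) = (‖ζ X‖ : ℂ) := rfl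
        rw [h3] at h1
        linear_combination h1
      rw [← inner_conj_symm (ζ X) B, hX, hY'] at h2
      set s : ℂ := inner ℂ B (ζ X)
      -- The relation now reads `4 conj s = ddη Y Z - i ddη X Z`, whose imaginary part is the claim.
      have h3 := congrArg im h2
      simp at h3
      linarith
  refine ⟨?_, key⟩
  obtain ⟨Z, hZ, hZ1, hZ2⟩ := h.exists_transversal
  rw [h.dlam_conj hΘ hη hZ hZ1 hZ2, key Z hZ hZ1 hZ2]
  push_cast
  ring

/-- The unit length of `N` gives `Re ⟨N, dN e⟩ = 0`, and `dN e = -i lam N + A`. -/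
lemma re_inner_N_A : (inner ℂ N A).re = -lam.im := by
  obtain ⟨e, he, he1, he2⟩ := h.exists_char
  have := h.re_inner_dN e
  rw [h.dN_eq, he, he1, he2] at this
  simp [inner_smul_right, h.norm_normal] at this
  linarith

variable {da : E →L[ℝ] ℂ} (hA : ∀ v, dA v = da v • N + inner ℂ N A • dN v)
include hA

/-- The hypothesis `hA` is the derivative of `A = a N`, with `a = ⟨N, A⟩` and `da` its differential.
The two conclusions are the components of `d_dN e X` along `ζ X` and along `N`. -/
lemma char_derivatives {e X : E} (he : ζ e = -I • N) (hΘe : Θ e = 0) (hηe : η e = 1)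
    (hΘ : Θ X = 0) (hη : η X = 0) (hX : ζ X ≠ 0) :
    dlam e = inner ℂ N A * lam ∧ da X = I * dlam X := by
  have h0 := h.d_dN e X
  have h1 : inner ℂ (ζ e) (ζ X) = 0 := by
    rw [he, inner_smul_left, h.inner_eq_zero hΘ hη, mul_zero]
  rw [h.contact, h1, (h.ddη_char_and_A hΘ hη he hΘe hηe).1, hΘe, hηe, hΘ, hη, hA X, h.dN_eq X, hΘ,
    hη, he] at h0
  simp only [ofReal_zero, ofReal_one, one_smul, zero_smul, add_zero, sub_zero, zero_im,
    mul_zero] at h0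
  have hN := congrArg (inner ℂ N) h0
  have hX' := congrArg (inner ℂ (ζ X)) h0
  simp only [inner_sub_right, inner_add_right, inner_smul_right, h.inner_eq_zero hΘ hη,
    h.inner_eq_zero' hΘ hη, h.inner_self_normal, inner_zero_right] at hN hX'
  have hne : inner ℂ (ζ X) (ζ X) ≠ 0 := fun h => hX (inner_self_eq_zero.1 h)
  refine ⟨?_, ?_⟩
  · apply mul_right_cancel₀ hne
    linear_combination hX'
  · linear_combination -hN

/-- The imaginary part of `d_inner e Z`, once `dlam e = a lam` and `Re a = -Im lam` are inserted. -/
lemma ddη_char_transversal {e Z : E} (he : ζ e = -I • N) (hΘe : Θ e = 0) (hηe : η e = 1)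
    (hZ : ζ Z = (I * conj lam) • N) (hΘZ : Θ Z = 1) (hηZ : η Z = 0) : ddη e Z = 0 := by
  obtain ⟨w, hw, hw'⟩ := h.exists_horizontal
  obtain ⟨X, hX, hX1, hX2⟩ := h.exists_lift hw'
  have hl := (h.char_derivatives hA he hΘe hηe hX1 hX2 (by rwa [hX])).1
  have h0 := h.d_inner e Z
  have hA' : inner ℂ A N = conj (inner ℂ N A) := (inner_conj_symm _ _).symm
  rw [h.dN_eq, h.dN_eq, hΘe, hηe, hΘZ, hηZ, h.contact, he, hZ, hl] at h0
  simp only [ofReal_zero, ofReal_one, one_smul, zero_smul, add_zero, inner_smul_left,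
      inner_smul_right, mul_zero, sub_zero, inner_add_left, mul_one, h.inner_self_normal,
      h.inner_B_N, hA', map_mul, map_neg, conj_I, conj_conj] at h0
  have h1 := h.re_inner_N_A
  set a : ℂ := inner ℂ N A
  have h2 := congrArg im h0
  simp at h2
  rw [h1] at h2
  linear_combination h2

/-- The component of `d_dN e Z` along `ζ X`; the term `-2 Im lam` is `ddΘ e Z`. -/
lemma inner_dB_char {e X : E} (he : ζ e = -I • N) (hΘe : Θ e = 0) (hηe : η e = 1)
    (hΘ : Θ X = 0) (hη : η X = 0) :
    inner ℂ (dB e) (ζ X) = (conj (inner ℂ N A) - 2 * lam.im) * inner ℂ B (ζ X) := by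
  obtain ⟨Z, hZ, hΘZ, hηZ⟩ := h.exists_transversal
  have h0 := h.d_dN e Z
  rw [h.ddη_char_transversal hA he hΘe hηe hZ hΘZ hηZ, h.contact, hA Z, h.dN_eq Z, hΘZ, hηZ, hΘe,
    hηe, he, hZ] at h0
  have h1 := congrArg (fun w => inner ℂ w (ζ X)) h0
  simp only [inner_sub_left, inner_add_left, inner_smul_left, inner_smul_right, ofReal_zero,
    ofReal_one, zero_smul, h.inner_eq_zero hΘ hη, inner_zero_left, mul_zero, h.inner_self_normal,
    map_one, one_mul, sub_zero, add_zero, zero_add, mul_one, conj_ofReal] at h1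
  have h2 : (conj (-I) * (I * conj lam)).im = lam.im * (-1) * (-1) := by simp
  have h3 : (conj (-I) * (I * conj lam)) = -conj lam := by
    simp only [map_neg, conj_I, neg_neg]; linear_combination conj lam * I_mul_I
  rw [show I * (starRingEnd ℂ) lam * (starRingEnd ℂ) (-I) = -conj lam by rw [mul_comm]; exact h3] at h1
  simp only [neg_im, conj_im, neg_neg] at h1
  push_cast at h1
  linear_combination h1

/-- If the mixed second derivatives of the curvature are equal then, wherever `B ≠ 0`, the curvature
in the characteristic direction is twice the curvature in the horizontal directions. -/
lemma curvature_eq (hB : B ≠ 0) {dw : E →L[ℝ] ℂ} {w : ℂ}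
    (hNB : ∀ v, inner ℂ (dN v) B + inner ℂ N (dB v) = 0)
    (hlam : ∀ u v,
      (da u * lam + inner ℂ N A * dlam u) * η v - (da v * lam + inner ℂ N A * dlam v) * η u +
      inner ℂ N A * lam * ddη u v + dw u * Θ v - dw v * Θ u + w * ddΘ u v +
      4 * (inner ℂ (dB u) (ζ v) - inner ℂ (dB v) (ζ u)).im -
      I * conj (inner ℂ (dB u) (ζ v) - inner ℂ (dB v) (ζ u)) = 0) :
    (inner ℂ N A).im + lam.re = 0 := by
  obtain ⟨e, he, hΘe, hηe⟩ := h.exists_char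
  -- The lift of `B` itself, so that `⟨B, ζ X⟩ = ‖B‖²` is real and nonzero.
  obtain ⟨X, hX, hΘ, hη⟩ := h.exists_lift h.inner_N_B
  have hs : inner ℂ (dB e) (ζ X) - inner ℂ (dB X) (ζ e) =
      (conj (inner ℂ N A) - 2 * lam.im - I * lam) * inner ℂ B (ζ X) := by
    have h1 := congrArg conj (hNB X)
    rw [map_add, inner_conj_symm, inner_conj_symm, h.dN_eq X, hΘ, hη] at h1
    simp only [ofReal_zero, zero_smul, add_zero, inner_smul_right, map_zero] at h1
    rw [h.inner_dB_char hA he hΘe hηe hΘ hη, he, inner_smul_right]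
    linear_combination I * h1
  have h0 := hlam e X
  have hd := h.char_derivatives hA he hΘe hηe hΘ hη (by rwa [hX])
  have h1 : inner ℂ (ζ e) (ζ X) = 0 := by
    rw [he, inner_smul_left, h.inner_eq_zero hΘ hη, mul_zero]
  rw [hs, h.contact, h1, (h.ddη_char_and_A hΘ hη he hΘe hηe).1, hΘe, hηe, hΘ, hη, hd.1, hd.2,
    (h.dlam_horizontal hΘ hη).1, hX] at h0
  have hre := h.re_inner_N_A
  obtain ⟨b, hb, hb'⟩ : ∃ b : ℝ, b ≠ 0 ∧ inner ℂ B B = b :=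
    ⟨‖B‖ ^ 2, by simp [hB], by rw [inner_self_eq_norm_sq_to_K]; norm_cast⟩
  rw [hb'] at h0
  set a : ℂ := inner ℂ N A
  -- With `b = ‖B‖²` and `Re a = -Im lam`, the whole relation reduces to `-4 b (Im a + Re lam) = 0`.
  have h2 := congrArg re h0
  have h3 := congrArg im h0
  simp at h2 h3
  have h4 : b * (a.im + lam.re) = 0 := by linarith
  exact (mul_eq_zero.1 h4).resolve_left hb

-- With `B = 0` the last component `ddη X Z = 4 Im ⟨B, ζ X⟩` vanishes too. The rest is bilinear
-- bookkeeping in the splitting of `E` into `ker η ∩ ker Θ` and the lines of `e` and `Z`.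
omit hA in
lemma ddη_eq_zero (hA : ∀ v, dA v = da v • N + inner ℂ N A • dN v) (hB : B = 0)
    (hadd : ∀ u u' v, ddη (u + u') v = ddη u v + ddη u' v)
    (hsmul : ∀ (c : ℝ) u v, ddη (c • u) v = c * ddη u v)
    (hswap : ∀ u v, ddη u v = -ddη v u) (u v : E) : ddη u v = 0 := by
  obtain ⟨e, he, hΘe, hηe⟩ := h.exists_char
  obtain ⟨Z, hZ, hΘZ, hηZ⟩ := h.exists_transversal
  have hXZ : ∀ X, Θ X = 0 → η X = 0 → ddη X Z = 0 := fun X h1 h2 => by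
    rw [(h.dlam_horizontal h1 h2).2 Z hZ hΘZ hηZ, hB]; simp
  have heX : ∀ X, Θ X = 0 → η X = 0 → ddη e X = 0 := fun X h1 h2 =>
    (h.ddη_char_and_A h1 h2 he hΘe hηe).1
  have heZ := h.ddη_char_transversal hA he hΘe hηe hZ hΘZ hηZ
  have dec : ∀ v, ∃ X, Θ X = 0 ∧ η X = 0 ∧ v = X + (η v • e + Θ v • Z) := fun v =>
    ⟨v - (η v • e + Θ v • Z), by simp [hΘe, hΘZ], by simp [hηe, hηZ], by abel⟩
  have key : ∀ y x, ddη x e = 0 → ddη x Z = 0 → (∀ X, Θ X = 0 → η X = 0 → ddη x X = 0) →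
      ddη y x = 0 := by
    intro y x h1 h2 h3
    obtain ⟨X, hX1, hX2, hX⟩ := dec y
    rw [hX, hadd, hadd, hsmul, hsmul, hswap X, hswap e, hswap Z, h1, h2, h3 X hX1 hX2]
    simp
  have hee : ∀ x, ddη x x = 0 := fun x => by linarith [hswap x x]
  have he' : ∀ y, ddη y e = 0 := fun y => key y e (hee e) heZ heX
  have hZ' : ∀ y, ddη y Z = 0 := fun y => key y Z (by rw [hswap, heZ, neg_zero]) (hee Z)
    fun X h1 h2 => by rw [hswap, hXZ X h1 h2, neg_zero]
  have hX' : ∀ X, Θ X = 0 → η X = 0 → ∀ y, ddη y X = 0 := fun X h1 h2 y => key y X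
    (by rw [hswap, heX X h1 h2, neg_zero]) (hXZ X h1 h2) fun W h3 h4 => h.ddη_horizontal h1 h2 h3 h4
  exact key u v (he' v) (hZ' v) fun X h1 h2 => hX' X h1 h2 v

end

end UmbilicJet

end StructureEquations

/-! ### The form dual to the characteristic direction is closed -/

section DualFrame

variable {E : Type*} [NormedAddCommGroup E] [NormedSpace ℝ E]

/-- Two smooth 1-forms that are linearly independent at a point have a smooth dual frame near it. -/
lemma exists_dual_frame {Ω : Set E} (hΩ : IsOpen Ω) {η Θ : E → E →L[ℝ] ℝ}
    (hη : ContDiffOn ℝ ∞ η Ω) (hΘ : ContDiffOn ℝ ∞ Θ Ω) {p u₁ u₂ : E} (hp : p ∈ Ω)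
    (h₁ : η p u₁ = 1) (h₁' : Θ p u₁ = 0) (h₂ : η p u₂ = 0) (h₂' : Θ p u₂ = 1) :
    ∃ (Ω' : Set E) (e₁ e₂ : E → E), IsOpen Ω' ∧ p ∈ Ω' ∧ Ω' ⊆ Ω ∧
      ContDiffOn ℝ ∞ e₁ Ω' ∧ ContDiffOn ℝ ∞ e₂ Ω' ∧ ∀ q ∈ Ω',
        η q (e₁ q) = 1 ∧ Θ q (e₁ q) = 0 ∧ η q (e₂ q) = 0 ∧ Θ q (e₂ q) = 1 := by
  -- The determinant of `(η, Θ)` on `(u₁, u₂)`, equal to 1 at `p`. Where it is nonzero, Cramer's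
  -- rule gives the dual frame.
  set Δ : E → ℝ := fun q => η q u₁ * Θ q u₂ - η q u₂ * Θ q u₁ with hΔ
  have hc : ∀ {θ : E → E →L[ℝ] ℝ} (u : E), ContDiffOn ℝ ∞ θ Ω →
      ContDiffOn ℝ ∞ (fun q => θ q u) Ω := fun u h => h.clm_apply contDiffOn_const
  have hΔs : ContDiffOn ℝ ∞ Δ Ω :=
    ((hc u₁ hη).mul (hc u₂ hΘ)).sub ((hc u₂ hη).mul (hc u₁ hΘ))
  refine ⟨Ω ∩ Δ ⁻¹' {0}ᶜ,
    fun q => (Δ q)⁻¹ • (Θ q u₂ • u₁ - Θ q u₁ • u₂),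
    fun q => (Δ q)⁻¹ • (η q u₁ • u₂ - η q u₂ • u₁),
    hΔs.continuousOn.isOpen_inter_preimage hΩ isOpen_compl_singleton,
    ⟨hp, by simp [hΔ, h₁, h₁', h₂, h₂']⟩, inter_subset_left, ?_, ?_, ?_⟩
  · refine ((hΔs.mono inter_subset_left).inv fun q hq => hq.2).smul ?_
    exact (((hc u₂ hΘ).smul contDiffOn_const).sub
      ((hc u₁ hΘ).smul contDiffOn_const)).mono inter_subset_left
  · refine ((hΔs.mono inter_subset_left).inv fun q hq => hq.2).smul ?_
    exact (((hc u₁ hη).smul contDiffOn_const).sub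
      ((hc u₂ hη).smul contDiffOn_const)).mono inter_subset_left
  · intro q hq
    have h0 : Δ q ≠ 0 := hq.2
    simp only [map_smul, map_sub, smul_eq_mul]
    refine ⟨?_, by ring, by ring, ?_⟩
    · rw [show Θ q u₂ * η q u₁ - Θ q u₁ * η q u₂ = Δ q by simp only [hΔ]; ring, inv_mul_cancel₀ h0]
    · rw [show η q u₁ * Θ q u₂ - η q u₂ * Θ q u₁ = Δ q by simp only [hΔ], inv_mul_cancel₀ h0]

end DualFrame

/-! ### Differentiation of identities along lines -/

section LineDerivatives

variable {E F : Type*} [NormedAddCommGroup E] [NormedSpace ℝ E] [NormedAddCommGroup F]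
  [NormedSpace ℝ F]

lemma hasLineDerivAt_of_contDiffOn {Ω : Set E} (hΩ : IsOpen Ω) {g : E → F}
    (hg : ContDiffOn ℝ ∞ g Ω) {q : E} (hq : q ∈ Ω) (u : E) :
    HasLineDerivAt ℝ g (fderiv ℝ g q u) q u :=
  (((hg.contDiffAt (hΩ.mem_nhds hq)).differentiableAt (by simp)).hasFDerivAt).hasLineDerivAt u

lemma hasLineDerivAt_clm_apply {Ω : Set E} (hΩ : IsOpen Ω) {g : E → E →L[ℝ] F}
    (hg : ContDiffOn ℝ ∞ g Ω) {q : E} (hq : q ∈ Ω) (u v : E) :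
    HasLineDerivAt ℝ (fun x => g x v) (fderiv ℝ g q u v) q u := by
  have h1 := ((hg.contDiffAt (hΩ.mem_nhds hq)).differentiableAt (by simp)).hasFDerivAt
  have h2 := (h1.clm_apply (hasFDerivAt_const v q)).hasLineDerivAt u
  simpa using h2

/-- Allows an identity on an open set to be differentiated; the differentiated structure equations
are obtained this way. -/
lemma HasLineDerivAt.unique_of_eqOn {Ω : Set E} (hΩ : IsOpen Ω) {g₁ g₂ : E → F} {a b : F} {q u : E}
    (hq : q ∈ Ω) (heq : EqOn g₁ g₂ Ω) (h₁ : HasLineDerivAt ℝ g₁ a q u)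
    (h₂ : HasLineDerivAt ℝ g₂ b q u) : a = b := by
  refine HasDerivAt.unique h₁ (HasDerivAt.congr_of_eventuallyEq h₂ ?_)
  have hc : ContinuousAt (fun t : ℝ => q + t • u) 0 := by fun_prop
  have : ∀ᶠ t in 𝓝 (0 : ℝ), q + t • u ∈ Ω := hc (hΩ.mem_nhds (by simpa using hq))
  filter_upwards [this] with t ht using heq ht

lemma contDiffOn_fderiv {Ω : Set E} (hΩ : IsOpen Ω) {g : E → F} (hg : ContDiffOn ℝ ∞ g Ω) :
    ContDiffOn ℝ ∞ (fderiv ℝ g) Ω :=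
  hg.fderiv_of_isOpen hΩ (by simp)

lemma fderiv_fderiv_comm {Ω : Set E} (hΩ : IsOpen Ω) {g : E → F} (hg : ContDiffOn ℝ ∞ g Ω)
    {q : E} (hq : q ∈ Ω) (u v : E) :
    fderiv ℝ (fderiv ℝ g) q u v = fderiv ℝ (fderiv ℝ g) q v u :=
  (hg.contDiffAt (hΩ.mem_nhds hq)).isSymmSndFDerivAt (by
    rw [minSmoothness_of_isRCLikeNormedField]; norm_cast) u v

end LineDerivatives

/-! ### Umbilic hypersurfaces in a chart and closedness of `η` -/

section UmbilicChart

open Complex ComplexConjugate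

variable {E V : Type*} [NormedAddCommGroup E] [NormedSpace ℝ E] [NormedAddCommGroup V]
  [InnerProductSpace ℂ V]

lemma HasLineDerivAt.inner_complex {g₁ g₂ : E → V} {a b : V} {q u : E}
    (h₁ : HasLineDerivAt ℝ g₁ a q u) (h₂ : HasLineDerivAt ℝ g₂ b q u) :
    HasLineDerivAt ℝ (fun x => inner ℂ (g₁ x) (g₂ x)) (inner ℂ a (g₂ q) + inner ℂ (g₁ q) b) q u := by
  have := HasDerivAt.inner ℂ h₁ h₂
  simpa [HasLineDerivAt, add_comm] using this

lemma HasLineDerivAt.mul_complex {g₁ g₂ : E → ℂ} {a b : ℂ} {q u : E}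
    (h₁ : HasLineDerivAt ℝ g₁ a q u) (h₂ : HasLineDerivAt ℝ g₂ b q u) :
    HasLineDerivAt ℝ (fun x => g₁ x * g₂ x) (a * g₂ q + g₁ q * b) q u := by
  have := HasDerivAt.mul h₁ h₂
  simpa [HasLineDerivAt] using! this

lemma HasLineDerivAt.smul_complex {g₁ : E → ℂ} {g₂ : E → V} {a : ℂ} {b : V} {q u : E}
    (h₁ : HasLineDerivAt ℝ g₁ a q u) (h₂ : HasLineDerivAt ℝ g₂ b q u) :
    HasLineDerivAt ℝ (fun x => g₁ x • g₂ x) (a • g₂ q + g₁ q • b) q u := by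
  have := HasDerivAt.smul h₁ h₂
  simpa [HasLineDerivAt, add_comm] using! this

lemma HasLineDerivAt.fun_add {F : Type*} [NormedAddCommGroup F] [NormedSpace ℝ F] {g₁ g₂ : E → F}
    {a b : F} {q u : E} (h₁ : HasLineDerivAt ℝ g₁ a q u) (h₂ : HasLineDerivAt ℝ g₂ b q u) :
    HasLineDerivAt ℝ (fun x => g₁ x + g₂ x) (a + b) q u :=
  HasDerivAt.add h₁ h₂

lemma HasLineDerivAt.fun_sub {F : Type*} [NormedAddCommGroup F] [NormedSpace ℝ F] {g₁ g₂ : E → F}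
    {a b : F} {q u : E} (h₁ : HasLineDerivAt ℝ g₁ a q u) (h₂ : HasLineDerivAt ℝ g₂ b q u) :
    HasLineDerivAt ℝ (fun x => g₁ x - g₂ x) (a - b) q u :=
  HasDerivAt.sub h₁ h₂

lemma HasLineDerivAt.clm_comp {F G : Type*} [NormedAddCommGroup F] [NormedSpace ℝ F]
    [NormedAddCommGroup G] [NormedSpace ℝ G] (L : F →L[ℝ] G) {g : E → F} {a : F} {q u : E}
    (h : HasLineDerivAt ℝ g a q u) : HasLineDerivAt ℝ (fun x => L (g x)) (L a) q u :=
  L.hasFDerivAt.comp_hasDerivAt (0 : ℝ) h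

/-- The complex inner product as a continuous real bilinear map. -/
def innerReal (V : Type*) [NormedAddCommGroup V] [InnerProductSpace ℂ V] : V →L[ℝ] V →L[ℝ] ℂ :=
  (isBoundedBilinearMap_inner (𝕜 := ℂ) (E := V)).toContinuousLinearMap

/-- The form `η` dual to the characteristic direction: `⟨N, dz⟩ = i (conj lam Θ - η)`. -/
def charForm (z N : E → V) (lam : E → ℂ) (Θ : E → E →L[ℝ] ℝ) (q : E) : E →L[ℝ] ℝ :=
  -(imCLM ∘L innerReal V (N q) ∘L fderiv ℝ z q) + (lam q).re • Θ q

lemma charForm_apply (z N : E → V) (lam : E → ℂ) (Θ : E → E →L[ℝ] ℝ) (q v : E) :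
    charForm z N lam Θ q v = -(inner ℂ (N q) (fderiv ℝ z q v)).im + (lam q).re * Θ q v := by
  simp [charForm, innerReal]

/-- An umbilic hypersurface in a chart: `z` is the horizontal part of the immersion, `N` the
horizontal unit normal, `Θ` the contact form, and `lam = -k + iα`. -/
structure UmbilicChart (Ω : Set E) (z N : E → V) (lam : E → ℂ) (Θ : E → E →L[ℝ] ℝ) : Prop where
  isOpen : IsOpen Ω
  smooth_z : ContDiffOn ℝ ∞ z Ω
  smooth_N : ContDiffOn ℝ ∞ N Ω
  smooth_Θ : ContDiffOn ℝ ∞ Θ Ω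
  norm_normal : ∀ q ∈ Ω, ‖N q‖ = 1
  contact : ∀ q ∈ Ω, ∀ u v, fderiv ℝ Θ q u v - fderiv ℝ Θ q v u =
    2 * (inner ℂ (fderiv ℝ z q u) (fderiv ℝ z q v)).im
  re_inner : ∀ q ∈ Ω, ∀ v, (inner ℂ (N q) (fderiv ℝ z q v)).re = (lam q).im * Θ q v
  exists_tangent : ∀ q ∈ Ω, ∀ (w : V) (c : ℝ), (inner ℂ (N q) w).re = (lam q).im * c →
    ∃ v, fderiv ℝ z q v = w ∧ Θ q v = c
  umbilic : ∀ q ∈ Ω, ∀ v, Θ q v = 0 → inner ℂ (N q) (fderiv ℝ z q v) = 0 →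
    fderiv ℝ N q v = lam q • fderiv ℝ z q v
  exists_horizontal : ∀ q ∈ Ω, ∃ w : V, w ≠ 0 ∧ inner ℂ (N q) w = 0

namespace UmbilicChart

variable {Ω : Set E} {z N : E → V} {lam : E → ℂ} {Θ : E → E →L[ℝ] ℝ}
  (h : UmbilicChart Ω z N lam Θ)

include h

lemma mono {Ω' : Set E} (ho : IsOpen Ω') (hs : Ω' ⊆ Ω) : UmbilicChart Ω' z N lam Θ where
  isOpen := ho
  smooth_z := h.smooth_z.mono hs
  smooth_N := h.smooth_N.mono hs
  smooth_Θ := h.smooth_Θ.mono hs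
  norm_normal q hq := h.norm_normal q (hs hq)
  contact q hq := h.contact q (hs hq)
  re_inner q hq := h.re_inner q (hs hq)
  exists_tangent q hq := h.exists_tangent q (hs hq)
  umbilic q hq := h.umbilic q (hs hq)
  exists_horizontal q hq := h.exists_horizontal q (hs hq)

lemma inner_normal {q : E} (hq : q ∈ Ω) (v : E) : inner ℂ (N q) (fderiv ℝ z q v) =
    I * (conj (lam q) * Θ q v - charForm z N lam Θ q v) := by
  have h1 := h.re_inner q hq v
  have h2 := charForm_apply z N lam Θ q v
  apply Complex.ext
  · simp [h1]
  · simp [h2]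

/-- The coefficient `lam'` is free because smoothness of `lam` is not assumed; the case `lam' = 0`
is used to prove it. -/
lemma smooth_charForm_of {lam' : E → ℂ} (hlam : ContDiffOn ℝ ∞ lam' Ω) :
    ContDiffOn ℝ ∞ (charForm z N lam' Θ) Ω := by
  unfold charForm
  have h1 : ContDiffOn ℝ ∞ (fun q => innerReal V (N q)) Ω :=
    (innerReal V).contDiff.comp_contDiffOn h.smooth_N
  have h2 := contDiffOn_fderiv h.isOpen h.smooth_z
  refine ContDiffOn.add (ContDiffOn.neg ?_) (ContDiffOn.fun_smul ?_ h.smooth_Θ)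
  · exact contDiffOn_const.clm_comp (h1.clm_comp h2)
  · exact reCLM.contDiff.comp_contDiffOn hlam

lemma inner_normal_self {q : E} (hq : q ∈ Ω) : inner ℂ (N q) (N q) = 1 := by
  rw [inner_self_eq_norm_sq_to_K, h.norm_normal q hq]; simp

/-- A complex-horizontal tangent vector extends to a smooth field of such vectors. -/
lemma exists_horizontal_field {q : E} (hq : q ∈ Ω) {v : E} (hv : Θ q v = 0)
    (hv' : inner ℂ (N q) (fderiv ℝ z q v) = 0) :
    ∃ (Ω' : Set E) (X : E → E), IsOpen Ω' ∧ q ∈ Ω' ∧ Ω' ⊆ Ω ∧ ContDiffOn ℝ ∞ X Ω' ∧ X q = v ∧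
      ∀ x ∈ Ω', Θ x (X x) = 0 ∧ inner ℂ (N x) (fderiv ℝ z x (X x)) = 0 := by
  obtain ⟨u₁, h1, h2⟩ := h.exists_tangent q hq (-I • N q) 0 (by
    rw [inner_smul_right, h.inner_normal_self hq]; simp)
  obtain ⟨u₂, h3, h4⟩ := h.exists_tangent q hq (((lam q).im : ℂ) • N q) 1 (by
    rw [inner_smul_right, h.inner_normal_self hq]; simp)
  -- On `ker Θ` the form does not depend on its curvature coefficient, so 0 may replace `lam`, which
  -- is not yet known to be smooth.
  have hs := h.smooth_charForm_of (lam' := fun _ => 0) contDiffOn_const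
  obtain ⟨Ω', e₁, e₂, hΩ', hqΩ', hsub, hs₁, hs₂, hdual⟩ := exists_dual_frame h.isOpen
    hs h.smooth_Θ hq (u₁ := u₁) (u₂ := u₂)
    (by rw [charForm_apply, h1, inner_smul_right, h.inner_normal_self hq]; simp) h2
    (by rw [charForm_apply, h3, inner_smul_right, h.inner_normal_self hq]; simp) h4
  refine ⟨Ω', fun x => v - charForm z N (fun _ => 0) Θ x v • e₁ x - Θ x v • e₂ x, hΩ', hqΩ', hsub,
    ?_, ?_, fun x hx => ?_⟩
  · exact (contDiffOn_const.sub (((hs.mono hsub).clm_apply contDiffOn_const).smul hs₁)).sub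
      (((h.smooth_Θ.mono hsub).clm_apply contDiffOn_const).smul hs₂)
  · simp [charForm_apply, hv, hv']
  · obtain ⟨d1, d2, d3, d4⟩ := hdual x hx
    have hΘ : Θ x (v - charForm z N (fun _ => 0) Θ x v • e₁ x - Θ x v • e₂ x) = 0 := by
      simp [d2, d4]
    refine ⟨hΘ, Complex.ext ?_ ?_⟩
    · rw [h.re_inner x (hsub hx), hΘ]; simp
    · have h0 : charForm z N (fun _ => 0) Θ x
          (v - charForm z N (fun _ => 0) Θ x v • e₁ x - Θ x v • e₂ x) = 0 := by
        simp [d1, d3]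
      rw [charForm_apply, hΘ, mul_zero, add_zero, neg_eq_zero] at h0
      exact h0

/-- Along a smooth nonvanishing field `X` of `ξ'`, umbilicity exhibits `lam` as the quotient `⟨dz X,
dN X⟩ / ⟨dz X, dz X⟩`. -/
lemma smooth_lam : ContDiffOn ℝ ∞ lam Ω := by
  intro q hq
  obtain ⟨w, hw, hw'⟩ := h.exists_horizontal q hq
  obtain ⟨v, hv, hv'⟩ := h.exists_tangent q hq w 0 (by simp [hw'])
  obtain ⟨Ω', X, hΩ', hqΩ', hsub, hX, hXq, hXh⟩ := h.exists_horizontal_field hq hv'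
    (by rw [hv, hw'])
  have hζ := ((contDiffOn_fderiv h.isOpen h.smooth_z).mono hsub).clm_apply hX
  have hN := ((contDiffOn_fderiv h.isOpen h.smooth_N).mono hsub).clm_apply hX
  have hne : ∀ᶠ x in 𝓝 q, fderiv ℝ z x (X x) ≠ 0 :=
    (hζ.continuousOn.continuousAt (hΩ'.mem_nhds hqΩ')).eventually_ne (by rw [hXq, hv]; exact hw)
  have hne' : inner ℂ (fderiv ℝ z q (X q)) (fderiv ℝ z q (X q)) ≠ 0 := fun h0 => by
    rw [hXq, hv] at h0
    exact hw (inner_self_eq_zero.1 h0)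
  have hdiv : ContDiffAt ℝ ∞ (fun x => inner ℂ (fderiv ℝ z x (X x)) (fderiv ℝ N x (X x)) /
      inner ℂ (fderiv ℝ z x (X x)) (fderiv ℝ z x (X x))) q := by
    have hζ' := hζ.contDiffAt (hΩ'.mem_nhds hqΩ')
    have hN' := hN.contDiffAt (hΩ'.mem_nhds hqΩ')
    simp only [div_eq_mul_inv]
    exact (hζ'.inner ℂ hN').mul ((hζ'.inner ℂ hζ').inv hne')
  refine (hdiv.congr_of_eventuallyEq ?_).contDiffWithinAt
  filter_upwards [hne, hΩ'.mem_nhds hqΩ'] with x hx hxΩ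
  rw [h.umbilic x (hsub hxΩ) _ (hXh x hxΩ).1 (hXh x hxΩ).2, inner_smul_right, mul_div_assoc,
    div_self (fun h0 => hx (inner_self_eq_zero.1 h0)), mul_one]

lemma smooth_charForm : ContDiffOn ℝ ∞ (charForm z N lam Θ) Ω := h.smooth_charForm_of h.smooth_lam

/-- The derivatives of an umbilic chart at a point satisfy the structure equations. -/
lemma jet {A B : E → V} (hA : ContDiffOn ℝ ∞ A Ω) (hB : ContDiffOn ℝ ∞ B Ω)
    (hdN : ∀ q ∈ Ω, ∀ v, fderiv ℝ N q v = lam q • fderiv ℝ z q v +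
      (charForm z N lam Θ q v : ℂ) • A q + (Θ q v : ℂ) • B q) {q : E} (hq : q ∈ Ω) :
    UmbilicJet (fderiv ℝ z q) (fderiv ℝ N q) (fderiv ℝ A q) (fderiv ℝ B q) (fderiv ℝ lam q)
      (charForm z N lam Θ q) (Θ q)
      (fun u v => fderiv ℝ (charForm z N lam Θ) q u v - fderiv ℝ (charForm z N lam Θ) q v u)
      (fun u v => fderiv ℝ Θ q u v - fderiv ℝ Θ q v u) (N q) (A q) (B q) (lam q) := by
  have hΩ := h.isOpen
  have dN := fun u => hasLineDerivAt_of_contDiffOn hΩ h.smooth_N hq u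
  have dA := fun u => hasLineDerivAt_of_contDiffOn hΩ hA hq u
  have dB := fun u => hasLineDerivAt_of_contDiffOn hΩ hB hq u
  have dlam := fun u => hasLineDerivAt_of_contDiffOn hΩ h.smooth_lam hq u
  have dz := fun u v => hasLineDerivAt_clm_apply hΩ (contDiffOn_fderiv hΩ h.smooth_z) hq u v
  have ddN := fun u v => hasLineDerivAt_clm_apply hΩ (contDiffOn_fderiv hΩ h.smooth_N) hq u v
  have dΘ := fun u v => (hasLineDerivAt_clm_apply hΩ h.smooth_Θ hq u v).clm_comp ofRealCLM
  have dη := fun u v => (hasLineDerivAt_clm_apply hΩ h.smooth_charForm hq u v).clm_comp ofRealCLM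
  refine ⟨h.norm_normal q hq, h.inner_normal hq, h.exists_tangent q hq, hdN q hq,
    h.contact q hq, ?_, ?_, ?_, h.exists_horizontal q hq⟩
  · intro v
    have h1 := (dN v).inner_complex (dN v)
    have h2 : HasLineDerivAt ℝ (fun _ : E => (1 : ℂ)) 0 q v := hasDerivAt_const _ _
    have h3 := HasLineDerivAt.unique_of_eqOn hΩ hq (fun x hx => by
      rw [inner_self_eq_norm_sq_to_K, h.norm_normal x hx]; simp) h1 h2
    have h4 := congrArg re h3
    rw [← inner_conj_symm, add_re, conj_re, zero_re] at h4
    linarith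
  -- The derivative along `u` of the `inner_normal` identity at `v`. Exchanging `u` and `v` and
  -- subtracting removes the second derivative of `z`.
  · have key : ∀ u v, inner ℂ (fderiv ℝ N q u) (fderiv ℝ z q v) +
        inner ℂ (N q) (fderiv ℝ (fderiv ℝ z) q u v) =
        I * (conj (fderiv ℝ lam q u) * Θ q v + conj (lam q) * (fderiv ℝ Θ q u v) -
          fderiv ℝ (charForm z N lam Θ) q u v) := by
      intro u v
      have h1 := (dN u).inner_complex (dz u v)
      have h2 := ((((dlam u).clm_comp conjCLE.toContinuousLinearMap).mul_complex (dΘ u v)).fun_sub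
        (dη u v)).clm_comp (ContinuousLinearMap.mul ℝ ℂ I)
      have h3 := HasLineDerivAt.unique_of_eqOn hΩ hq (fun x hx => by
        simpa using h.inner_normal hx v) h1 h2
      simpa using h3
    intro u v
    have h1 := key u v
    have h2 := key v u
    rw [fderiv_fderiv_comm hΩ h.smooth_z hq v u] at h2
    push_cast
    linear_combination h1 - h2
  · have key : ∀ u v, fderiv ℝ (fderiv ℝ N) q u v = fderiv ℝ lam q u • fderiv ℝ z q v +
        lam q • fderiv ℝ (fderiv ℝ z) q u v + (fderiv ℝ (charForm z N lam Θ) q u v : ℂ) • A q +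
        (charForm z N lam Θ q v : ℂ) • fderiv ℝ A q u + (fderiv ℝ Θ q u v : ℂ) • B q +
        (Θ q v : ℂ) • fderiv ℝ B q u := by
      intro u v
      have h2 := (((dlam u).smul_complex (dz u v)).fun_add ((dη u v).smul_complex (dA u))).fun_add
        ((dΘ u v).smul_complex (dB u))
      have h3 := HasLineDerivAt.unique_of_eqOn hΩ hq (fun x hx => by
        simpa using hdN x hx v) (ddN u v) h2
      rw [h3]
      simp only [ofRealCLM_apply]
      module
    intro u v
    have h1 := key u v
    have h2 := key v u
    rw [fderiv_fderiv_comm hΩ h.smooth_z hq v u, fderiv_fderiv_comm hΩ h.smooth_N hq v u, h1] at h2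
    rw [← sub_eq_zero] at h2
    rw [← h2]
    push_cast
    module

/-- The form `η` of an umbilic hypersurface is closed. -/
theorem charForm_closed {p : E} (hp : p ∈ Ω) (u v : E) :
    fderiv ℝ (charForm z N lam Θ) p u v = fderiv ℝ (charForm z N lam Θ) p v u := by
  obtain ⟨u₁, hu₁, hu₁', u₂, hu₂, hu₂'⟩ : ∃ u₁, Θ p u₁ = 0 ∧ charForm z N lam Θ p u₁ = 1 ∧
      ∃ u₂, Θ p u₂ = 1 ∧ charForm z N lam Θ p u₂ = 0 := by
    have hN := h.inner_normal_self hp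
    obtain ⟨u₁, h1, h2⟩ := h.exists_tangent p hp (-I • N p) 0 (by
      rw [inner_smul_right, hN]; simp)
    obtain ⟨u₂, h3, h4⟩ := h.exists_tangent p hp ((I * conj (lam p)) • N p) 1 (by
      rw [inner_smul_right, hN]; simp)
    refine ⟨u₁, h2, ?_, u₂, h4, ?_⟩
    · rw [charForm_apply, h1, h2, inner_smul_right, hN]; simp
    · rw [charForm_apply, h3, h4, inner_smul_right, hN]; simp
  obtain ⟨Ω', e₁, e₂, hΩ', hpΩ', hsub, hs₁, hs₂, hdual⟩ := exists_dual_frame h.isOpen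
    h.smooth_charForm h.smooth_Θ hp hu₁' hu₁ hu₂' hu₂
  have h' := h.mono hΩ' hsub
  clear hu₁ hu₁' hu₂ hu₂' hp
  have hζ := contDiffOn_fderiv hΩ' h'.smooth_z
  have hdNs := contDiffOn_fderiv hΩ' h'.smooth_N
  -- `dN - lam dz` vanishes on `ker η ∩ ker Θ`, so it is `η A + Θ B` with its values on the dual
  -- frame as coefficients.
  set A : E → V := fun q => fderiv ℝ N q (e₁ q) - lam q • fderiv ℝ z q (e₁ q) with hAdef
  set B : E → V := fun q => fderiv ℝ N q (e₂ q) - lam q • fderiv ℝ z q (e₂ q) with hBdef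
  have hA : ContDiffOn ℝ ∞ A Ω' :=
    (hdNs.clm_apply hs₁).sub (h'.smooth_lam.smul (hζ.clm_apply hs₁))
  have hB : ContDiffOn ℝ ∞ B Ω' :=
    (hdNs.clm_apply hs₂).sub (h'.smooth_lam.smul (hζ.clm_apply hs₂))
  have hdN : ∀ q ∈ Ω', ∀ v, fderiv ℝ N q v = lam q • fderiv ℝ z q v +
      (charForm z N lam Θ q v : ℂ) • A q + (Θ q v : ℂ) • B q := by
    intro q hq v
    obtain ⟨d1, d2, d3, d4⟩ := hdual q hq
    have hX := h'.umbilic q hq (v - charForm z N lam Θ q v • e₁ q - Θ q v • e₂ q)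
      (by simp [d2, d4]) (by rw [h'.inner_normal hq]; simp [d1, d2, d3, d4])
    simp only [map_sub, map_smul] at hX
    rw [hAdef, hBdef, ← sub_eq_zero]
    rw [← sub_eq_zero] at hX
    rw [← hX]
    simp only [← Complex.coe_smul]
    module
  clear_value A B
  have jet := fun q (hq : q ∈ Ω') => h'.jet hA hB hdN hq
  set a : E → ℂ := fun q => inner ℂ (N q) (A q) with ha
  have has : ContDiffOn ℝ ∞ a Ω' := h'.smooth_N.inner ℂ hA
  -- `A = a N` holds at every point of `Ω'`, hence can be differentiated; this supplies the
  -- hypothesis `hA` of the pointwise lemmas.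
  have hda : ∀ q ∈ Ω', ∀ v, fderiv ℝ A q v = fderiv ℝ a q v • N q + a q • fderiv ℝ N q v :=
    fun q hq v => HasLineDerivAt.unique_of_eqOn hΩ' hq (fun x hx => (jet x hx).A_eq)
      (hasLineDerivAt_of_contDiffOn hΩ' hA hq v)
      ((hasLineDerivAt_of_contDiffOn hΩ' has hq v).smul_complex
        (hasLineDerivAt_of_contDiffOn hΩ' h'.smooth_N hq v))
  have hNB : ∀ q ∈ Ω', ∀ v, inner ℂ (fderiv ℝ N q v) (B q) + inner ℂ (N q) (fderiv ℝ B q v) = 0 :=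
    fun q hq v => HasLineDerivAt.unique_of_eqOn hΩ' hq (fun x hx => (jet x hx).inner_N_B)
      ((hasLineDerivAt_of_contDiffOn hΩ' h'.smooth_N hq v).inner_complex
        (hasLineDerivAt_of_contDiffOn hΩ' hB hq v)) (hasDerivAt_const _ _)
  -- The `Θ`-coefficient of `d lam` once the `B`-terms are split off. Its value is never needed,
  -- only its smoothness.
  set w : E → ℂ := fun q => fderiv ℝ lam q (e₂ q) - (4 * ((inner ℂ (B q) (fderiv ℝ z q (e₂ q))).im : ℂ) -
    I * conj (inner ℂ (B q) (fderiv ℝ z q (e₂ q)))) with hw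
  have hσs : ∀ {e : E → E}, ContDiffOn ℝ ∞ e Ω' →
      ContDiffOn ℝ ∞ (fun q => inner ℂ (B q) (fderiv ℝ z q (e q))) Ω' := fun he =>
    hB.inner ℂ (hζ.clm_apply he)
  have hdlams := contDiffOn_fderiv hΩ' h'.smooth_lam
  have hws : ContDiffOn ℝ ∞ w Ω' := by
    refine (hdlams.clm_apply hs₂).sub ((contDiffOn_const.mul ?_).sub (contDiffOn_const.mul ?_))
    · exact (ofRealCLM.contDiff.comp imCLM.contDiff).comp_contDiffOn (hσs hs₂)
    · exact conjCLE.contDiff.comp_contDiffOn (hσs hs₂)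
  have hdlam : ∀ q ∈ Ω', ∀ v, fderiv ℝ lam q v = a q * lam q * charForm z N lam Θ q v +
      w q * Θ q v + 4 * ((inner ℂ (B q) (fderiv ℝ z q v)).im : ℂ) -
      I * conj (inner ℂ (B q) (fderiv ℝ z q v)) := by
    intro q hq v
    obtain ⟨d1, d2, d3, d4⟩ := hdual q hq
    have J := jet q hq
    obtain ⟨e, he, he1, he2⟩ := J.exists_char
    obtain ⟨x, hx, hx'⟩ := J.exists_horizontal
    obtain ⟨X, hX, hX1, hX2⟩ := J.exists_lift hx'
    have h1 := (J.char_derivatives (hda q hq) he he1 he2 hX1 hX2 (by rwa [hX])).1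
    have h2 := (J.dlam_horizontal (X := v - charForm z N lam Θ q v • e - Θ q v • e₂ q)
      (by simp [he1, d4]) (by simp [he2, d3])).1
    simp only [map_sub, map_smul, ← Complex.coe_smul, inner_sub_right, he, inner_smul_right,
      J.inner_B_N, h1, mul_zero, sub_zero, smul_eq_mul] at h2
    simp only [hw]
    simp only [sub_im, mul_im, ofReal_re, ofReal_im, zero_mul, add_zero,
      map_mul, conj_ofReal, ofReal_sub, ofReal_mul] at h2
    linear_combination h2
  have hB0 : ∀ q ∈ Ω', B q = 0 := by
    intro q₀ hq₀
    by_contra hne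
    set Ω'' := Ω' ∩ B ⁻¹' {0}ᶜ
    have hΩ'' : IsOpen Ω'' := hB.continuousOn.isOpen_inter_preimage hΩ' isOpen_compl_singleton
    -- The relation is established on the whole open set where `B ≠ 0`, so that it can be
    -- differentiated at `q₀`.
    have hzero : ∀ q ∈ Ω'', (a q).im + (lam q).re = 0 := by
      intro q hq
      refine (jet q hq.1).curvature_eq (hda q hq.1) hq.2 (hNB q hq.1) (dw := fderiv ℝ w q)
        (w := w q) ?_
      have key : ∀ u v, fderiv ℝ (fderiv ℝ lam) q u v =
          (fderiv ℝ a q u * lam q + a q * fderiv ℝ lam q u) * charForm z N lam Θ q v +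
          a q * lam q * fderiv ℝ (charForm z N lam Θ) q u v +
          (fderiv ℝ w q u * Θ q v + w q * fderiv ℝ Θ q u v) +
          4 * ((inner ℂ (fderiv ℝ B q u) (fderiv ℝ z q v) +
            inner ℂ (B q) (fderiv ℝ (fderiv ℝ z) q u v)).im : ℂ) -
          I * conj (inner ℂ (fderiv ℝ B q u) (fderiv ℝ z q v) +
            inner ℂ (B q) (fderiv ℝ (fderiv ℝ z) q u v)) := by
        intro u v
        have dη := (hasLineDerivAt_clm_apply hΩ' h'.smooth_charForm hq.1 u v).clm_comp ofRealCLM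
        have dΘ := (hasLineDerivAt_clm_apply hΩ' h'.smooth_Θ hq.1 u v).clm_comp ofRealCLM
        have dσ := (hasLineDerivAt_of_contDiffOn hΩ' hB hq.1 u).inner_complex
          (hasLineDerivAt_clm_apply hΩ' hζ hq.1 u v)
        have d1 := (((hasLineDerivAt_of_contDiffOn hΩ' has hq.1 u).mul_complex
          (hasLineDerivAt_of_contDiffOn hΩ' h'.smooth_lam hq.1 u)).mul_complex dη)
        have d2 := ((hasLineDerivAt_of_contDiffOn hΩ' hws hq.1 u).mul_complex dΘ)
        have d3 := dσ.clm_comp ((ContinuousLinearMap.mul ℝ ℂ 4) ∘L ofRealCLM ∘L imCLM)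
        have d4 := dσ.clm_comp ((ContinuousLinearMap.mul ℝ ℂ I) ∘L conjCLE.toContinuousLinearMap)
        have h3 := HasLineDerivAt.unique_of_eqOn hΩ' hq.1 (fun x hx => by
          simpa using hdlam x hx v) (hasLineDerivAt_clm_apply hΩ' hdlams hq.1 u v)
          (((d1.fun_add d2).fun_add d3).fun_sub d4)
        rw [h3]
        simp
      intro u v
      have h1 := key u v
      have h2 := key v u
      rw [fderiv_fderiv_comm hΩ' h'.smooth_z hq.1 v u,
        fderiv_fderiv_comm hΩ' h'.smooth_lam hq.1 v u, h1] at h2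
      simp only [add_im, sub_im, map_add, map_sub] at h2 ⊢
      push_cast at h2 ⊢
      linear_combination h2
    have J := jet q₀ hq₀
    obtain ⟨e, he, he1, he2⟩ := J.exists_char
    -- Along the lift of `iB`, with `b = ‖B‖²`, one has `d lam = 4b - b = 3b` and `da = 3bi`. The
    -- derivative of `Im a + Re lam` is therefore `6b`.
    obtain ⟨X, hX, hX1, hX2⟩ := J.exists_lift (w := I • B q₀) (by
      rw [inner_smul_right, J.inner_N_B, mul_zero])
    have hX0 : fderiv ℝ z q₀ X ≠ 0 := by rw [hX]; simpa using hne
    have h1 := (J.char_derivatives (hda q₀ hq₀) he he1 he2 hX1 hX2 hX0).2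
    have h2 := (J.dlam_horizontal hX1 hX2).1
    have h3 : imCLM (fderiv ℝ a q₀ X) + reCLM (fderiv ℝ lam q₀ X) = 0 :=
      HasLineDerivAt.unique_of_eqOn hΩ'' (q := q₀) ⟨hq₀, hne⟩ (g₂ := fun _ => (0 : ℝ)) (u := X)
        (fun x hx => hzero x hx)
        (((hasLineDerivAt_of_contDiffOn hΩ' has hq₀ X).clm_comp imCLM).fun_add
          ((hasLineDerivAt_of_contDiffOn hΩ' h'.smooth_lam hq₀ X).clm_comp reCLM))
        (hasDerivAt_const _ _)
    obtain ⟨b, hb, hb'⟩ : ∃ b : ℝ, b ≠ 0 ∧ inner ℂ (B q₀) (B q₀) = b :=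
      ⟨‖B q₀‖ ^ 2, by simp [hne], by rw [inner_self_eq_norm_sq_to_K]; norm_cast⟩
    rw [h1, h2, hX, inner_smul_right, hb'] at h3
    simp at h3
    exact hb (by linarith)
  have J := jet p hpΩ'
  exact sub_eq_zero.1 (J.ddη_eq_zero (hda p hpΩ') (hB0 p hpΩ')
    (fun u u' v => by simp only [map_add, add_apply]; ring)
    (fun c u v => by simp only [map_smul, smul_apply, smul_eq_mul]; ring)
    (fun u v => by ring) u v)

end UmbilicChart

end UmbilicChart

/-! ### The Heisenberg group in complex coordinates -/

namespace Heis

open Complex ComplexConjugate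

variable {n : ℕ}

/-- The horizontal part of a tangent vector, `z_j = x_j + i y_j`. -/
def toComplex (n : ℕ) : Heis n →L[ℝ] EuclideanSpace ℂ (Fin n) :=
  LinearMap.toContinuousLinearMap
    { toFun := fun v => WithLp.toLp 2 fun j => (v.1 j : ℂ) + I * v.2.1 j
      map_add' := fun v w => by ext j; simp; ring
      map_smul' := fun c v => by ext j; simp; ring }

lemma toComplex_apply (v : Heis n) (j : Fin n) : toComplex n v j = (v.1 j : ℂ) + I * v.2.1 j := rfl

lemma re_inner_toComplex (v w : Heis n) :
    (inner ℂ (toComplex n v) (toComplex n w)).re = G v w := by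
  simp only [PiLp.inner_apply, toComplex_apply, re_sum, G]
  refine Finset.sum_congr rfl fun j _ => ?_
  simp; ring

lemma im_inner_toComplex (v w : Heis n) :
    (inner ℂ (toComplex n v) (toComplex n w)).im = ∑ j, (v.1 j * w.2.1 j - v.2.1 j * w.1 j) := by
  simp only [PiLp.inner_apply, toComplex_apply, im_sum]
  refine Finset.sum_congr rfl fun j _ => ?_
  simp; ring

/-- `x dy - y dx` is the imaginary part of `conj z dz`. -/
lemma Θ_apply (q v : Heis n) :
    Θ q v = v.2.2 + (inner ℂ (toComplex n q) (toComplex n v)).im := by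
  rw [im_inner_toComplex]; rfl

lemma toComplex_ofFrame (q w : Heis n) : toComplex n (ofFrame q w) = toComplex n w := rfl

lemma Θ_ofFrame (q w : Heis n) : Θ q (ofFrame q w) = w.2.2 := by
  simp only [Θ, ofFrame, LinearMap.coe_mk, AddHom.coe_mk, add_assoc, ← Finset.sum_add_distrib]
  simp

lemma toComplex_J (q v : Heis n) : toComplex n (J q v) = I • toComplex n v := by
  ext j
  simp [toComplex_apply, J, ofFrame]
  linear_combination -(v.2.1 j : ℂ) * I_mul_I

lemma Θ_J (q v : Heis n) : Θ q (J q v) = 0 := Θ_ofFrame _ _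

lemma toComplex_T : toComplex n T = 0 := by
  ext j; simp [toComplex_apply, T]

lemma Θ_T (q : Heis n) : Θ q T = 1 := by simp [Θ, T]

lemma exists_toComplex_eq (q : Heis n) (w : EuclideanSpace ℂ (Fin n)) (c : ℝ) :
    ∃ v, toComplex n v = w ∧ Θ q v = c := by
  refine ⟨ofFrame q (fun j => (w j).re, fun j => (w j).im, c), ?_, Θ_ofFrame _ _⟩
  ext j
  rw [toComplex_ofFrame, toComplex_apply]
  simpa [mul_comm] using re_add_im (w j)

lemma eq_of_toComplex_eq {q v w : Heis n} (h : toComplex n v = toComplex n w)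
    (h' : Θ q v = Θ q w) : v = w := by
  have h1 : ∀ j, (v.1 j : ℂ) + I * v.2.1 j = (w.1 j : ℂ) + I * w.2.1 j := fun j =>
    congrArg (fun x : EuclideanSpace ℂ (Fin n) => x j) h
  have h2 : v.1 = w.1 := funext fun j => by simpa using congrArg re (h1 j)
  have h3 : v.2.1 = w.2.1 := funext fun j => by simpa using congrArg im (h1 j)
  rw [Θ_apply, Θ_apply, h] at h'
  exact Prod.ext h2 (Prod.ext h3 (by linarith))

lemma mem_ξ {q v : Heis n} : v ∈ ξ q ↔ Θ q v = 0 := LinearMap.mem_ker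

/-- A hyperplane other than the contact plane has a horizontal unit normal. -/
lemma exists_unit_normal (q : Heis n) (P : Submodule ℝ (Heis n))
    (hP : Module.finrank ℝ P = 2 * n) (hne : ξ q ≠ P) :
    ∃ (ν : EuclideanSpace ℂ (Fin n)) (β : ℝ), ‖ν‖ = 1 ∧
      ∀ v, v ∈ P ↔ (inner ℂ ν (toComplex n v)).re = β * Θ q v := by
  have hfin : Module.finrank ℝ (Heis n) = 2 * n + 1 := by
    simp [Heis, Module.finrank_prod]; ring
  have hlt : P < ⊤ := lt_top_iff_ne_top.2 fun h => by
    rw [h, finrank_top, hfin] at hP; omega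
  obtain ⟨ℓ, hℓ, hℓP⟩ := Submodule.exists_le_ker_of_lt_top P hlt
  have hker : ∀ m : Heis n →ₗ[ℝ] ℝ, m ≠ 0 → Module.finrank ℝ (LinearMap.ker m) = 2 * n := by
    intro m hm
    have := Module.Dual.finrank_ker_add_one_of_ne_zero (f := m) hm
    omega
  have hPeq : P = LinearMap.ker ℓ :=
    Submodule.eq_of_le_of_finrank_eq hℓP (by rw [hP, hker ℓ hℓ])
  set L : EuclideanSpace ℂ (Fin n) →L[ℝ] ℝ := LinearMap.toContinuousLinearMap
    { toFun := fun w => ℓ (ofFrame q (fun j => (w j).re, fun j => (w j).im, 0))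
      map_add' := fun w w' => by
        rw [← map_add]; congr 1
        refine eq_of_toComplex_eq (q := q) ?_ ?_
        · rw [map_add]; simp only [toComplex_ofFrame]; ext j; simp [toComplex_apply]; ring
        · rw [map_add]; simp only [Θ_ofFrame]; simp
      map_smul' := fun c w => by
        rw [← map_smul]; congr 1
        refine eq_of_toComplex_eq (q := q) ?_ ?_
        · rw [map_smul]; simp only [toComplex_ofFrame]; ext j; simp [toComplex_apply]; ring
        · rw [map_smul]; simp only [Θ_ofFrame]; simp } with hL
  have hℓeq : ∀ v, ℓ v = L (toComplex n v) + ℓ T * Θ q v := by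
    intro v
    have : v = ofFrame q (fun j => (toComplex n v j).re, fun j => (toComplex n v j).im, 0) +
        Θ q v • T := by
      refine eq_of_toComplex_eq (q := q) ?_ ?_
      · rw [map_add, map_smul, toComplex_T, smul_zero, add_zero, toComplex_ofFrame]
        ext j; simp [toComplex_apply]
      · rw [map_add, map_smul, Θ_T, Θ_ofFrame]; simp
    conv_lhs => rw [this, map_add, map_smul]
    simp [hL, mul_comm]
  -- The real functional `L` is the real part of a complex linear one, which the Riesz theorem
  -- represents by `ν`.
  obtain ⟨ν, hν⟩ : ∃ ν : EuclideanSpace ℂ (Fin n), ∀ w, (inner ℂ ν w).re = L w := by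
    refine ⟨(InnerProductSpace.toDual ℂ _).symm (StrongDual.extendRCLike (𝕜 := ℂ) L), fun w => ?_⟩
    rw [InnerProductSpace.toDual_symm_apply]
    simp [StrongDual.extendRCLike_apply]
  have hmem : ∀ v, v ∈ P ↔ (inner ℂ ν (toComplex n v)).re = -ℓ T * Θ q v := by
    intro v
    rw [hPeq, LinearMap.mem_ker, hℓeq, hν]
    constructor <;> intro h <;> linarith
  -- If `ν = 0`, then `ℓ` is a nonzero multiple of `Θ` and the hyperplane is the contact plane.
  have hν0 : ν ≠ 0 := by
    rintro rfl
    refine hne ?_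
    have hT : ℓ T ≠ 0 := by
      intro h
      refine hℓ (LinearMap.ext fun v => ?_)
      rw [hℓeq, h, ← hν]; simp
    ext v
    rw [hmem, mem_ξ]
    simp [hT]
  have hn0 : ‖ν‖ ≠ 0 := norm_ne_zero_iff.2 hν0
  refine ⟨((‖ν‖⁻¹ : ℝ) : ℂ) • ν, -ℓ T * ‖ν‖⁻¹, ?_, fun v => ?_⟩
  · rw [norm_smul]; simp [hn0]
  · rw [hmem, inner_smul_left, conj_ofReal, re_ofReal_mul]
    constructor
    · intro h; rw [h]; ring
    · intro h
      field_simp at h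
      linarith

end Heis

/-! ### `ξ'`, the characteristic line and the tangent plane in complex coordinates -/

section Complexification

open Complex ComplexConjugate Heis

variable {n : ℕ} {M : Type*} [TopologicalSpace M] [ChartedSpace (EuclideanSpace ℝ (Fin (2 * n))) M]

lemma finrank_tangentPlane {f : M → Heis n} {p : M} (h : Function.Injective (diffAt f p)) :
    Module.finrank ℝ (tangentPlane f p) = 2 * n := by
  unfold tangentPlane
  rw [LinearMap.finrank_range_of_inj h]
  exact finrank_euclideanSpace_fin

lemma mem_xiTangent {f : M → Heis n} {p : M} {ν : EuclideanSpace ℂ (Fin n)} {β : ℝ}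
    (hT : ∀ v, v ∈ tangentPlane f p ↔ (inner ℂ ν (toComplex n v)).re = β * Θ (f p) v) {v : Heis n} :
    v ∈ xiTangent f p ↔ Θ (f p) v = 0 ∧ (inner ℂ ν (toComplex n v)).re = 0 := by
  rw [xiTangent, Submodule.mem_inf, mem_ξ, hT]
  constructor <;> rintro ⟨h1, h2⟩ <;> refine ⟨h1, ?_⟩ <;> simp_all

/-- Membership of both `v` and `Jv` in `ξ ∩ TΣ` kills the real and the imaginary part of `⟨ν, v⟩`.
Thus `ξ'` is the complex orthogonal complement of `ν` in `ξ`. -/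
lemma mem_xiPrime_of_normal {f : M → Heis n} {p : M} {ν : EuclideanSpace ℂ (Fin n)} {β : ℝ}
    (hT : ∀ v, v ∈ tangentPlane f p ↔ (inner ℂ ν (toComplex n v)).re = β * Θ (f p) v) {v : Heis n} :
    v ∈ xiPrime f p ↔ Θ (f p) v = 0 ∧ inner ℂ ν (toComplex n v) = 0 := by
  rw [xiPrime, Submodule.mem_inf, mem_xiTangent hT, Submodule.mem_map]
  constructor
  · rintro ⟨⟨h1, h2⟩, u, hu, rfl⟩
    refine ⟨h1, Complex.ext h2 ?_⟩
    rw [toComplex_J, inner_smul_right]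
    simpa using ((mem_xiTangent hT).1 hu).2
  · rintro ⟨h1, h2⟩
    refine ⟨⟨h1, by rw [h2]; rfl⟩, -J (f p) v, ?_, ?_⟩
    · rw [mem_xiTangent hT, map_neg, map_neg, Θ_J, toComplex_J, inner_neg_right, inner_smul_right, h2]
      simp
    · refine eq_of_toComplex_eq (q := f p) ?_ ?_
      · rw [toComplex_J, map_neg, toComplex_J, smul_neg, smul_smul, I_mul_I]; simp
      · rw [Θ_J, h1]

/-- The part of `v` orthogonal to `ν` over `ℂ` is in `ξ'`, hence orthogonal to `v` and so to itself.
The remaining multiple of `ν` is imaginary by tangency. -/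
lemma toComplex_of_mem_charLine {f : M → Heis n} {p : M} {ν : EuclideanSpace ℂ (Fin n)} {β : ℝ}
    (hν : ‖ν‖ = 1)
    (hT : ∀ v, v ∈ tangentPlane f p ↔ (inner ℂ ν (toComplex n v)).re = β * Θ (f p) v) {v : Heis n}
    (hv : v ∈ charLine f p) : Θ (f p) v = 0 ∧ ∃ r : ℝ, toComplex n v = (r * I) • ν := by
  obtain ⟨h1, h2⟩ := hv
  rw [mem_xiTangent hT] at h1
  have hνν : inner ℂ ν ν = 1 := by rw [inner_self_eq_norm_sq_to_K, hν]; simp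
  refine ⟨h1.1, (inner ℂ ν (toComplex n v)).im, ?_⟩
  set w := toComplex n v
  have hw : inner ℂ ν w = ((inner ℂ ν w).im : ℂ) * I := by
    apply Complex.ext <;> simp [h1.2]
  rw [← hw, ← sub_eq_zero]
  set x := w - inner ℂ ν w • ν with hx
  have hx0 : inner ℂ ν x = 0 := by
    rw [hx, inner_sub_right, inner_smul_right, hνν]; ring
  obtain ⟨u, hu, hu'⟩ := exists_toComplex_eq (f p) x 0
  have h3 := h2 u ((mem_xiPrime_of_normal hT).2 ⟨hu', by rw [hu, hx0]⟩)
  rw [← re_inner_toComplex, hu] at h3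
  have hxx : inner ℂ x x = inner ℂ x w := by
    conv_lhs => rw [hx, inner_sub_right, inner_smul_right, ← hx, ← inner_conj_symm x ν, hx0]
    simp
  have h4 : (inner ℂ x x).re = 0 := by rw [hxx]; exact h3
  rw [inner_self_eq_norm_sq_to_K] at h4
  have h5 : ‖x‖ ^ 2 = 0 := by
    have : (((RCLike.ofReal ‖x‖ : ℂ)) ^ 2).re = ‖x‖ ^ 2 := by
      rw [show (RCLike.ofReal ‖x‖ : ℂ) = ((‖x‖ : ℝ) : ℂ) from rfl, ← ofReal_pow, ofReal_re]
    rw [← this]; exact h4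
  simpa using h5

/-- The horizontal normal `J e` in complex coordinates. -/
def complexNormal (e : M → Heis n) (q : M) : EuclideanSpace ℂ (Fin n) := I • toComplex n (e q)

/-- At a regular point the horizontal normal determines the tangent plane up to the slope `α`. -/
lemma exists_slope {f : M → Heis n} {p : M} (hf : Function.Injective (diffAt f p))
    (hp : p ∈ regularSet f) {e : M → Heis n} (he : e p ∈ charLine f p) (he1 : G (e p) (e p) = 1) :
    ‖complexNormal e p‖ = 1 ∧ ∃ α : ℝ, ∀ v, v ∈ tangentPlane f p ↔
      (inner ℂ (complexNormal e p) (toComplex n v)).re = α * Θ (f p) v := by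
  obtain ⟨ν, β, hν, hT⟩ := exists_unit_normal (f p) (tangentPlane f p) (finrank_tangentPlane hf) hp
  obtain ⟨-, r, hr⟩ := toComplex_of_mem_charLine hν hT he
  -- The normal `J e` is a real multiple of `ν`, so it defines the same plane with the slope
  -- rescaled by `-r`.
  have hN : complexNormal e p = ((-r : ℝ) : ℂ) • ν := by
    rw [complexNormal, hr, smul_smul]; congr 1; push_cast; linear_combination (r : ℂ) * I_mul_I
  have hnorm : ‖complexNormal e p‖ = 1 := by
    rw [← re_inner_toComplex, inner_self_eq_norm_sq_to_K] at he1
    rw [complexNormal, norm_smul, norm_I, one_mul]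
    have h2 : ‖toComplex n (e p)‖ ^ 2 = 1 := by
      rw [← he1, show (RCLike.ofReal ‖toComplex n (e p)‖ : ℂ) =
        ((‖toComplex n (e p)‖ : ℝ) : ℂ) from rfl, ← ofReal_pow, ofReal_re]
    exact (pow_eq_one_iff_of_nonneg (norm_nonneg _) two_ne_zero).1 h2
  refine ⟨hnorm, -r * β, fun v => ?_⟩
  have hr0 : r ≠ 0 := by
    rintro rfl
    rw [hN] at hnorm
    simp at hnorm
  rw [hT, hN, inner_smul_left, conj_ofReal, re_ofReal_mul, mul_assoc]
  exact (mul_right_inj' (neg_ne_zero.2 hr0)).symm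

/-- The characteristic line is spanned by `e`. -/
lemma mem_charLine_iff {f : M → Heis n} {p : M} {e : M → Heis n} {α : ℝ}
    (h1 : ‖complexNormal e p‖ = 1) (hT : ∀ v, v ∈ tangentPlane f p ↔
      (inner ℂ (complexNormal e p) (toComplex n v)).re = α * Θ (f p) v)
    (he : e p ∈ charLine f p) {v : Heis n} :
    v ∈ charLine f p ↔ ∃ r : ℝ, v = r • e p := by
  constructor
  · intro hv
    obtain ⟨h2, r, hr⟩ := toComplex_of_mem_charLine h1 hT hv
    refine ⟨-r, eq_of_toComplex_eq (q := f p) ?_ ?_⟩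
    · rw [hr, complexNormal, smul_smul, map_smul, ← Complex.coe_smul]
      congr 1; push_cast; linear_combination (r : ℂ) * I_mul_I
    · rw [h2, map_smul, (toComplex_of_mem_charLine h1 hT he).1, smul_zero]
  · rintro ⟨r, rfl⟩
    exact Submodule.smul_mem _ _ he

end Complexification

/-! ### The contact form and Lie brackets on a vector space -/

section ChartPullback

open Complex ComplexConjugate Heis

variable {n : ℕ} {E : Type*} [NormedAddCommGroup E] [NormedSpace ℝ E]

/-- The pullback of the contact form under `F : E → H_n`. -/
def contactPullback (F : E → Heis n) (q : E) : E →L[ℝ] ℝ :=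
  fderiv ℝ (fun x => (F x).2.2) q +
    imCLM ∘L innerReal _ (toComplex n (F q)) ∘L fderiv ℝ (fun x => toComplex n (F x)) q

lemma fderiv_toComplex_comp {F : E → Heis n} {q : E} (hF : DifferentiableAt ℝ F q) (v : E) :
    fderiv ℝ (fun x => toComplex n (F x)) q v = toComplex n (fderiv ℝ F q v) := by
  have := ((toComplex n).hasFDerivAt.comp q hF.hasFDerivAt).fderiv
  exact congrArg (fun L : E →L[ℝ] _ => L v) this

lemma contactPullback_apply {F : E → Heis n} {q : E} (hF : DifferentiableAt ℝ F q) (v : E) :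
    contactPullback F q v = Θ (F q) (fderiv ℝ F q v) := by
  have h1 : fderiv ℝ (fun x => (F x).2.2) q v = (fderiv ℝ F q v).2.2 := by
    have := (((ContinuousLinearMap.snd ℝ (Fin n → ℝ) ℝ).comp (ContinuousLinearMap.snd ℝ (Fin n → ℝ)
      ((Fin n → ℝ) × ℝ))).hasFDerivAt.comp q hF.hasFDerivAt).fderiv
    exact congrArg (fun L : E →L[ℝ] ℝ => L v) this
  rw [Θ_apply, ← fderiv_toComplex_comp hF, ← h1]
  simp [contactPullback, innerReal]

lemma contDiffOn_contactPullback {Ω : Set E} (hΩ : IsOpen Ω) {F : E → Heis n}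
    (hF : ContDiffOn ℝ ∞ F Ω) : ContDiffOn ℝ ∞ (contactPullback F) Ω := by
  have hz : ContDiffOn ℝ ∞ (fun x => toComplex n (F x)) Ω := (toComplex n).contDiff.comp_contDiffOn hF
  refine (contDiffOn_fderiv hΩ hF.snd.snd).add ?_
  exact contDiffOn_const.clm_comp
    (((innerReal _).contDiff.comp_contDiffOn hz).clm_comp (contDiffOn_fderiv hΩ hz))

lemma fderiv_contactPullback {Ω : Set E} (hΩ : IsOpen Ω) {F : E → Heis n}
    (hF : ContDiffOn ℝ ∞ F Ω) {q : E} (hq : q ∈ Ω) (u v : E) :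
    fderiv ℝ (contactPullback F) q u v - fderiv ℝ (contactPullback F) q v u =
      2 * (inner ℂ (fderiv ℝ (fun x => toComplex n (F x)) q u)
        (fderiv ℝ (fun x => toComplex n (F x)) q v)).im := by
  have hz : ContDiffOn ℝ ∞ (fun x => toComplex n (F x)) Ω := (toComplex n).contDiff.comp_contDiffOn hF
  have ht := hF.snd.snd
  -- The second derivatives of `t` and `z` are symmetric, so only `Im ⟨dz u, dz v⟩` survives
  -- antisymmetrisation.
  have key : ∀ u v, fderiv ℝ (contactPullback F) q u v =
      fderiv ℝ (fderiv ℝ (fun x => (F x).2.2)) q u v +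
      (inner ℂ (fderiv ℝ (fun x => toComplex n (F x)) q u)
        (fderiv ℝ (fun x => toComplex n (F x)) q v) +
      inner ℂ (toComplex n (F q)) (fderiv ℝ (fderiv ℝ (fun x => toComplex n (F x))) q u v)).im := by
    intro u v
    have h1 := hasLineDerivAt_clm_apply hΩ (contDiffOn_fderiv hΩ ht) hq u v
    have h2 := ((hasLineDerivAt_of_contDiffOn hΩ hz hq u).inner_complex
      (hasLineDerivAt_clm_apply hΩ (contDiffOn_fderiv hΩ hz) hq u v)).clm_comp imCLM
    exact HasLineDerivAt.unique_of_eqOn hΩ hq (fun x hx => by simp [contactPullback, innerReal])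
      (hasLineDerivAt_clm_apply hΩ (contDiffOn_contactPullback hΩ hF) hq u v) (h1.fun_add h2)
  rw [key, key, fderiv_fderiv_comm hΩ ht hq v u, fderiv_fderiv_comm hΩ hz hq v u,
    ← inner_conj_symm (fderiv ℝ (fun x => toComplex n (F x)) q v)]
  simp only [add_im, conj_im]
  ring

/-- The Lie bracket of two vector fields in the kernel of a 1-form. -/
lemma apply_lieBracket {θ : E → E →L[ℝ] ℝ} {X Y : E → E} {q : E} (hθ : DifferentiableAt ℝ θ q)
    (hX : DifferentiableAt ℝ X q) (hY : DifferentiableAt ℝ Y q)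
    (h1 : ∀ᶠ x in 𝓝 q, θ x (X x) = 0) (h2 : ∀ᶠ x in 𝓝 q, θ x (Y x) = 0) :
    θ q (VectorField.lieBracket ℝ X Y q) = fderiv ℝ θ q (Y q) (X q) - fderiv ℝ θ q (X q) (Y q) := by
  -- Differentiating `θ(W) = 0` moves the derivative from `W` to `θ`.
  have key : ∀ {W : E → E}, DifferentiableAt ℝ W q → (∀ᶠ x in 𝓝 q, θ x (W x) = 0) → ∀ u,
      θ q (fderiv ℝ W q u) = -fderiv ℝ θ q u (W q) := by
    intro W hW h u
    have h3 := (hθ.hasFDerivAt.clm_apply hW.hasFDerivAt)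
    have h4 : HasFDerivAt (fun x => θ x (W x)) (0 : E →L[ℝ] ℝ) q :=
      (hasFDerivAt_const (0 : ℝ) q).congr_of_eventuallyEq h
    have h5 := congrArg (fun L : E →L[ℝ] ℝ => L u) (h3.unique h4)
    simp at h5
    linarith
  rw [VectorField.lieBracket_eq, map_sub, key hY h2, key hX h1]
  ring

end ChartPullback

/-! ### Transport of differentials and brackets to the preferred chart -/

section ChartTransport

variable {d : ℕ} {M : Type*} [TopologicalSpace M] [ChartedSpace (EuclideanSpace ℝ (Fin d)) M]
  [IsManifold (𝓡 d) ∞ M]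

/-- The differential of the preferred chart at `p`. -/
def chartDeriv (p x : M) : TangentSpace (𝓡 d) x →L[ℝ] EuclideanSpace ℝ (Fin d) :=
  mfderiv (𝓡 d) (𝓡 d) (chartAt (EuclideanSpace ℝ (Fin d)) p) x

instance isManifold_one : IsManifold (𝓡 d) 1 M := IsManifold.of_le (n := ∞) (by norm_cast)

lemma chartDeriv_bijective {p x : M} (hx : x ∈ (chartAt (EuclideanSpace ℝ (Fin d)) p).source) :
    Function.Bijective (chartDeriv (d := d) p x) :=
  (mdifferentiable_chart (I := 𝓡 d) p).mfderiv_bijective hx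

lemma mfderiv_eq_chartDeriv {F : Type*} [NormedAddCommGroup F] [NormedSpace ℝ F] {g : M → F}
    {p x : M} (hx : x ∈ (chartAt (EuclideanSpace ℝ (Fin d)) p).source)
    (hg : MDifferentiableAt (𝓡 d) 𝓘(ℝ, F) g x) (v : TangentSpace (𝓡 d) x) :
    mfderiv (𝓡 d) 𝓘(ℝ, F) g x v =
      fderiv ℝ (g ∘ (chartAt (EuclideanSpace ℝ (Fin d)) p).symm)
        (chartAt (EuclideanSpace ℝ (Fin d)) p x) (chartDeriv p x v) := by
  set φ := chartAt (EuclideanSpace ℝ (Fin d)) p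
  have h1 : g =ᶠ[𝓝 x] (g ∘ φ.symm) ∘ φ := by
    filter_upwards [φ.open_source.mem_nhds hx] with y hy
    simp [φ.left_inv hy]
  have h2 : MDifferentiableAt (𝓡 d) 𝓘(ℝ, F) (g ∘ φ.symm) (φ x) := by
    refine MDifferentiableAt.comp (I' := 𝓡 d) (φ x) ?_
      ((mdifferentiable_chart (I := 𝓡 d) p).mdifferentiableAt_symm (φ.map_source hx))
    rwa [φ.left_inv hx]
  have h3 : MDifferentiableAt (𝓡 d) (𝓡 d) φ x :=
    (mdifferentiable_chart (I := 𝓡 d) p).mdifferentiableAt hx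
  rw [h1.mfderiv_eq, mfderiv_comp (I' := 𝓡 d) x h2 h3]
  simp only [mfderiv_eq_fderiv]
  rfl

lemma contDiffOn_comp_chart_symm {F : Type*} [NormedAddCommGroup F] [NormedSpace ℝ F] {g : M → F}
    {s : Set M} {Ω : Set (EuclideanSpace ℝ (Fin d))} {p : M}
    (hΩ : Ω ⊆ (chartAt (EuclideanSpace ℝ (Fin d)) p).target)
    (hΩs : MapsTo (chartAt (EuclideanSpace ℝ (Fin d)) p).symm Ω s)
    (hg : ContMDiffOn (𝓡 d) 𝓘(ℝ, F) ∞ g s) :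
    ContDiffOn ℝ ∞ (g ∘ (chartAt (EuclideanSpace ℝ (Fin d)) p).symm) Ω := by
  rw [← contMDiffOn_iff_contDiffOn]
  exact hg.comp (contMDiffOn_chart_symm.mono hΩ) hΩs

/-- A vector field in the chart at `p`. -/
def chartField (p : M) (V : ∀ x : M, TangentSpace (𝓡 d) x) :
    EuclideanSpace ℝ (Fin d) → EuclideanSpace ℝ (Fin d) :=
  VectorField.mpullbackWithin 𝓘(ℝ, EuclideanSpace ℝ (Fin d)) (𝓡 d) (extChartAt (𝓡 d) p).symm V
    (range (𝓡 d))

/-- The Lie bracket of two vector fields in the kernel of a 1-form given in the chart at `p`. -/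
lemma apply_mlieBracket {V W : ∀ x : M, TangentSpace (𝓡 d) x} {p : M} {U : Set M} (hU : IsOpen U)
    (hp : p ∈ U) (hV : SmoothVFOn U V) (hW : SmoothVFOn U W)
    {θ : EuclideanSpace ℝ (Fin d) → EuclideanSpace ℝ (Fin d) →L[ℝ] ℝ}
    (hθ : DifferentiableAt ℝ θ (chartAt (EuclideanSpace ℝ (Fin d)) p p))
    (h1 : ∀ᶠ x in 𝓝 p, θ (chartAt (EuclideanSpace ℝ (Fin d)) p x) (chartDeriv p x (V x)) = 0)
    (h2 : ∀ᶠ x in 𝓝 p, θ (chartAt (EuclideanSpace ℝ (Fin d)) p x) (chartDeriv p x (W x)) = 0) :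
    θ (chartAt (EuclideanSpace ℝ (Fin d)) p p)
        (chartDeriv p p (VectorField.mlieBracket (𝓡 d) V W p)) =
      fderiv ℝ θ (chartAt (EuclideanSpace ℝ (Fin d)) p p) (chartDeriv p p (W p))
        (chartDeriv p p (V p)) -
      fderiv ℝ θ (chartAt (EuclideanSpace ℝ (Fin d)) p p) (chartDeriv p p (V p))
        (chartDeriv p p (W p)) := by
  set φ := chartAt (EuclideanSpace ℝ (Fin d)) p with hφ
  have hφp : p ∈ φ.source := mem_chart_source _ p
  have hext : ∀ {V : ∀ x : M, TangentSpace (𝓡 d) x}, ∀ y ∈ φ.target,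
      chartField p V y = chartDeriv p (φ.symm y) (V (φ.symm y)) := by
    intro V y hy
    have hy' : y ∈ (extChartAt (𝓡 d) p).target := by simpa [hφ] using! hy
    rw [chartField, VectorField.mpullbackWithin_apply]
    rw [ContinuousLinearMap.inverse_eq (mfderivWithin_extChartAt_symm_comp_mfderiv_extChartAt hy')
      (mfderiv_extChartAt_comp_mfderivWithin_extChartAt_symm hy')]
    rfl
  have huniv : (extChartAt (𝓡 d) p).symm ⁻¹' univ ∩ range (𝓡 d) = univ := by simp
  have hdiff : ∀ {V : ∀ x : M, TangentSpace (𝓡 d) x}, SmoothVFOn U V →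
      DifferentiableAt ℝ (chartField p V) (φ p) := by
    intro V hV
    have h3 : MDifferentiableWithinAt (𝓡 d) (𝓡 d).tangent
        (fun x ↦ (V x : TangentBundle (𝓡 d) M)) univ p :=
      ((hV.contMDiffAt (hU.mem_nhds hp)).mdifferentiableAt (by simp)).mdifferentiableWithinAt
    have h4 : DifferentiableWithinAt ℝ (chartField p V)
        ((extChartAt (𝓡 d) p).symm ⁻¹' univ ∩ range (𝓡 d)) (φ p) :=
      h3.differentiableWithinAt_mpullbackWithin_vectorField
    rwa [huniv, differentiableWithinAt_univ] at h4
  have hev : ∀ {V : ∀ x : M, TangentSpace (𝓡 d) x},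
      (∀ᶠ x in 𝓝 p, θ (φ x) (chartDeriv p x (V x)) = 0) →
      ∀ᶠ y in 𝓝 (φ p), θ y (chartField p V y) = 0 := by
    intro V h
    have hc : ContinuousAt φ.symm (φ p) := φ.continuousAt_symm (φ.map_source hφp)
    have h5 : ∀ᶠ x in 𝓝 (φ.symm (φ p)), θ (φ x) (chartDeriv p x (V x)) = 0 := by
      rwa [φ.left_inv hφp]
    filter_upwards [hc.eventually h5, φ.open_target.mem_nhds (φ.map_source hφp)] with y hy hyt
    rw [hext y hyt]
    rwa [φ.right_inv hyt] at hy
  have hbr : chartDeriv p p (VectorField.mlieBracket (𝓡 d) V W p) =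
      VectorField.lieBracket ℝ (chartField p V) (chartField p W) (φ p) := by
    have hinv := isInvertible_mfderiv_extChartAt (I := 𝓡 d) (mem_extChartAt_source (I := 𝓡 d) p)
    rw [← VectorField.lieBracketWithin_univ, ← huniv]
    exact hinv.self_apply_inverse _
  rw [hbr, apply_lieBracket hθ (hdiff hV) (hdiff hW) (hev h1) (hev h2),
    hext (V := V) _ (φ.map_source hφp), hext (V := W) _ (φ.map_source hφp), φ.left_inv hφp]

end ChartTransport

/-! ### From an umbilic hypersurface to an umbilic chart -/

section UmbilicHypersurface

open Complex ComplexConjugate Heis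

variable {n : ℕ} {M : Type*} [TopologicalSpace M] [ChartedSpace (EuclideanSpace ℝ (Fin (2 * n))) M]

lemma mfderiv_clm_comp {F G : Type*} [NormedAddCommGroup F] [NormedSpace ℝ F]
    [NormedAddCommGroup G] [NormedSpace ℝ G] (L : F →L[ℝ] G) {g : M → F} {q : M}
    (hg : MDifferentiableAt (𝓡 (2 * n)) 𝓘(ℝ, F) g q) (v : TangentSpace (𝓡 (2 * n)) q) :
    mfderiv (𝓡 (2 * n)) 𝓘(ℝ, G) (fun x => L (g x)) q v =
      L (mfderiv (𝓡 (2 * n)) 𝓘(ℝ, F) g q v) := by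
  have h1 : MDifferentiableAt 𝓘(ℝ, F) 𝓘(ℝ, G) L (g q) := L.differentiableAt.mdifferentiableAt
  have h2 := mfderiv_comp q h1 hg
  rw [mfderiv_eq_fderiv, L.fderiv] at h2
  exact congrArg (fun T : TangentSpace (𝓡 (2 * n)) q →L[ℝ] G => T v) h2

/-- The rotation `(a, b, c) ↦ (-b, a, 0)` of components in the left invariant frame. -/
def rotate (n : ℕ) : Heis n →L[ℝ] Heis n :=
  (-((ContinuousLinearMap.fst ℝ _ _).comp (ContinuousLinearMap.snd ℝ _ _))).prod
    ((ContinuousLinearMap.fst ℝ _ _).prod 0)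

lemma toFrame_J (q v : Heis n) : toFrame q (J q v) = rotate n v := by
  refine Prod.ext rfl (Prod.ext rfl ?_)
  simp only [toFrame, Θ_J]
  rfl

lemma toComplex_rotate (v : Heis n) : toComplex n (rotate n v) = I • toComplex n v := by
  rw [← toComplex_J 0 v]; rfl

/-- The frame components of `J e` are a fixed rotation of those of `e`, independent of the base
point, so the horizontal part of `∇ e_{2n}` is the ordinary derivative of `N`. -/
lemma toComplex_covDeriv {f e : M → Heis n} {q : M}
    (he : MDifferentiableAt (𝓡 (2 * n)) 𝓘(ℝ, Heis n) e q) (v : TangentSpace (𝓡 (2 * n)) q) :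
    toComplex n (covDeriv f (horizontalNormal f e) q v) =
      mfderiv (𝓡 (2 * n)) 𝓘(ℝ, EuclideanSpace ℂ (Fin n)) (complexNormal e) q v := by
  have h1 : (fun x => toFrame (f x) (horizontalNormal f e x)) = fun x => rotate n (e x) :=
    funext fun x => toFrame_J _ _
  have h2 : complexNormal e = fun x => (toComplex n ∘L rotate n) (e x) :=
    funext fun x => (toComplex_rotate _).symm
  rw [covDeriv, toComplex_ofFrame, h1, h2, mfderiv_clm_comp _ he, diffAt]
  exact congrArg (toComplex n) (mfderiv_clm_comp (rotate n) he v)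

/-- Two unit characteristic fields agree up to a locally constant sign. -/
lemma IsCharField.eventually_eq_smul {f : M → Heis n} (hf : IsImmersedHypersurface f)
    {U U' : Set M} (hU : IsOpen U) (hU' : IsOpen U') (hUR : U ⊆ regularSet f) {e e' : M → Heis n}
    (he : IsCharField f U e) (he' : IsCharField f U' e') {q : M} (hq : q ∈ U) (hq' : q ∈ U') :
    ∃ s : ℝ, (s = 1 ∨ s = -1) ∧ ∀ᶠ x in 𝓝 q, e' x = s • e x := by
  set s : M → ℝ := fun x => (inner ℂ (toComplex n (e x)) (toComplex n (e' x))).re with hs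
  have key : ∀ x ∈ U ∩ U', e' x = s x • e x ∧ (s x = 1 ∨ s x = -1) := by
    rintro x ⟨hx, hx'⟩
    obtain ⟨h1, α, h2⟩ := exists_slope (hf.immersion x) (hUR hx) (he.mem x hx) (he.unit x hx)
    obtain ⟨r, hr⟩ := (mem_charLine_iff h1 h2 (he.mem x hx)).1 (he'.mem x hx')
    have h3 := he.unit x hx
    have h4 := he'.unit x hx'
    have hsr : s x = r := by
      simp only [hs]
      rw [← re_inner_toComplex] at h3
      rw [hr, map_smul, ← Complex.coe_smul, inner_smul_right, re_ofReal_mul, h3, mul_one]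
    refine ⟨by rw [hsr, hr], ?_⟩
    rw [← re_inner_toComplex] at h3 h4
    rw [hr, map_smul, ← Complex.coe_smul, inner_smul_right, inner_smul_left, conj_ofReal,
      re_ofReal_mul, re_ofReal_mul, h3] at h4
    rw [hsr]
    exact mul_self_eq_one_iff.1 (by linarith)
  have hc : ContinuousAt s q := by
    have h1 := (toComplex n).continuous.continuousAt.comp
      (he.smoothOn.continuousOn.continuousAt (hU.mem_nhds hq))
    have h2 := (toComplex n).continuous.continuousAt.comp
      (he'.smoothOn.continuousOn.continuousAt (hU'.mem_nhds hq'))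
    exact continuous_re.continuousAt.comp (h1.inner h2)
  refine ⟨s q, (key q ⟨hq, hq'⟩).2, ?_⟩
  -- The continuous function `s` takes only the values 1 and -1, which are at distance 2.
  have hlt : ∀ᶠ x in 𝓝 q, |s x - s q| < 1 := by
    have := Metric.continuousAt_iff'.1 hc 1 one_pos
    simpa [Real.dist_eq] using this
  filter_upwards [hlt, (hU.inter hU').mem_nhds ⟨hq, hq'⟩] with x hx hxU
  obtain ⟨h1, h2⟩ := key x hxU
  rw [h1]
  congr 1
  have h3 := (key q ⟨hq, hq'⟩).2
  rcases h2 with h2 | h2 <;> rcases h3 with h3 | h3 <;> rw [h2, h3] at hx ⊢ <;> norm_num at hx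

/-- The umbilicity condition in complex coordinates, with respect to a given choice of `e_n`. -/
lemma IsUmbilicAt.exists_curvature {f : M → Heis n} (hf : IsImmersedHypersurface f)
    {U : Set M} (hU : IsOpen U) (hUR : U ⊆ regularSet f) {e : M → Heis n}
    (he : IsCharField f U e) {q : M} (hq : q ∈ U) (hq' : IsUmbilicAt f q) :
    ∃ lam : ℂ, (∀ v, v ∈ tangentPlane f q ↔
      (inner ℂ (complexNormal e q) (toComplex n v)).re = lam.im * Θ (f q) v) ∧
      ∀ v, diffAt f q v ∈ xiPrime f q →
        mfderiv (𝓡 (2 * n)) 𝓘(ℝ, EuclideanSpace ℂ (Fin n)) (complexNormal e) q v =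
          lam • toComplex n (diffAt f q v) := by
  -- Umbilicity at `q` comes with its own choice `e'` of `e_n`. The curvature is computed for `e'`
  -- and then carried to the given `e` by the local sign `s`.
  obtain ⟨U', e', α, k, hU', hqU', hU'R, he', hα, -, hk⟩ := hq'
  have hmd : ∀ {U : Set M} {e : M → Heis n}, IsOpen U → IsCharField f U e → q ∈ U →
      MDifferentiableAt (𝓡 (2 * n)) 𝓘(ℝ, Heis n) e q := fun hU he hq =>
    (he.smoothOn.contMDiffAt (hU.mem_nhds hq)).mdifferentiableAt (by simp)
  have hcd := toComplex_covDeriv (f := f) (hmd hU' he' hqU')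
  have h1 : ∀ v, diffAt f q v ∈ xiPrime f q →
      mfderiv (𝓡 (2 * n)) 𝓘(ℝ, EuclideanSpace ℂ (Fin n)) (complexNormal e') q v =
        (-k + α * I : ℂ) • toComplex n (diffAt f q v) := by
    intro v hv
    have h2 := congrArg (toComplex n) (hk v hv)
    rw [shapeOp, map_add, map_neg, map_smul, map_smul, toComplex_J, hcd] at h2
    rw [add_smul, mul_smul, neg_smul, Complex.coe_smul, Complex.coe_smul, ← h2]
    abel
  obtain ⟨hn, α', hα'⟩ := exists_slope (hf.immersion q) (hU'R hqU') (he'.mem q hqU')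
    (he'.unit q hqU')
  have hαα : α = α' := by
    have h2 := (hα' _).1 hα
    rw [map_add, map_smul, toComplex_T, add_zero, map_add, Θ_T, map_smul, horizontalNormal,
      Θ_J, toComplex_J, ← Complex.coe_smul, inner_smul_right, re_ofReal_mul] at h2
    change α * (inner ℂ (complexNormal e' q) (complexNormal e' q)).re = _ at h2
    rw [inner_self_eq_norm_sq_to_K, hn] at h2
    simpa using h2
  subst hαα
  obtain ⟨s, hs, hse⟩ := he.eventually_eq_smul hf hU hU' hUR he' hq hqU'
  have hev : complexNormal e =ᶠ[𝓝 q] fun x => (s • ContinuousLinearMap.id ℝ _) (complexNormal e' x) := by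
    filter_upwards [hse] with x hx
    have hss : s * s = 1 := by rcases hs with rfl | rfl <;> norm_num
    simp only [complexNormal, hx, map_smul, _root_.smul_apply,
      ContinuousLinearMap.id_apply]
    rw [smul_comm I s, smul_smul, hss, one_smul]
  have hmd' : MDifferentiableAt (𝓡 (2 * n)) 𝓘(ℝ, EuclideanSpace ℂ (Fin n)) (complexNormal e') q := by
    have h2 : MDifferentiableAt 𝓘(ℝ, Heis n) 𝓘(ℝ, EuclideanSpace ℂ (Fin n))
        (toComplex n ∘L rotate n) (e' q) :=
      (toComplex n ∘L rotate n).differentiableAt.mdifferentiableAt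
    refine (h2.comp q (hmd hU' he' hqU')).congr_of_eventuallyEq (Filter.Eventually.of_forall ?_)
    exact fun x => (toComplex_rotate _).symm
  refine ⟨s * (-k + α * I), fun v => ?_, fun v hv => ?_⟩
  · rw [hα', hev.eq_of_nhds]
    simp only [_root_.smul_apply, ContinuousLinearMap.id_apply]
    rw [← Complex.coe_smul, inner_smul_left, conj_ofReal, re_ofReal_mul, im_ofReal_mul, mul_assoc]
    have hs0 : s ≠ 0 := by rcases hs with rfl | rfl <;> norm_num
    simp [hs0]
  · have h2 := mfderiv_clm_comp (s • ContinuousLinearMap.id ℝ _) hmd' v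
    rw [← hev.mfderiv_eq, h1 v hv] at h2
    rw [mul_smul, Complex.coe_smul]
    exact h2

variable [IsManifold (𝓡 (2 * n)) ∞ M]

/-- Every regular point of an umbilic hypersurface has a neighbourhood in its preferred chart on
which the structure equations hold. -/
theorem exists_umbilicChart (hn : 2 ≤ n) {f : M → Heis n} (hf : IsImmersedHypersurface f)
    (hu : IsUmbilicHypersurface f) {p : M} (hp : p ∈ regularSet f) :
    ∃ (U : Set M) (e : M → Heis n) (lam : EuclideanSpace ℝ (Fin (2 * n)) → ℂ), IsOpen U ∧ p ∈ U ∧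
      U ⊆ regularSet f ∧ U ⊆ (chartAt (EuclideanSpace ℝ (Fin (2 * n))) p).source ∧
      IsCharField f U e ∧
      (∀ x ∈ U, ∀ v, v ∈ tangentPlane f x ↔ (inner ℂ (complexNormal e x) (toComplex n v)).re =
        (lam (chartAt (EuclideanSpace ℝ (Fin (2 * n))) p x)).im * Θ (f x) v) ∧
      UmbilicChart ((chartAt (EuclideanSpace ℝ (Fin (2 * n))) p).target ∩
          (chartAt (EuclideanSpace ℝ (Fin (2 * n))) p).symm ⁻¹' U)
        (fun y => toComplex n (f ((chartAt (EuclideanSpace ℝ (Fin (2 * n))) p).symm y)))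
        (fun y => complexNormal e ((chartAt (EuclideanSpace ℝ (Fin (2 * n))) p).symm y)) lam
        (contactPullback (f ∘ (chartAt (EuclideanSpace ℝ (Fin (2 * n))) p).symm)) := by
  obtain ⟨U₀, e, -, -, hU₀, hpU₀, hU₀R, he₀, -⟩ := hu p hp
  set φ := chartAt (EuclideanSpace ℝ (Fin (2 * n))) p with hφ
  set U := U₀ ∩ φ.source with hUdef
  have hU : IsOpen U := hU₀.inter φ.open_source
  have hUR : U ⊆ regularSet f := inter_subset_left.trans hU₀R
  have he : IsCharField f U e := ⟨he₀.smoothOn.mono inter_subset_left,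
    fun q hq => he₀.mem q hq.1, fun q hq => he₀.unit q hq.1⟩
  -- The curvature is chosen point by point, with the irrelevant value 0 off `U`; its regularity
  -- follows afterwards from `UmbilicChart.smooth_lam`.
  have hcurv : ∀ x : M, ∃ lam : ℂ, x ∈ U → (∀ v, v ∈ tangentPlane f x ↔
      (inner ℂ (complexNormal e x) (toComplex n v)).re = lam.im * Θ (f x) v) ∧
      ∀ v, diffAt f x v ∈ xiPrime f x →
        mfderiv (𝓡 (2 * n)) 𝓘(ℝ, EuclideanSpace ℂ (Fin n)) (complexNormal e) x v =
          lam • toComplex n (diffAt f x v) := by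
    intro x
    by_cases hx : x ∈ U
    · obtain ⟨lam, h⟩ := (hu x (hUR hx)).exists_curvature hf hU hUR he hx
      exact ⟨lam, fun _ => h⟩
    · exact ⟨0, fun h => absurd h hx⟩
  choose lam₀ hlam₀ using hcurv
  have hΩ : IsOpen (φ.target ∩ φ.symm ⁻¹' U) := φ.isOpen_inter_preimage_symm hU
  have hmaps : MapsTo φ.symm (φ.target ∩ φ.symm ⁻¹' U) U := fun y hy => hy.2
  have hF : ContDiffOn ℝ ∞ (f ∘ φ.symm) (φ.target ∩ φ.symm ⁻¹' U) :=
    contDiffOn_comp_chart_symm inter_subset_left hmaps (hf.smoothOn.mono hUR)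
  have hε : ContDiffOn ℝ ∞ (e ∘ φ.symm) (φ.target ∩ φ.symm ⁻¹' U) :=
    contDiffOn_comp_chart_symm inter_subset_left hmaps he.smoothOn
  have hFd : ∀ y ∈ φ.target ∩ φ.symm ⁻¹' U, DifferentiableAt ℝ (f ∘ φ.symm) y := fun y hy =>
    (hF.contDiffAt (hΩ.mem_nhds hy)).differentiableAt (by simp)
  have hfd : ∀ x ∈ U, ∀ v, diffAt f x v = fderiv ℝ (f ∘ φ.symm) (φ x) (chartDeriv p x v) :=
    fun x hx v => mfderiv_eq_chartDeriv hx.2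
      (((hf.smoothOn.mono hUR).contMDiffAt (hU.mem_nhds hx)).mdifferentiableAt (by simp)) v
  have hNs : ContDiffOn ℝ ∞ (fun y => complexNormal e (φ.symm y)) (φ.target ∩ φ.symm ⁻¹' U) :=
    contDiffOn_const.fun_smul ((toComplex n).contDiff.comp_contDiffOn hε)
  have hNmd : ∀ x ∈ U, MDifferentiableAt (𝓡 (2 * n)) 𝓘(ℝ, EuclideanSpace ℂ (Fin n))
      (complexNormal e) x := by
    intro x hx
    have h2 : MDifferentiableAt 𝓘(ℝ, Heis n) 𝓘(ℝ, EuclideanSpace ℂ (Fin n))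
        (toComplex n ∘L rotate n) (e x) :=
      (toComplex n ∘L rotate n).differentiableAt.mdifferentiableAt
    refine (h2.comp x ((he.smoothOn.contMDiffAt (hU.mem_nhds hx)).mdifferentiableAt
      (by simp))).congr_of_eventuallyEq (Filter.Eventually.of_forall ?_)
    exact fun x => (toComplex_rotate _).symm
  have hsymm : ∀ y ∈ φ.target ∩ φ.symm ⁻¹' U, φ (φ.symm y) = y := fun y hy => φ.right_inv hy.1
  have hvec : ∀ y ∈ φ.target ∩ φ.symm ⁻¹' U, ∀ w, ∃ v, chartDeriv p (φ.symm y) v = w :=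
    fun y hy => (chartDeriv_bijective (hφ ▸ hy.2.2)).2
  have hfd' : ∀ y ∈ φ.target ∩ φ.symm ⁻¹' U, ∀ v, diffAt f (φ.symm y) v =
      fderiv ℝ (f ∘ φ.symm) y (chartDeriv p (φ.symm y) v) := fun y hy v => by
    rw [hfd _ hy.2, hsymm y hy]
  refine ⟨U, e, fun y => lam₀ (φ.symm y), hU, ⟨hpU₀, mem_chart_source _ p⟩, hUR, inter_subset_right,
    he, ?_, ?_⟩
  · intro x hx
    simp only [φ.left_inv hx.2]
    exact (hlam₀ x hx).1
  · have hslope : ∀ y ∈ φ.target ∩ φ.symm ⁻¹' U, ∀ v,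
        (inner ℂ (complexNormal e (φ.symm y)) (toComplex n (fderiv ℝ (f ∘ φ.symm) y v))).re =
          (lam₀ (φ.symm y)).im * Θ (f (φ.symm y)) (fderiv ℝ (f ∘ φ.symm) y v) := by
      intro y hy v
      obtain ⟨w, rfl⟩ := hvec y hy v
      rw [← hfd' y hy]
      exact ((hlam₀ _ hy.2).1 _).1 (LinearMap.mem_range_self _ _)
    have hz : ∀ y ∈ φ.target ∩ φ.symm ⁻¹' U, ∀ v,
        fderiv ℝ (fun y => toComplex n (f (φ.symm y))) y v =
          toComplex n (fderiv ℝ (f ∘ φ.symm) y v) :=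
      fun y hy v => fderiv_toComplex_comp (hFd y hy) v
    refine ⟨hΩ, (toComplex n).contDiff.comp_contDiffOn hF, hNs, contDiffOn_contactPullback hΩ hF,
      ?_, ?_, ?_, ?_, ?_, ?_⟩
    · exact fun y hy => (exists_slope (hf.immersion _) (hUR hy.2) (he.mem _ hy.2)
        (he.unit _ hy.2)).1
    · exact fun y hy u v => fderiv_contactPullback hΩ hF hy u v
    · intro y hy v
      rw [hz y hy, contactPullback_apply (hFd y hy)]
      exact hslope y hy v
    · intro y hy w c hwc
      obtain ⟨u, rfl, rfl⟩ := exists_toComplex_eq (f (φ.symm y)) w c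
      obtain ⟨v, rfl⟩ := ((hlam₀ _ hy.2).1 u).2 hwc
      refine ⟨chartDeriv p (φ.symm y) v, ?_, ?_⟩
      · rw [hz y hy, ← hfd' y hy]
      · rw [contactPullback_apply (hFd y hy), ← hfd' y hy]; rfl
    · intro y hy v h1 h2
      obtain ⟨w, rfl⟩ := hvec y hy v
      rw [hz y hy, ← hfd' y hy] at h2 ⊢
      rw [contactPullback_apply (hFd y hy), ← hfd' y hy] at h1
      have h3 := (hlam₀ _ hy.2).2 w ((mem_xiPrime_of_normal (hlam₀ _ hy.2).1).2 ⟨h1, h2⟩)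
      rw [← h3, mfderiv_eq_chartDeriv (hφ ▸ hy.2.2) (hNmd _ hy.2), ← hφ, hsymm y hy]
      rfl
    · intro y hy
      -- Here `n ≥ 2` enters: a linear functional on `ℂⁿ` has a nonzero kernel.
      have hlt : Module.finrank ℂ ℂ < Module.finrank ℂ (EuclideanSpace ℂ (Fin n)) := by
        rw [Module.finrank_self, finrank_euclideanSpace_fin]; omega
      have := LinearMap.ker_ne_bot_of_finrank_lt
        (f := (innerSL ℂ (complexNormal e (φ.symm y))).toLinearMap) hlt
      obtain ⟨w, hw, hw0⟩ := Submodule.exists_mem_ne_zero_of_ne_bot this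
      exact ⟨w, hw0, by simpa using hw⟩

end UmbilicHypersurface

/-! ### First integrals of `ker η` and sections of `ξ'` -/

section Potential

open Complex ComplexConjugate Heis

variable {n : ℕ} {M : Type*} [TopologicalSpace M] [ChartedSpace (EuclideanSpace ℝ (Fin (2 * n))) M]

/-- A local first integral of the distribution generated by `ξ'`. -/
structure IsCharPotential (f : M → Heis n) (U : Set M) (g : M → ℝ) : Prop where
  isOpen : IsOpen U
  subset : U ⊆ regularSet f
  smooth : ContMDiffOn (𝓡 (2 * n)) 𝓘(ℝ, ℝ) ∞ g U
  mem_iff : ∀ x ∈ U, ∀ v, Θ (f x) (diffAt f x v) = 0 →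
    (mfderiv (𝓡 (2 * n)) 𝓘(ℝ, ℝ) g x v = 0 ↔ diffAt f x v ∈ xiPrime f x)
  charLine_ne : ∀ x ∈ U, ∀ v, diffAt f x v ∈ charLine f x → v ≠ 0 →
    mfderiv (𝓡 (2 * n)) 𝓘(ℝ, ℝ) g x v ≠ 0

variable [IsManifold (𝓡 (2 * n)) ∞ M]

lemma diffAt_eq_chartDeriv {f : M → Heis n} (hf : IsImmersedHypersurface f) {p x : M}
    (hx : x ∈ (chartAt (EuclideanSpace ℝ (Fin (2 * n))) p).source) (v : TangentSpace (𝓡 (2 * n)) x) :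
    diffAt f x v = fderiv ℝ (f ∘ (chartAt (EuclideanSpace ℝ (Fin (2 * n))) p).symm)
      (chartAt (EuclideanSpace ℝ (Fin (2 * n))) p x) (chartDeriv p x v) :=
  mfderiv_eq_chartDeriv hx ((hf.contMDiff x).mdifferentiableAt (by simp)) v

lemma differentiableAt_comp_chart_symm {f : M → Heis n} (hf : IsImmersedHypersurface f) {p : M}
    {y : EuclideanSpace ℝ (Fin (2 * n))}
    (hy : y ∈ (chartAt (EuclideanSpace ℝ (Fin (2 * n))) p).target) :
    DifferentiableAt ℝ (f ∘ (chartAt (EuclideanSpace ℝ (Fin (2 * n))) p).symm) y := by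
  have h1 := (mdifferentiable_chart (I := 𝓡 (2 * n)) p).mdifferentiableAt_symm hy
  exact (((hf.contMDiff _).mdifferentiableAt (by simp)).comp y h1).differentiableAt

lemma contactPullback_chart {f : M → Heis n} (hf : IsImmersedHypersurface f) {p x : M}
    (hx : x ∈ (chartAt (EuclideanSpace ℝ (Fin (2 * n))) p).source) (v : TangentSpace (𝓡 (2 * n)) x) :
    contactPullback (f ∘ (chartAt (EuclideanSpace ℝ (Fin (2 * n))) p).symm)
      (chartAt (EuclideanSpace ℝ (Fin (2 * n))) p x) (chartDeriv p x v) =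
      Θ (f x) (diffAt f x v) := by
  rw [contactPullback_apply (differentiableAt_comp_chart_symm hf (OpenPartialHomeomorph.map_source _ hx)),
    diffAt_eq_chartDeriv hf hx, Function.comp_apply, OpenPartialHomeomorph.left_inv _ hx]

lemma fderiv_toComplex_chart {f : M → Heis n} (hf : IsImmersedHypersurface f) {p x : M}
    (hx : x ∈ (chartAt (EuclideanSpace ℝ (Fin (2 * n))) p).source) (v : TangentSpace (𝓡 (2 * n)) x) :
    fderiv ℝ (fun y => toComplex n (f ((chartAt (EuclideanSpace ℝ (Fin (2 * n))) p).symm y)))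
      (chartAt (EuclideanSpace ℝ (Fin (2 * n))) p x) (chartDeriv p x v) =
      toComplex n (diffAt f x v) := by
  rw [diffAt_eq_chartDeriv hf hx]
  exact fderiv_toComplex_comp
    (differentiableAt_comp_chart_symm hf (OpenPartialHomeomorph.map_source _ hx)) _

/-- The distribution generated by `ξ'` has first integrals near every regular point. -/
theorem exists_charPotential (hn : 2 ≤ n) {f : M → Heis n} (hf : IsImmersedHypersurface f)
    (hu : IsUmbilicHypersurface f) {p : M} (hp : p ∈ regularSet f) :
    ∃ (U : Set M) (g : M → ℝ), p ∈ U ∧ IsCharPotential f U g := by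
  obtain ⟨U, e, lam, hU, hpU, hUR, hUs, he, hT, hch⟩ := exists_umbilicChart hn hf hu hp
  set φ := chartAt (EuclideanSpace ℝ (Fin (2 * n))) p with hφ
  set η := charForm (fun y => toComplex n (f (φ.symm y))) (fun y => complexNormal e (φ.symm y)) lam
    (contactPullback (f ∘ φ.symm)) with hη
  have hφp : φ p ∈ φ.target ∩ φ.symm ⁻¹' U :=
    ⟨φ.map_source (hUs hpU), by rw [mem_preimage, φ.left_inv (hUs hpU)]; exact hpU⟩
  -- A ball is convex, so the Poincaré lemma provides a primitive `h` of the closed form `η` on it.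
  obtain ⟨r, hr, hball⟩ := Metric.isOpen_iff.1 hch.isOpen _ hφp
  have hηs : ContDiffOn ℝ ∞ η (Metric.ball (φ p) r) := hch.smooth_charForm.mono hball
  obtain ⟨h, hh⟩ := (convex_ball (φ p) r).exists_forall_hasFDerivAt_of_fderiv_symmetric
    Metric.isOpen_ball (hηs.differentiableOn (by simp)) fun y hy => hch.charForm_closed (hball hy)
  have hhs : ContDiffOn ℝ ∞ h (Metric.ball (φ p) r) := by
    rw [contDiffOn_infty_iff_fderiv_of_isOpen Metric.isOpen_ball]
    exact ⟨fun y hy => (hh y hy).differentiableAt.differentiableWithinAt,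
      hηs.congr fun y hy => (hh y hy).fderiv⟩
  set U' := φ.source ∩ φ ⁻¹' Metric.ball (φ p) r with hU'
  have hU'U : U' ⊆ U := fun x hx => by
    have := (hball hx.2).2
    rwa [mem_preimage, φ.left_inv hx.1] at this
  have hd : ∀ x ∈ U', ∀ v, mfderiv (𝓡 (2 * n)) 𝓘(ℝ, ℝ) (h ∘ φ) x v =
      -(inner ℂ (complexNormal e x) (toComplex n (diffAt f x v))).im +
        (lam (φ x)).re * Θ (f x) (diffAt f x v) := by
    intro x hx v
    have h1 : MDifferentiableAt (𝓡 (2 * n)) (𝓡 (2 * n)) φ x :=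
      (mdifferentiable_chart (I := 𝓡 (2 * n)) p).mdifferentiableAt hx.1
    have h2 := mfderiv_comp (I' := 𝓡 (2 * n)) x (hh _ hx.2).differentiableAt.mdifferentiableAt h1
    rw [mfderiv_eq_fderiv, (hh _ hx.2).fderiv] at h2
    have h3 : mfderiv (𝓡 (2 * n)) 𝓘(ℝ, ℝ) (h ∘ φ) x v = η (φ x) (chartDeriv p x v) :=
      congrArg (fun T : TangentSpace (𝓡 (2 * n)) x →L[ℝ] ℝ => T v) h2
    rw [h3, hη, charForm_apply, contactPullback_chart hf hx.1, fderiv_toComplex_chart hf hx.1,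
      φ.left_inv hx.1]
  refine ⟨U', h ∘ φ, ⟨hUs hpU, by simpa using hr⟩,
    φ.isOpen_inter_preimage Metric.isOpen_ball, hU'U.trans hUR, ?_, ?_, ?_⟩
  · have h1 : ContMDiffOn (𝓡 (2 * n)) 𝓘(ℝ, ℝ) ∞ h (Metric.ball (φ p) r) := hhs.contMDiffOn
    exact h1.comp (contMDiffOn_chart.mono inter_subset_left) fun x hx => hx.2
  · intro x hx v hv
    have h0 : mfderiv (𝓡 (2 * n)) 𝓘(ℝ, ℝ) (h ∘ φ) x v =
        -(inner ℂ (complexNormal e x) (toComplex n (diffAt f x v))).im := by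
      rw [hd x hx, hv, mul_zero, add_zero]
    rw [mem_xiPrime_of_normal (hT x (hU'U hx)), h0]
    have hre := (hT x (hU'U hx) _).1 (LinearMap.mem_range_self (diffAt f x) v)
    rw [hv, mul_zero] at hre
    exact ⟨fun h1 => ⟨hv, Complex.ext hre (neg_eq_zero.1 h1)⟩, fun h1 => neg_eq_zero.2 (by
      rw [h1.2]; rfl)⟩
  · intro x hx v hv hv0
    have hxU := hU'U hx
    have hN := hch.norm_normal (φ x) (hball hx.2)
    simp only [φ.left_inv hx.1] at hN
    obtain ⟨r, hr⟩ := (mem_charLine_iff hN (hT x hxU) (he.mem x hxU)).1 hv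
    have hr0 : r ≠ 0 := by
      rintro rfl
      rw [zero_smul] at hr
      exact hv0 ((map_eq_zero_iff _ (hf.immersion x)).1 hr)
    have hΘ := ((mem_xiTangent (hT x hxU)).1 (he.mem x hxU).1).1
    have h1 : (inner ℂ (toComplex n (e x)) (toComplex n (e x))).re = 1 := by
      rw [re_inner_toComplex]; exact he.unit x hxU
    have h2 : inner ℂ (toComplex n (e x)) (toComplex n (e x)) = 1 := by
      have h3 : ‖toComplex n (e x)‖ ^ 2 = 1 := by
        rw [← inner_self_eq_norm_sq (𝕜 := ℂ)]; exact h1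
      rw [inner_self_eq_norm_sq_to_K]
      norm_cast
      rw [h3]
      simp
    -- `η` takes the value 1 on `e`, hence `r` on `r e`.
    have h3 : mfderiv (𝓡 (2 * n)) 𝓘(ℝ, ℝ) (h ∘ φ) x v = r := by
      rw [hd x hx, hr, map_smul, map_smul, hΘ, complexNormal, ← Complex.coe_smul, inner_smul_left,
        inner_smul_right, h2]
      simp
      rfl
    rw [h3]
    exact hr0

/-- Vectors of `ξ'` extend to smooth sections of `ξ'`. -/
theorem exists_xiPrimeSection [T2Space M] (hn : 2 ≤ n) {f : M → Heis n}
    (hf : IsImmersedHypersurface f) (hu : IsUmbilicHypersurface f) {U : Set M}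
    (hUR : U ⊆ regularSet f) {p : M} (hp : p ∈ U) {v : TangentSpace (𝓡 (2 * n)) p}
    (hv : diffAt f p v ∈ xiPrime f p) : ∃ V ∈ xiPrimeSections f U, V p = v := by
  obtain ⟨U₁, e, lam, hU₁, hpU₁, hU₁R, hU₁s, he, hT, hch⟩ := exists_umbilicChart hn hf hu (hUR hp)
  set φ := chartAt (EuclideanSpace ℝ (Fin (2 * n))) p with hφ
  have hφp : φ p ∈ φ.target ∩ φ.symm ⁻¹' U₁ :=
    ⟨φ.map_source (hU₁s hpU₁), by rw [mem_preimage, φ.left_inv (hU₁s hpU₁)]; exact hpU₁⟩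
  have hv' := (mem_xiPrime_of_normal (hT p hpU₁)).1 hv
  obtain ⟨Ω, X, hΩ, hpΩ, hΩs, hX, hXp, hXh⟩ := hch.exists_horizontal_field hφp
    (v := chartDeriv p p v) (by rw [contactPullback_chart hf (hU₁s hpU₁)]; exact hv'.1)
    (by rw [fderiv_toComplex_chart hf (hU₁s hpU₁), φ.left_inv (hU₁s hpU₁)]; exact hv'.2)
  set W := φ.source ∩ φ ⁻¹' Ω with hW
  have hWo : IsOpen W := φ.isOpen_inter_preimage hΩ
  have hpW : p ∈ W := ⟨hU₁s hpU₁, hpΩ⟩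
  have hWU₁ : W ⊆ U₁ := fun x hx => by
    have := (hΩs hx.2).2
    rwa [mem_preimage, φ.left_inv hx.1] at this
  set Y : ∀ x : M, TangentSpace (𝓡 (2 * n)) x :=
    VectorField.mpullback (𝓡 (2 * n)) (𝓡 (2 * n)) φ X with hY
  have hinv : ∀ x ∈ W, (mfderiv (𝓡 (2 * n)) (𝓡 (2 * n)) φ x).IsInvertible := fun x hx =>
    ⟨(mdifferentiable_chart (I := 𝓡 (2 * n)) p).mfderiv hx.1, rfl⟩
  have hYc : ∀ x ∈ W, chartDeriv p x (Y x) = X (φ x) := fun x hx =>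
    (hinv x hx).self_apply_inverse _
  have hYs : ContMDiffOn (𝓡 (2 * n)) (𝓡 (2 * n)).tangent ∞
      (fun q => (⟨q, Y q⟩ : TangentBundle (𝓡 (2 * n)) M)) W := by
    intro x hx
    have h1 : ContMDiffAt (𝓡 (2 * n)) (𝓡 (2 * n)).tangent ∞
        (fun q => (⟨q, X q⟩ : TangentBundle (𝓡 (2 * n)) (EuclideanSpace ℝ (Fin (2 * n))))) (φ x) :=
      contMDiffAt_vectorSpace_iff_contDiffAt.2 (hX.contDiffAt (hΩ.mem_nhds hx.2))
    have h2 : ContMDiffAt (𝓡 (2 * n)) (𝓡 (2 * n)) ∞ φ x :=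
      contMDiffOn_chart.contMDiffAt (φ.open_source.mem_nhds hx.1)
    exact (h1.mpullback_vectorField_preimage h2 (hinv x hx) (by simp)).contMDiffWithinAt
  -- A bump function supported in `W` extends the local field by zero; the zero vector also lies in
  -- `ξ'`.
  obtain ⟨ψ, -, hψ⟩ := (SmoothBumpFunction.nhds_basis_tsupport (I := 𝓡 (2 * n)) p).mem_iff.1
    (hWo.mem_nhds hpW)
  have hψ1 : ψ p = 1 := ψ.eq_one
  refine ⟨fun x => ψ x • Y x, ⟨?_, fun x hx => ?_⟩, ?_⟩
  · exact (ContMDiffOn.smul_section_of_tsupport ψ.contMDiff.contMDiffOn hWo hψ hYs).contMDiffOn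
  · by_cases hxW : x ∈ W
    · rw [map_smul]
      refine Submodule.smul_mem _ _ ?_
      have hx' := hXh _ hxW.2
      rw [← hYc x hxW, contactPullback_chart hf hxW.1, fderiv_toComplex_chart hf hxW.1,
        φ.left_inv hxW.1] at hx'
      exact (mem_xiPrime_of_normal (hT x (hWU₁ hxW))).2 hx'
    · have h0 : ψ x = 0 := image_eq_zero_of_notMem_tsupport fun h => hxW (hψ h)
      simp only [h0, zero_smul, map_zero]
      exact zero_mem _
  · simp only [hψ1, one_smul]
    exact (chartDeriv_bijective (d := 2 * n) (p := p) hpW.1).1 (by rw [hYc p hpW, hXp])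

end Potential

/-! ### Smoothness and first integrals of bracket closures -/

section LieClosure

variable {d : ℕ} {M : Type*} [TopologicalSpace M] [ChartedSpace (EuclideanSpace ℝ (Fin d)) M]
  [IsManifold (𝓡 d) ∞ M]

lemma LieClosure.smoothVFOn {U : Set M} (hU : IsOpen U) {S : Set (∀ q : M, TangentSpace (𝓡 d) q)}
    (hS : ∀ V ∈ S, SmoothVFOn U V) {V : ∀ q : M, TangentSpace (𝓡 d) q} (hV : LieClosure U S V) :
    SmoothVFOn U V := by
  induction hV with
  | of V hV => exact hS V hV
  | zero => exact (Bundle.contMDiff_zeroSection ℝ (TangentSpace (𝓡 d) : M → Type _)).contMDiffOn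
  | add V W _ _ hV hW => exact ContMDiffOn.add_section hV hW
  | smul g hg V _ hV => exact ContMDiffOn.smul_section hg hV
  | bracket V W _ _ hV hW =>
    intro x hx
    have : IsManifold (𝓡 d) (∞ + 1) M := ‹IsManifold (𝓡 d) ∞ M›
    have : IsManifold (𝓡 d) (minSmoothness ℝ 2) M := by
      rw [minSmoothness_of_isRCLikeNormedField]
      exact IsManifold.of_le (n := ∞) (by norm_cast)
    exact (ContMDiffAt.mlieBracket_vectorField (n := (⊤ : ℕ∞)) (m := (⊤ : ℕ∞)) (hV.contMDiffAt (hU.mem_nhds hx))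
      (hW.contMDiffAt (hU.mem_nhds hx)) (by simp)).contMDiffWithinAt

/-- A first integral of a family of vector fields is a first integral of its bracket closure. -/
lemma LieClosure.mfderiv_eq_zero {U U' : Set M} (hU : IsOpen U) (hU' : IsOpen U')
    {S : Set (∀ q : M, TangentSpace (𝓡 d) q)} (hS : ∀ V ∈ S, SmoothVFOn U V) {g : M → ℝ}
    (hg : ContMDiffOn (𝓡 d) 𝓘(ℝ, ℝ) ∞ g U')
    (h0 : ∀ V ∈ S, ∀ x ∈ U ∩ U', mfderiv (𝓡 d) 𝓘(ℝ, ℝ) g x (V x) = 0)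
    {V : ∀ q : M, TangentSpace (𝓡 d) q} (hV : LieClosure U S V) {x : M} (hx : x ∈ U ∩ U') :
    mfderiv (𝓡 d) 𝓘(ℝ, ℝ) g x (V x) = 0 := by
  -- The point varies because the bracket case needs the vanishing in a neighbourhood.
  induction hV generalizing x with
  | of V hV => exact h0 V hV x hx
  | zero => exact map_zero _
  | add V W _ _ hV hW => rw [map_add, hV hx, hW hx]; exact add_zero _
  | smul r hr V _ hV => rw [map_smul, hV hx]; exact smul_zero _
  | bracket V W hV₀ hW₀ hV hW =>
    set φ := chartAt (EuclideanSpace ℝ (Fin d)) x with hφ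
    have hxφ : x ∈ φ.source := mem_chart_source _ x
    have hmd : ∀ y ∈ U', MDifferentiableAt (𝓡 d) 𝓘(ℝ, ℝ) g y := fun y hy =>
      (hg.contMDiffAt (hU'.mem_nhds hy)).mdifferentiableAt (by simp)
    have hΩ : IsOpen (φ.target ∩ φ.symm ⁻¹' U') := φ.isOpen_inter_preimage_symm hU'
    have hgs : ContDiffOn ℝ ∞ (g ∘ φ.symm) (φ.target ∩ φ.symm ⁻¹' U') :=
      contDiffOn_comp_chart_symm inter_subset_left (fun y hy => hy.2) hg
    have hφx : φ x ∈ φ.target ∩ φ.symm ⁻¹' U' :=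
      ⟨φ.map_source hxφ, by rw [mem_preimage, φ.left_inv hxφ]; exact hx.2⟩
    have hev : ∀ {V : ∀ q : M, TangentSpace (𝓡 d) q},
        (∀ {y}, y ∈ U ∩ U' → mfderiv (𝓡 d) 𝓘(ℝ, ℝ) g y (V y) = 0) →
        ∀ᶠ y in 𝓝 x, fderiv ℝ (g ∘ φ.symm) (φ y) (chartDeriv x y (V y)) = 0 := by
      intro V hV
      filter_upwards [(hU.inter hU').mem_nhds hx, φ.open_source.mem_nhds hxφ] with y hy hyφ
      rw [← mfderiv_eq_chartDeriv hyφ (hmd y hy.2)]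
      exact hV hy
    have h1 := apply_mlieBracket hU hx.1 (hV₀.smoothVFOn hU hS) (hW₀.smoothVFOn hU hS)
      (((contDiffOn_fderiv hΩ hgs).contDiffAt (hΩ.mem_nhds hφx)).differentiableAt (by simp))
      (hev hV) (hev hW)
    -- `dg` is closed: the Hessian of `g` in the chart is symmetric.
    rw [fderiv_fderiv_comm hΩ hgs hφx, sub_self] at h1
    rw [mfderiv_eq_chartDeriv hxφ (hmd x hx.2)]
    exact h1

end LieClosure

/-! ### The bracket of sections of `ξ'` modulo `ξ` -/

section Bracket

open Complex ComplexConjugate Heis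

variable {n : ℕ} {M : Type*} [TopologicalSpace M] [ChartedSpace (EuclideanSpace ℝ (Fin (2 * n))) M]

/-- For `n ≥ 2` there is `w ≠ 0` orthogonal to the normal, and `Im ⟨w, iw⟩ = ‖w‖²`. -/
lemma exists_im_inner_ne_zero (hn : 2 ≤ n) {f : M → Heis n} {p : M}
    (hf : Function.Injective (diffAt f p)) (hp : p ∈ regularSet f) :
    ∃ u v, diffAt f p u ∈ xiPrime f p ∧ diffAt f p v ∈ xiPrime f p ∧
      (inner ℂ (toComplex n (diffAt f p u)) (toComplex n (diffAt f p v))).im ≠ 0 := by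
  obtain ⟨ν, β, -, hT⟩ := exists_unit_normal (f p) (tangentPlane f p) (finrank_tangentPlane hf) hp
  have hlt : Module.finrank ℂ ℂ < Module.finrank ℂ (EuclideanSpace ℂ (Fin n)) := by
    rw [Module.finrank_self, finrank_euclideanSpace_fin]; omega
  obtain ⟨w, hw, hw0⟩ := Submodule.exists_mem_ne_zero_of_ne_bot
    (LinearMap.ker_ne_bot_of_finrank_lt (f := (innerSL ℂ ν).toLinearMap) hlt)
  have hw' : inner ℂ ν w = 0 := by simpa using hw
  have key : ∀ a : ℂ, ∃ u, diffAt f p u ∈ xiPrime f p ∧ toComplex n (diffAt f p u) = a • w := by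
    intro a
    obtain ⟨z, hz, hz0⟩ := exists_toComplex_eq (f p) (a • w) 0
    have h1 : inner ℂ ν (toComplex n z) = 0 := by rw [hz, inner_smul_right, hw', mul_zero]
    obtain ⟨u, rfl⟩ : z ∈ tangentPlane f p := by rw [hT, h1, hz0]; simp
    exact ⟨u, (mem_xiPrime_of_normal hT).2 ⟨hz0, h1⟩, hz⟩
  obtain ⟨u, hu, hu'⟩ := key 1
  obtain ⟨v, hv, hv'⟩ := key I
  refine ⟨u, v, hu, hv, ?_⟩
  rw [hu', hv', one_smul, inner_smul_right, inner_self_eq_norm_sq_to_K]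
  simpa [← ofReal_pow] using hw0

/-- Both fields lie in `ker Θ`, so `Θ [V, W] = dΘ (W, V)`. -/
lemma Θ_mlieBracket [IsManifold (𝓡 (2 * n)) ∞ M] {f : M → Heis n} (hf : IsImmersedHypersurface f)
    {U : Set M} (hU : IsOpen U) (hUR : U ⊆ regularSet f)
    {V W : ∀ q : M, TangentSpace (𝓡 (2 * n)) q} (hV : V ∈ xiPrimeSections f U)
    (hW : W ∈ xiPrimeSections f U) {x : M} (hx : x ∈ U) :
    Θ (f x) (diffAt f x (VectorField.mlieBracket (𝓡 (2 * n)) V W x)) =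
      2 * (inner ℂ (toComplex n (diffAt f x (W x))) (toComplex n (diffAt f x (V x)))).im := by
  set φ := chartAt (EuclideanSpace ℝ (Fin (2 * n))) x with hφ
  have hxφ : x ∈ φ.source := mem_chart_source _ x
  have hΩ : IsOpen (φ.target ∩ φ.symm ⁻¹' U) := φ.isOpen_inter_preimage_symm hU
  have hF : ContDiffOn ℝ ∞ (f ∘ φ.symm) (φ.target ∩ φ.symm ⁻¹' U) :=
    contDiffOn_comp_chart_symm inter_subset_left (fun y hy => hy.2) (hf.smoothOn.mono hUR)
  have hφx : φ x ∈ φ.target ∩ φ.symm ⁻¹' U :=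
    ⟨φ.map_source hxφ, by rw [mem_preimage, φ.left_inv hxφ]; exact hx⟩
  have hev : ∀ {V : ∀ q : M, TangentSpace (𝓡 (2 * n)) q}, V ∈ xiPrimeSections f U →
      ∀ᶠ y in 𝓝 x, contactPullback (f ∘ φ.symm) (φ y) (chartDeriv x y (V y)) = 0 := by
    intro V hV
    filter_upwards [hU.mem_nhds hx, φ.open_source.mem_nhds hxφ] with y hy hyφ
    rw [contactPullback_chart hf hyφ]
    exact (hV.2 y hy).1.1
  have h1 := apply_mlieBracket hU hx hV.1 hW.1
    (((contDiffOn_contactPullback hΩ hF).contDiffAt (hΩ.mem_nhds hφx)).differentiableAt (by simp))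
    (hev hV) (hev hW)
  rw [contactPullback_chart hf hxφ, fderiv_contactPullback hΩ hF hφx] at h1
  rw [h1, ← fderiv_toComplex_chart hf hxφ, ← fderiv_toComplex_chart hf hxφ]
  rfl

end Bracket

/-! ### The bracket closure equals the kernel of the first integral -/

section Rank

open Complex ComplexConjugate Heis

variable {n : ℕ} {M : Type*} [TopologicalSpace M] [ChartedSpace (EuclideanSpace ℝ (Fin (2 * n))) M]

lemma exists_mem_charLine {f : M → Heis n} (hu : IsUmbilicHypersurface f) {p : M}
    (hp : p ∈ regularSet f) : ∃ v, diffAt f p v ∈ charLine f p ∧ v ≠ 0 := by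
  obtain ⟨U, e, -, -, -, hpU, -, he, -⟩ := hu p hp
  obtain ⟨v, hv⟩ := (he.mem p hpU).1.2
  refine ⟨v, hv ▸ he.mem p hpU, ?_⟩
  rintro rfl
  have h := he.unit p hpU
  rw [← hv, map_zero] at h
  simp [G] at h

lemma IsCharPotential.finrank_ker {f : M → Heis n} (hu : IsUmbilicHypersurface f) {U : Set M}
    {g : M → ℝ} (hg : IsCharPotential f U g) {p : M} (hp : p ∈ U) :
    Module.finrank ℝ (LinearMap.ker (mfderiv (𝓡 (2 * n)) 𝓘(ℝ, ℝ) g p).toLinearMap) =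
      2 * n - 1 := by
  obtain ⟨v, hv, hv0⟩ := exists_mem_charLine hu (hg.subset hp)
  set ℓ : EuclideanSpace ℝ (Fin (2 * n)) →ₗ[ℝ] ℝ :=
    (mfderiv (𝓡 (2 * n)) 𝓘(ℝ, ℝ) g p).toLinearMap with hℓ
  have h0 : ℓ ≠ 0 := fun h => hg.charLine_ne p hp v hv hv0 (congrArg (fun T => T v) h)
  have h1 := Module.Dual.finrank_ker_add_one_of_ne_zero h0
  rw [finrank_euclideanSpace_fin] at h1
  have h2 : Module.finrank ℝ (LinearMap.ker ℓ) = 2 * n - 1 := by omega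
  exact h2

/-- The characteristic line is transversal to the distribution generated by `ξ'`. -/
lemma IsCharPotential.isCompl {f : M → Heis n} (hu : IsUmbilicHypersurface f) {U : Set M}
    {g : M → ℝ} (hg : IsCharPotential f U g) {p : M} (hp : p ∈ U) :
    IsCompl ((charLine f p).comap (diffAt f p))
      (LinearMap.ker (mfderiv (𝓡 (2 * n)) 𝓘(ℝ, ℝ) g p).toLinearMap) := by
  obtain ⟨e, he, he0⟩ := exists_mem_charLine hu (hg.subset hp)
  set ℓ : TangentSpace (𝓡 (2 * n)) p →ₗ[ℝ] ℝ :=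
    (mfderiv (𝓡 (2 * n)) 𝓘(ℝ, ℝ) g p).toLinearMap with hℓ
  have hℓe : ℓ e ≠ 0 := hg.charLine_ne p hp e he he0
  constructor
  · rw [Submodule.disjoint_def]
    intro v hv hv'
    by_contra hv0
    exact hg.charLine_ne p hp v hv hv0 hv'
  · rw [codisjoint_iff, eq_top_iff]
    intro v _
    rw [Submodule.mem_sup]
    refine ⟨(ℓ v / ℓ e) • e, Submodule.smul_mem _ _ he, v - (ℓ v / ℓ e) • e, ?_,
      add_sub_cancel _ _⟩
    change ℓ (v - (ℓ v / ℓ e) • e) = 0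
    rw [map_sub, map_smul, smul_eq_mul, div_mul_cancel₀ _ hℓe, sub_self]

variable [IsManifold (𝓡 (2 * n)) ∞ M]

/-- Otherwise the bilinear form `Im ⟨·, ·⟩` would vanish on a family spanning `ξ'`, hence on all of
`ξ'`. -/
lemma exists_Θ_mlieBracket_ne_zero (hn : 2 ≤ n) {f : M → Heis n} (hf : IsImmersedHypersurface f)
    {U : Set M} (hU : IsOpen U) (hUR : U ⊆ regularSet f)
    {S : Set (∀ q : M, TangentSpace (𝓡 (2 * n)) q)} (hS : S ⊆ xiPrimeSections f U) {p : M}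
    (hp : p ∈ U) (hspan : (xiPrime f p).comap (diffAt f p) ≤
      Submodule.span ℝ ((fun V : ∀ q : M, TangentSpace (𝓡 (2 * n)) q => V p) '' S)) :
    ∃ V ∈ S, ∃ W ∈ S,
      Θ (f p) (diffAt f p (VectorField.mlieBracket (𝓡 (2 * n)) V W p)) ≠ 0 := by
  by_contra! hcon
  obtain ⟨u, v, hu, hv, huv⟩ := exists_im_inner_ne_zero hn (hf.immersion p) (hUR hp)
  refine huv (Submodule.span_induction₂ (R := ℝ)
    (p := fun u v _ _ => (inner ℂ (toComplex n (diffAt f p u)) (toComplex n (diffAt f p v))).im = 0)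
    ?_ ?_ ?_ ?_ ?_ ?_ ?_ (hspan hu) (hspan hv))
  · rintro _ _ ⟨V, hV, rfl⟩ ⟨W, hW, rfl⟩
    have h := hcon W hW V hV
    rw [Θ_mlieBracket hf hU hUR (hS hW) (hS hV) hp] at h
    linarith
  · intro x _; simp
  · intro x _; simp
  · intro x y z _ _ _ h1 h2
    rw [map_add, map_add, inner_add_left, add_im, h1, h2, add_zero]
  · intro x y z _ _ _ h1 h2
    rw [map_add, map_add, inner_add_right, add_im, h1, h2, add_zero]
  · intro r x y _ _ h
    rw [map_smul, map_smul, ← Complex.coe_smul, inner_smul_left, conj_ofReal, im_ofReal_mul, h,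
      mul_zero]
  · intro r x y _ _ h
    rw [map_smul, map_smul, ← Complex.coe_smul, inner_smul_right, im_ofReal_mul, h, mul_zero]

/-- The bracket closure of a spanning family of sections of `ξ'` is the kernel of the differential
of the first integral. -/
lemma IsCharPotential.lieClosureAt_eq_ker (hn : 2 ≤ n) {f : M → Heis n}
    (hf : IsImmersedHypersurface f) {U U' : Set M} (hU : IsOpen U) (hUR : U ⊆ regularSet f)
    {g : M → ℝ} (hg : IsCharPotential f U' g)
    {S : Set (∀ q : M, TangentSpace (𝓡 (2 * n)) q)} (hS : S ⊆ xiPrimeSections f U) {p : M}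
    (hp : p ∈ U) (hp' : p ∈ U') (hspan : (xiPrime f p).comap (diffAt f p) ≤
      Submodule.span ℝ ((fun V : ∀ q : M, TangentSpace (𝓡 (2 * n)) q => V p) '' S)) :
    lieClosureAt U S p = LinearMap.ker (mfderiv (𝓡 (2 * n)) 𝓘(ℝ, ℝ) g p).toLinearMap := by
  set ℓ : TangentSpace (𝓡 (2 * n)) p →ₗ[ℝ] ℝ :=
    (mfderiv (𝓡 (2 * n)) 𝓘(ℝ, ℝ) g p).toLinearMap with hℓ
  have hle : lieClosureAt U S p ≤ LinearMap.ker ℓ := by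
    refine Submodule.span_le.2 ?_
    rintro v ⟨V, hV, rfl⟩
    refine hV.mfderiv_eq_zero hU hg.isOpen (fun V hV => (hS hV).1) hg.smooth ?_ ⟨hp, hp'⟩
    intro V hV x hx
    have h1 := (hS hV).2 x hx.1
    exact (hg.mem_iff x hx.2 (V x) h1.1.1).2 h1
  refine le_antisymm hle fun v hv => ?_
  have hP : (xiPrime f p).comap (diffAt f p) ≤ lieClosureAt U S p := by
    refine hspan.trans (Submodule.span_mono ?_)
    rintro _ ⟨V, hV, rfl⟩
    exact ⟨V, .of V hV, rfl⟩
  obtain ⟨V, hV, W, hW, hVW⟩ := exists_Θ_mlieBracket_ne_zero hn hf hU hUR hS hp hspan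
  set b := VectorField.mlieBracket (𝓡 (2 * n)) V W p with hb
  have hbL : b ∈ lieClosureAt U S p :=
    Submodule.subset_span ⟨_, .bracket V W (.of V hV) (.of W hW), rfl⟩
  -- Subtracting `c • b` moves `v` into `ker Θ ∩ ker dg = ξ'`, which the closure contains.
  set c := Θ (f p) (diffAt f p v) / Θ (f p) (diffAt f p b) with hc
  have h1 : Θ (f p) (diffAt f p (v - c • b)) = 0 := by
    rw [map_sub, map_sub, map_smul, map_smul, smul_eq_mul, hc, div_mul_cancel₀ _ hVW, sub_self]
  have h2 : v - c • b ∈ LinearMap.ker ℓ := Submodule.sub_mem _ hv (Submodule.smul_mem _ _ (hle hbL))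
  have h3 := hP ((hg.mem_iff p hp' _ h1).1 h2)
  have h4 := Submodule.add_mem _ h3 (Submodule.smul_mem _ c hbL)
  rwa [sub_add_cancel] at h4

lemma comap_xiPrime_le_span_sections [T2Space M] (hn : 2 ≤ n) {f : M → Heis n}
    (hf : IsImmersedHypersurface f) (hu : IsUmbilicHypersurface f) {U : Set M}
    (hUR : U ⊆ regularSet f) {p : M} (hp : p ∈ U) : (xiPrime f p).comap (diffAt f p) ≤
      Submodule.span ℝ
        ((fun V : ∀ q : M, TangentSpace (𝓡 (2 * n)) q => V p) '' xiPrimeSections f U) := by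
  intro v hv
  obtain ⟨V, hV, rfl⟩ := exists_xiPrimeSection hn hf hu hUR hp hv
  exact Submodule.subset_span ⟨V, hV, rfl⟩

lemma IsOrthonormalFrame.linearIndependent {f : M → Heis n} {U : Set M}
    {e : Fin (2 * n - 2) → ∀ q : M, TangentSpace (𝓡 (2 * n)) q} (he : IsOrthonormalFrame f U e)
    {p : M} (hp : p ∈ U) : LinearIndependent ℝ fun i => e i p := by
  rw [Fintype.linearIndependent_iff]
  intro c hc j
  have h1 : inner ℂ (toComplex n (diffAt f p (e j p)))
      (toComplex n (diffAt f p (∑ i, c i • e i p))) = 0 := by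
    rw [hc, map_zero, map_zero, inner_zero_right]
  rw [map_sum, map_sum, inner_sum] at h1
  have h2 := congrArg re h1
  rw [re_sum] at h2
  have h3 : ∀ i, (inner ℂ (toComplex n (diffAt f p (e j p)))
      (toComplex n (diffAt f p (c i • e i p)))).re = c i * if j = i then 1 else 0 := by
    intro i
    rw [map_smul, map_smul, ← Complex.coe_smul, inner_smul_right, re_ofReal_mul,
      re_inner_toComplex, he.2 p hp j i]
  simp only [h3] at h2
  simpa using h2

/-- A dimension count: `ξ'` is strictly smaller than `ker dg`, because a bracket of its sections
leaves it, so it has dimension at most `2n - 2`, the number of independent frame vectors. -/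
lemma comap_xiPrime_le_span_frame [T2Space M] (hn : 2 ≤ n) {f : M → Heis n}
    (hf : IsImmersedHypersurface f) (hu : IsUmbilicHypersurface f) {U : Set M} (hU : IsOpen U)
    (hUR : U ⊆ regularSet f) {p : M} (hp : p ∈ U)
    {e : Fin (2 * n - 2) → ∀ q : M, TangentSpace (𝓡 (2 * n)) q} (he : IsOrthonormalFrame f U e) :
    (xiPrime f p).comap (diffAt f p) ≤
      Submodule.span ℝ
        ((fun V : ∀ q : M, TangentSpace (𝓡 (2 * n)) q => V p) '' range e) := by
  obtain ⟨U', g, hp', hg⟩ := exists_charPotential hn hf hu (hUR hp)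
  have hspan := comap_xiPrime_le_span_sections hn hf hu hUR hp
  have hfin : FiniteDimensional ℝ (TangentSpace (𝓡 (2 * n)) p) :=
    inferInstanceAs (FiniteDimensional ℝ (EuclideanSpace ℝ (Fin (2 * n))))
  have hlt : (xiPrime f p).comap (diffAt f p) <
      LinearMap.ker (mfderiv (𝓡 (2 * n)) 𝓘(ℝ, ℝ) g p).toLinearMap := by
    refine lt_of_le_of_ne (fun v hv => (hg.mem_iff p hp' v hv.1.1).2 hv) fun h => ?_
    obtain ⟨V, hV, W, hW, hVW⟩ := exists_Θ_mlieBracket_ne_zero hn hf hU hUR subset_rfl hp hspan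
    have h1 : VectorField.mlieBracket (𝓡 (2 * n)) V W p ∈
        lieClosureAt U (xiPrimeSections f U) p :=
      Submodule.subset_span ⟨_, .bracket V W (.of V hV) (.of W hW), rfl⟩
    rw [hg.lieClosureAt_eq_ker hn hf hU hUR subset_rfl hp hp' hspan, ← h] at h1
    exact hVW h1.1.1
  have h1 := Submodule.finrank_lt_finrank_of_lt hlt
  rw [hg.finrank_ker hu hp'] at h1
  have h2 := finrank_span_eq_card (he.linearIndependent hp)
  have h3 : (fun V : ∀ q : M, TangentSpace (𝓡 (2 * n)) q => V p) '' range e =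
      range fun i => e i p := by rw [← range_comp]; rfl
  rw [h3]
  refine (Submodule.eq_of_le_of_finrank_le (Submodule.span_le.2 ?_) ?_).ge
  · rintro _ ⟨i, rfl⟩
    exact (he.1 i).2 p hp
  · rw [h2, Fintype.card_fin]; omega

end Rank

/-! ### Charts with a prescribed coordinate, and boxes -/

section Straightening

variable {d : ℕ}

/-- A function with nonvanishing differential is a coordinate of a smooth chart. -/
lemma exists_chart_with_coordinate {Ω : Set (EuclideanSpace ℝ (Fin d))} (hΩ : IsOpen Ω)
    {h : EuclideanSpace ℝ (Fin d) → ℝ} (hh : ContDiffOn ℝ ∞ h Ω) {y₀ : EuclideanSpace ℝ (Fin d)}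
    (hy₀ : y₀ ∈ Ω) (hd : fderiv ℝ h y₀ ≠ 0) (τ : Fin d) :
    ∃ χ : OpenPartialHomeomorph (EuclideanSpace ℝ (Fin d)) (EuclideanSpace ℝ (Fin d)),
      y₀ ∈ χ.source ∧ χ.source ⊆ Ω ∧ ContDiffOn ℝ ∞ χ χ.source ∧
      ContDiffOn ℝ ∞ χ.symm χ.target ∧ ∀ y, χ y τ = h y := by
  obtain ⟨j, hj⟩ : ∃ j, fderiv ℝ h y₀ (EuclideanSpace.single j 1) ≠ 0 := by
    by_contra! hcon
    refine hd (ContinuousLinearMap.coe_injective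
      ((EuclideanSpace.basisFun (Fin d) ℝ).toBasis.ext fun j => ?_))
    simpa using hcon j
  set P : EuclideanSpace ℝ (Fin d) →L[ℝ] EuclideanSpace ℝ (Fin d) :=
    ((LinearIsometryEquiv.piLpCongrLeft 2 ℝ ℝ (Equiv.swap j τ)).toContinuousLinearEquiv :
      EuclideanSpace ℝ (Fin d) →L[ℝ] EuclideanSpace ℝ (Fin d)) with hP
  have hPi : ∀ v i, P v i = v (Equiv.swap j τ i) := fun v i => by
    simp [hP, LinearIsometryEquiv.piLpCongrLeft_apply, Equiv.piCongrLeft']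
  -- Exchange the coordinates `j` and `τ`, then put `h` in place of `y j`, which now stands at index
  -- `τ`.
  set ψ : EuclideanSpace ℝ (Fin d) → EuclideanSpace ℝ (Fin d) := fun y =>
    P y + (h y - y j) • EuclideanSpace.single τ (1 : ℝ) with hψ
  have hψτ : ∀ y, ψ y τ = h y := fun y => by simp [hψ, hPi]
  -- The derivative of `ψ` is invertible throughout `Ω'`, which makes the inverse smooth on the
  -- whole target and not only near the image of `y₀`.
  set Ω' := Ω ∩ (fun y => fderiv ℝ h y (EuclideanSpace.single j 1)) ⁻¹' {0}ᶜ with hΩ'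
  have hΩo : IsOpen Ω' :=
    ((contDiffOn_fderiv hΩ hh).clm_apply contDiffOn_const).continuousOn.isOpen_inter_preimage hΩ
      isOpen_compl_singleton
  have hψs : ContDiffOn ℝ ∞ ψ Ω := by
    refine P.contDiff.contDiffOn.add ((hh.sub ?_).smul contDiffOn_const)
    exact (EuclideanSpace.proj j : EuclideanSpace ℝ (Fin d) →L[ℝ] ℝ).contDiff.contDiffOn
  have hequiv : ∀ y ∈ Ω', ∃ A : EuclideanSpace ℝ (Fin d) ≃L[ℝ] EuclideanSpace ℝ (Fin d),
      HasFDerivAt ψ (A : EuclideanSpace ℝ (Fin d) →L[ℝ] EuclideanSpace ℝ (Fin d)) y := by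
    intro y hy
    set A : EuclideanSpace ℝ (Fin d) →L[ℝ] EuclideanSpace ℝ (Fin d) :=
      P + (fderiv ℝ h y - EuclideanSpace.proj j).smulRight (EuclideanSpace.single τ (1 : ℝ)) with hA
    have hAd : HasFDerivAt ψ A y := by
      refine P.hasFDerivAt.add (HasFDerivAt.smul_const (HasFDerivAt.sub ?_ ?_) _)
      · exact ((hh.contDiffAt (hΩ.mem_nhds hy.1)).differentiableAt (by simp)).hasFDerivAt
      · exact (EuclideanSpace.proj j : EuclideanSpace ℝ (Fin d) →L[ℝ] ℝ).hasFDerivAt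
    have hAi : ∀ v i, A v i = v (Equiv.swap j τ i) + (fderiv ℝ h y v - v j) *
        (EuclideanSpace.single τ (1 : ℝ) : EuclideanSpace ℝ (Fin d)) i := fun v i => by
      simp [hA, hPi]
    have hinj : Function.Injective A.toLinearMap := by
      refine (injective_iff_map_eq_zero _).2 fun v hv => ?_
      have hv' : ∀ i, A v i = 0 := fun i => by
        rw [show A v = 0 from hv]; rfl
      have h1 : ∀ k, k ≠ j → v k = 0 := by
        intro k hk
        have h2 := hv' (Equiv.swap j τ k)
        have h3 : Equiv.swap j τ k ≠ τ := fun h =>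
          hk ((Equiv.swap j τ).injective (h.trans (Equiv.swap_apply_left j τ).symm))
        rw [hAi, Equiv.swap_apply_self] at h2
        simpa [h3] using h2
      have h2 : v = v j • EuclideanSpace.single j (1 : ℝ) := by
        ext k
        by_cases hk : k = j
        · subst hk; simp
        · simp [hk, h1 k hk]
      have h3 : fderiv ℝ h y v = 0 := by
        have := hv' τ
        rw [hAi, Equiv.swap_apply_right] at this
        simpa using this
      rw [h2, map_smul, smul_eq_mul] at h3
      rw [h2, (mul_eq_zero.1 h3).resolve_right hy.2, zero_smul]
    exact ⟨(LinearEquiv.ofInjectiveEndo A.toLinearMap hinj).toContinuousLinearEquiv, hAd⟩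
  have hy₀' : y₀ ∈ Ω' := ⟨hy₀, hj⟩
  obtain ⟨A₀, hA₀⟩ := hequiv y₀ hy₀'
  have hc := hψs.contDiffAt (hΩ.mem_nhds hy₀)
  set χ₀ := hc.toOpenPartialHomeomorph ψ hA₀ (by simp) with hχ₀
  set χ := χ₀.restrOpen Ω' hΩo with hχ
  have hχψ : ∀ y, χ y = ψ y := fun y => rfl
  have hsrc : χ.source = χ₀.source ∩ Ω' := χ₀.restrOpen_source Ω' hΩo
  refine ⟨χ, ?_, ?_, ?_, ?_, hψτ⟩
  · rw [hsrc]
    exact ⟨hc.mem_toOpenPartialHomeomorph_source hA₀ (by simp), hy₀'⟩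
  · rw [hsrc]
    exact fun y hy => hy.2.1
  · rw [hsrc]
    exact hψs.mono fun y hy => hy.2.1
  · intro z hz
    have h1 : χ.symm z ∈ Ω' := by
      have := χ.map_target hz
      rw [hsrc] at this
      exact this.2
    obtain ⟨A, hA⟩ := hequiv _ h1
    exact (χ.contDiffAt_symm hz hA (hψs.contDiffAt (hΩ.mem_nhds h1.1))).contDiffWithinAt

lemma isOpen_box (a b : Fin d → ℝ) :
    IsOpen {z : EuclideanSpace ℝ (Fin d) | ∀ i, a i < z i ∧ z i < b i} := by
  simp only [ofPred_forall, ofPred_and]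
  refine isOpen_iInter_of_finite fun i => ?_
  have hc : Continuous fun z : EuclideanSpace ℝ (Fin d) => z i :=
    (EuclideanSpace.proj i : EuclideanSpace ℝ (Fin d) →L[ℝ] ℝ).continuous
  exact (isOpen_lt continuous_const hc).inter (isOpen_lt hc continuous_const)

lemma exists_box_subset {T : Set (EuclideanSpace ℝ (Fin d))} (hT : IsOpen T)
    {c : EuclideanSpace ℝ (Fin d)} (hc : c ∈ T) : ∃ a b : Fin d → ℝ,
      c ∈ {z : EuclideanSpace ℝ (Fin d) | ∀ i, a i < z i ∧ z i < b i} ∧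
      {z : EuclideanSpace ℝ (Fin d) | ∀ i, a i < z i ∧ z i < b i} ⊆ T := by
  have h1 : IsOpen ((WithLp.toLp 2 : (Fin d → ℝ) → EuclideanSpace ℝ (Fin d)) ⁻¹' T) :=
    hT.preimage (PiLp.continuous_toLp 2 _)
  obtain ⟨r, hr, hball⟩ := Metric.isOpen_iff.1 h1 (WithLp.ofLp c) hc
  refine ⟨fun i => c i - r, fun i => c i + r, fun i => ⟨by linarith, by linarith⟩, fun z hz => ?_⟩
  refine @hball (WithLp.ofLp z) ?_
  rw [Metric.mem_ball, dist_pi_lt_iff hr]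
  intro i
  rw [Real.dist_eq, abs_lt]
  constructor <;> linarith [(hz i).1, (hz i).2]

end Straightening

/-! ### Foliated atlases from local first integrals -/

section Foliation

variable {d : ℕ} {M : Type*} [TopologicalSpace M] [ChartedSpace (EuclideanSpace ℝ (Fin d)) M]

lemma CodimOneFoliation.subset_of_mem_leaves {R : Set M} (F : CodimOneFoliation (d := d) R)
    {ℓ : Set M} (hℓ : ℓ ∈ F.leaves) : ℓ ⊆ R := by
  obtain ⟨p, hp, rfl⟩ := hℓ
  have key : ∀ {x y}, Relation.EqvGen F.SamePlaque x y → (x ∈ R ↔ y ∈ R) := by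
    intro x y h
    induction h with
    | rel x y h =>
      obtain ⟨φ, hφ, hx, hy, -⟩ := h
      exact iff_of_true (F.source_subset φ hφ hx) (F.source_subset φ hφ hy)
    | refl x => exact Iff.rfl
    | symm x y _ h => exact h.symm
    | trans x y z _ _ h1 h2 => exact h1.trans h2
  exact fun q hq => (key hq).1 hp

lemma mdifferentiableAt_coord {Φ : OpenPartialHomeomorph M (EuclideanSpace ℝ (Fin d))}
    (hΦ : Φ ∈ IsManifold.maximalAtlas (𝓡 d) ∞ M) {q : M} (hq : q ∈ Φ.source) (τ : Fin d) :
    MDifferentiableAt (𝓡 d) 𝓘(ℝ, ℝ) (fun x => Φ x τ) q := by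
  have h1 : MDifferentiableAt (𝓡 d) 𝓘(ℝ, ℝ)
      (EuclideanSpace.proj τ : EuclideanSpace ℝ (Fin d) →L[ℝ] ℝ) (Φ q) :=
    (EuclideanSpace.proj τ : EuclideanSpace ℝ (Fin d) →L[ℝ] ℝ).differentiableAt.mdifferentiableAt
  exact h1.comp q ((contMDiffAt_of_mem_maximalAtlas hΦ hq).mdifferentiableAt (by simp))

/-- If the differentials of coordinates of two charts have the same kernels, then one coordinate is
locally a function of the other. -/
lemma coord_eq_of_ker_eq {Φ Ψ : OpenPartialHomeomorph M (EuclideanSpace ℝ (Fin d))} {τ : Fin d}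
    (hΦ : Φ ∈ IsManifold.maximalAtlas (𝓡 d) ∞ M) (hΨ : Ψ ∈ IsManifold.maximalAtlas (𝓡 d) ∞ M)
    (hker : ∀ q ∈ Φ.source ∩ Ψ.source, ∀ v,
      mfderiv (𝓡 d) 𝓘(ℝ, ℝ) (fun x => Φ x τ) q v = 0 →
      mfderiv (𝓡 d) 𝓘(ℝ, ℝ) (fun x => Ψ x τ) q v = 0)
    {p : M} (hp : p ∈ Φ.source ∩ Ψ.source) :
    ∃ W ∈ 𝓝 p, ∀ q ∈ W, ∀ q' ∈ W, Φ q τ = Φ q' τ → Ψ q τ = Ψ q' τ := by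
  have hΩ : IsOpen (Φ.target ∩ Φ.symm ⁻¹' Ψ.source) := Φ.isOpen_inter_preimage_symm Ψ.open_source
  obtain ⟨r, hr, hball⟩ := Metric.isOpen_iff.1 hΩ (Φ p)
    ⟨Φ.map_source hp.1, by rw [mem_preimage, Φ.left_inv hp.1]; exact hp.2⟩
  set F : EuclideanSpace ℝ (Fin d) → ℝ := fun y => Ψ (Φ.symm y) τ with hF
  have hmd : ∀ y ∈ Metric.ball (Φ p) r, MDifferentiableAt (𝓡 d) (𝓡 d) Φ.symm y := fun y hy =>
    (contMDiffAt_symm_of_mem_maximalAtlas hΦ (hball hy).1).mdifferentiableAt (by simp)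
  have hcomp : ∀ {Ψ : OpenPartialHomeomorph M (EuclideanSpace ℝ (Fin d))},
      Ψ ∈ IsManifold.maximalAtlas (𝓡 d) ∞ M → ∀ y ∈ Metric.ball (Φ p) r, Φ.symm y ∈ Ψ.source →
      HasFDerivAt (fun y => Ψ (Φ.symm y) τ) (fderiv ℝ (fun y => Ψ (Φ.symm y) τ) y) y ∧ ∀ v,
      fderiv ℝ (fun y => Ψ (Φ.symm y) τ) y v =
        mfderiv (𝓡 d) 𝓘(ℝ, ℝ) (fun x => Ψ x τ) (Φ.symm y)
          (mfderiv (𝓡 d) (𝓡 d) Φ.symm y v) := by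
    intro Ψ hΨ y hy hy'
    have h1 := mdifferentiableAt_coord hΨ hy' τ
    have h2 := h1.comp y (hmd y hy)
    have h3 := mfderiv_comp y h1 (hmd y hy)
    refine ⟨h2.differentiableAt.hasFDerivAt, fun v => ?_⟩
    rw [← mfderiv_eq_fderiv]
    exact congrArg (fun T : EuclideanSpace ℝ (Fin d) →L[ℝ] ℝ => T v) h3
  refine ⟨Φ.source ∩ Φ ⁻¹' Metric.ball (Φ p) r,
    (Φ.isOpen_inter_preimage Metric.isOpen_ball).mem_nhds ⟨hp.1, Metric.mem_ball_self hr⟩, ?_⟩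
  intro q hq q' hq' hqq
  -- Mean value theorem on the segment from `Φ q` to `Φ q'`. Its direction lies in the kernel of the
  -- `τ`-th coordinate, hence in that of `dF`.
  obtain ⟨z, hz, hz'⟩ := domain_mvt (f := F) (f' := fun y => fderiv ℝ F y)
    (fun y hy => (hcomp hΨ y hy (hball hy).2).1.hasFDerivWithinAt)
    (convex_ball (Φ p) r) hq.2 hq'.2
  have hzb : z ∈ Metric.ball (Φ p) r := (convex_ball (Φ p) r).segment_subset hq.2 hq'.2 hz
  have hzΦ : Φ.symm z ∈ Φ.source := Φ.map_target (hball hzb).1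
  have h1 : fderiv ℝ (fun y => Φ (Φ.symm y) τ) z (Φ q' - Φ q) = 0 := by
    have h2 : (fun y => Φ (Φ.symm y) τ) =ᶠ[𝓝 z]
        (EuclideanSpace.proj τ : EuclideanSpace ℝ (Fin d) →L[ℝ] ℝ) := by
      filter_upwards [Φ.open_target.mem_nhds (hball hzb).1] with y hy
      rw [Φ.right_inv hy]; rfl
    rw [h2.fderiv_eq, ContinuousLinearMap.fderiv]
    simp [hqq]
  rw [(hcomp hΦ z hzb hzΦ).2] at h1
  have h2 := hker _ ⟨hzΦ, (hball hzb).2⟩ _ h1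
  rw [(hcomp hΨ z hzb (hball hzb).2).2] at hz'
  have h3 : F (Φ q') - F (Φ q) = 0 := hz'.trans h2
  simp only [hF, Φ.left_inv hq.1, Φ.left_inv hq'.1] at h3
  linarith

variable [IsManifold (𝓡 d) ∞ M]

/-- A smooth function with nonvanishing differential is the transverse coordinate of a chart onto
a box. -/
lemma exists_box_chart {U : Set M} (hU : IsOpen U) {g : M → ℝ}
    (hg : ContMDiffOn (𝓡 d) 𝓘(ℝ, ℝ) ∞ g U) {p : M} (hp : p ∈ U)
    (hd : mfderiv (𝓡 d) 𝓘(ℝ, ℝ) g p ≠ 0) (τ : Fin d) :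
    ∃ Φ ∈ IsManifold.maximalAtlas (𝓡 d) ∞ M, p ∈ Φ.source ∧ Φ.source ⊆ U ∧
      (∃ a b : Fin d → ℝ, Φ.target = {z | ∀ i, a i < z i ∧ z i < b i}) ∧
      ∀ q ∈ Φ.source, Φ q τ = g q := by
  set φ := chartAt (EuclideanSpace ℝ (Fin d)) p with hφ
  have hpφ : p ∈ φ.source := mem_chart_source _ p
  have hΩ : IsOpen (φ.target ∩ φ.symm ⁻¹' U) := φ.isOpen_inter_preimage_symm hU
  have hgs : ContDiffOn ℝ ∞ (g ∘ φ.symm) (φ.target ∩ φ.symm ⁻¹' U) :=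
    contDiffOn_comp_chart_symm inter_subset_left (fun y hy => hy.2) hg
  have hφp : φ p ∈ φ.target ∩ φ.symm ⁻¹' U :=
    ⟨φ.map_source hpφ, by rw [mem_preimage, φ.left_inv hpφ]; exact hp⟩
  have hd' : fderiv ℝ (g ∘ φ.symm) (φ p) ≠ 0 := by
    intro h0
    refine hd (ContinuousLinearMap.ext fun v => ?_)
    rw [mfderiv_eq_chartDeriv hpφ ((hg.contMDiffAt (hU.mem_nhds hp)).mdifferentiableAt (by simp)),
      ← hφ, h0]
    rfl
  obtain ⟨χ, hpχ, hχΩ, hχs, hχs', hχτ⟩ := exists_chart_with_coordinate hΩ hgs hφp hd' τ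
  set Φ₀ := φ.trans χ with hΦ₀
  have hp₀ : p ∈ Φ₀.source := by
    rw [hΦ₀, OpenPartialHomeomorph.trans_source]; exact ⟨hpφ, hpχ⟩
  obtain ⟨a, b, hab, hbox⟩ := exists_box_subset Φ₀.open_target (Φ₀.map_source hp₀)
  -- Restriction of the inverse, so that the target rather than the source is cut down to the box.
  set Φ := (Φ₀.symm.restrOpen _ (isOpen_box a b)).symm with hΦ
  have htgt : Φ.target = {z | ∀ i, a i < z i ∧ z i < b i} := by
    change (Φ₀.symm.restrOpen _ (isOpen_box a b)).source = _
    rw [OpenPartialHomeomorph.restrOpen_source]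
    exact inter_eq_right.2 hbox
  have hle : ∀ q ∈ Φ.source, q ∈ Φ₀.source := by
    intro q hq
    have h1 := Φ.map_source hq
    rw [htgt] at h1
    have h2 := Φ₀.map_target (hbox h1)
    have h3 : Φ.symm (Φ q) = q := Φ.left_inv hq
    have h4 : Φ.symm (Φ q) = Φ₀.symm (Φ q) := rfl
    rwa [← h4, h3] at h2
  have hsrc : ∀ q ∈ Φ.source, q ∈ φ.source ∧ φ q ∈ χ.source := by
    intro q hq
    have := hle q hq
    rwa [hΦ₀, OpenPartialHomeomorph.trans_source] at this
  have htg : ∀ z ∈ Φ.target, z ∈ χ.target ∧ χ.symm z ∈ φ.target := by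
    intro z hz
    rw [htgt] at hz
    have := hbox hz
    rwa [hΦ₀, OpenPartialHomeomorph.trans_target] at this
  refine ⟨Φ, ?_, ?_, ?_, ⟨a, b, htgt⟩, ?_⟩
  · refine Φ.mem_maximalAtlas_of_contMDiffOn ?_ ?_
    · have h1 : ContMDiffOn (𝓡 d) (𝓡 d) ∞ χ χ.source := hχs.contMDiffOn
      exact h1.comp (contMDiffOn_chart.mono fun q hq => (hsrc q hq).1) fun q hq => (hsrc q hq).2
    · have h1 : ContMDiffOn (𝓡 d) (𝓡 d) ∞ χ.symm χ.target := hχs'.contMDiffOn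
      have h2 : ContMDiffOn (𝓡 d) (𝓡 d) ∞ φ.symm φ.target := contMDiffOn_chart_symm
      exact h2.comp (h1.mono fun z hz => (htg z hz).1) fun z hz => (htg z hz).2
  · have h1 : Φ.symm (Φ₀ p) ∈ Φ.source := Φ.map_target (by rw [htgt]; exact hab)
    have h2 : Φ.symm (Φ₀ p) = p := Φ₀.left_inv hp₀
    rwa [h2] at h1
  · intro q hq
    have h1 := (hχΩ (hsrc q hq).2).2
    rwa [mem_preimage, φ.left_inv (hsrc q hq).1] at h1
  · intro q hq
    have h1 : Φ q τ = (g ∘ φ.symm) (φ q) := hχτ (φ q)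
    rw [h1, Function.comp_apply, φ.left_inv (hsrc q hq).1]

/-- A distribution which is locally the kernel of the differential of a function is tangent to a
foliation. -/
theorem exists_codimOneFoliation {R : Set M} (D : ∀ p : M, Submodule ℝ (TangentSpace (𝓡 d) p))
    (hD : ∀ p ∈ R, ∃ (U : Set M) (g : M → ℝ), IsOpen U ∧ p ∈ U ∧ U ⊆ R ∧
      ContMDiffOn (𝓡 d) 𝓘(ℝ, ℝ) ∞ g U ∧ ∀ x ∈ U, mfderiv (𝓡 d) 𝓘(ℝ, ℝ) g x ≠ 0 ∧
        LinearMap.ker (mfderiv (𝓡 d) 𝓘(ℝ, ℝ) g x).toLinearMap = D x) (τ : Fin d) :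
    ∃ F : CodimOneFoliation (d := d) R, ∀ p ∈ R, F.tangent p = D p := by
  -- All box charts whose `τ`-th coordinate has `D` as kernel: the intersection defining the leaf
  -- tangent is then one of equal subspaces.
  set charts : Set (OpenPartialHomeomorph M (EuclideanSpace ℝ (Fin d))) :=
    {φ | φ ∈ IsManifold.maximalAtlas (𝓡 d) ∞ M ∧ φ.source ⊆ R ∧
      (∃ a b : Fin d → ℝ, φ.target = {z | ∀ i, a i < z i ∧ z i < b i}) ∧
      ∀ q ∈ φ.source,
        LinearMap.ker (mfderiv (𝓡 d) 𝓘(ℝ, ℝ) (fun x => φ x τ) q).toLinearMap = D q} with hcharts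
  have hcover : ∀ p ∈ R, ∃ φ ∈ charts, p ∈ φ.source := by
    intro p hp
    obtain ⟨U, g, hU, hpU, hUR, hg, hgD⟩ := hD p hp
    obtain ⟨Φ, hΦ, hpΦ, hΦU, hbox, hΦg⟩ := exists_box_chart hU hg hpU (hgD p hpU).1 τ
    refine ⟨Φ, ⟨hΦ, hΦU.trans hUR, hbox, fun q hq => ?_⟩, hpΦ⟩
    have h1 : (fun x => Φ x τ) =ᶠ[𝓝 q] g := by
      filter_upwards [Φ.open_source.mem_nhds hq] with x hx using hΦg x hx
    rw [← (hgD q (hΦU hq)).2]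
    ext v
    change mfderiv (𝓡 d) 𝓘(ℝ, ℝ) (fun x => Φ x τ) q v = 0 ↔ mfderiv (𝓡 d) 𝓘(ℝ, ℝ) g q v = 0
    rw [h1.mfderiv_eq]
    exact Iff.rfl
  refine ⟨⟨charts, τ, fun φ hφ => hφ.1, fun φ hφ => hφ.2.1, fun φ hφ => hφ.2.2.1, hcover, ?_⟩, ?_⟩
  · intro φ hφ ψ hψ p hp
    refine coord_eq_of_ker_eq hφ.1 hψ.1 (fun q hq v hv => ?_) hp
    have h1 : v ∈ D q := by rw [← hφ.2.2.2 q hq.1]; exact hv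
    rw [← hψ.2.2.2 q hq.2] at h1
    exact h1
  · intro p hp
    obtain ⟨φ, hφ, hpφ⟩ := hcover p hp
    refine le_antisymm ?_ ?_
    · refine (iInf_le_of_le φ (iInf_le_of_le hφ (iInf_le _ hpφ))).trans ?_
      exact (hφ.2.2.2 p hpφ).le
    · exact le_iInf fun ψ => le_iInf fun hψ => le_iInf fun hpψ => (hψ.2.2.2 p hpψ).ge

end Foliation

end

/-! ### The main theorem -/

theorem proposition4p3 (n : ℕ) (hn : 2 ≤ n) {M : Type*} [TopologicalSpace M] [T2Space M]
    [SecondCountableTopology M] [ChartedSpace (EuclideanSpace ℝ (Fin (2 * n))) M]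
    [IsManifold (𝓡 (2 * n)) ∞ M] (f : M → Heis n) (hf : IsImmersedHypersurface f)
    (hu : IsUmbilicHypersurface f) :
    -- the Lie-bracket closure of `ξ'`, generated over an open set by all smooth sections of `ξ'` or
    -- by the members of an orthonormal frame, has rank `2n-1`
    (∀ U : Set M, IsOpen U → U ⊆ regularSet f → ∀ p ∈ U,
      Module.finrank ℝ (lieClosureAt U (xiPrimeSections f U) p) = 2 * n - 1 ∧
      ∀ e, IsOrthonormalFrame f U e →
        Module.finrank ℝ (lieClosureAt U (Set.range e) p) = 2 * n - 1) ∧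
    -- it is tangent to a codimension-one foliation of the regular part
    ∃ F : CodimOneFoliation (d := 2 * n) (regularSet f),
      (∀ U : Set M, IsOpen U → U ⊆ regularSet f → ∀ p ∈ U,
        F.tangent p = lieClosureAt U (xiPrimeSections f U) p ∧
        ∀ e, IsOrthonormalFrame f U e → F.tangent p = lieClosureAt U (Set.range e) p) ∧
      -- the characteristic direction is transversal to every leaf
      ∀ ℓ ∈ F.leaves, ∀ p ∈ ℓ, IsCompl ((charLine f p).comap (diffAt f p)) (F.tangent p) := by
  have hsec : ∀ {U U' : Set M} {g : M → ℝ} {p : M}, IsOpen U → U ⊆ regularSet f →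
      IsCharPotential f U' g → p ∈ U → p ∈ U' → lieClosureAt U (xiPrimeSections f U) p =
        LinearMap.ker (mfderiv (𝓡 (2 * n)) 𝓘(ℝ, ℝ) g p).toLinearMap :=
    fun hU hUR hg hp hp' => hg.lieClosureAt_eq_ker hn hf hU hUR subset_rfl hp hp'
      (comap_xiPrime_le_span_sections hn hf hu hUR hp)
  have hframe : ∀ {U U' : Set M} {g : M → ℝ} {p : M}, IsOpen U → U ⊆ regularSet f →
      IsCharPotential f U' g → p ∈ U → p ∈ U' → ∀ e, IsOrthonormalFrame f U e →
        lieClosureAt U (Set.range e) p =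
          LinearMap.ker (mfderiv (𝓡 (2 * n)) 𝓘(ℝ, ℝ) g p).toLinearMap := by
    intro U U' g p hU hUR hg hp hp' e he
    refine hg.lieClosureAt_eq_ker hn hf hU hUR ?_ hp hp'
      (comap_xiPrime_le_span_frame hn hf hu hU hUR hp he)
    rintro _ ⟨i, rfl⟩
    exact he.1 i
  -- Openness is needed to take the closure over the whole regular part, which defines the
  -- distribution; near each point it is the same kernel as the closure over any smaller `U`.
  have hR : IsOpen (regularSet f) := by
    rw [isOpen_iff_mem_nhds]
    intro p hp
    obtain ⟨U, g, hpU, hg⟩ := exists_charPotential hn hf hu hp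
    exact Filter.mem_of_superset (hg.isOpen.mem_nhds hpU) hg.subset
  obtain ⟨F, hF⟩ := exists_codimOneFoliation (R := regularSet f)
    (fun p => lieClosureAt (regularSet f) (xiPrimeSections f (regularSet f)) p)
    (fun p hp => by
      obtain ⟨U, g, hpU, hg⟩ := exists_charPotential hn hf hu hp
      refine ⟨U, g, hg.isOpen, hpU, hg.subset, hg.smooth, fun x hx => ⟨fun h0 => ?_,
        (hsec hR subset_rfl hg (hg.subset hx) hx).symm⟩⟩
      obtain ⟨v, hv, hv0⟩ := exists_mem_charLine hu (hg.subset hx)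
      refine hg.charLine_ne x hx v hv hv0 ?_
      rw [h0]
      rfl) ⟨0, by omega⟩
  refine ⟨fun U hU hUR p hp => ?_, F, fun U hU hUR p hp => ?_, fun ℓ hℓ p hpℓ => ?_⟩
  · obtain ⟨U', g, hp', hg⟩ := exists_charPotential hn hf hu (hUR hp)
    refine ⟨?_, fun e he => ?_⟩
    · rw [hsec hU hUR hg hp hp', hg.finrank_ker hu hp']
    · rw [hframe hU hUR hg hp hp' e he, hg.finrank_ker hu hp']
  · obtain ⟨U', g, hp', hg⟩ := exists_charPotential hn hf hu (hUR hp)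
    rw [hF p (hUR hp), hsec hR subset_rfl hg (hUR hp) hp']
    exact ⟨(hsec hU hUR hg hp hp').symm, fun e he => (hframe hU hUR hg hp hp' e he).symm⟩
  · have hp := F.subset_of_mem_leaves hℓ hpℓ
    obtain ⟨U', g, hp', hg⟩ := exists_charPotential hn hf hu hp
    rw [hF p hp, hsec hR subset_rfl hg hp hp']
    exact hg.isCompl hu hp'
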